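/- **Theorem 3.9.** Let $p,q,r\ge 1$ be pairwise relatively prime integers with $p$ and $q$ odd, let $\Sigma(p,q,r)=\{(x,y,z)\in\mathbb C^3 : x^p+y^q+z^r=0\}\cap S^5$ be the Brieskorn sphere, and let $Z=\Sigma(p,q,r)\setminus\{z=0\}$ be the complement of its singular $r$-fiber. Let $R(Z,SU(3))=\operatorname{Hom}(\pi_1(Z),SU(3))/\text{conjugation}$ with the quotient topology. Let $R^{\mathrm{red}}$ and $R^{\mathrm{ab}}$ be its subspaces of conjugacy classes of nonabelian reducible representations and of abelian representations, respectively. On each of these two strata call a real function $f$ smooth at a class if, near every representative $\rho$ of it, the function $\rho\mapsto f([\rho])$ agrees, on the representations with class in that stratum, with a $C^\infty$ function of the matrix entries of $\rho(w_1),\dots,\rho(w_n)$ for finitely many $w_1,\dots,w_n\in\pi_1(Z)$. Then: 1. $R^{\mathrm{red}}$ is a smooth 2-dimensional manifold (Hausdorff, second countable, without boundary), with the smooth structure whose smooth functions on open subsets are those just described. 2. $R^{\mathrm{red}}$ has exactly $(p-1)(q-1)/4$ path components; each is open in $R^{\mathrm{red}}$ and diffeomorphic to the open cylinder $(0,1)\times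 S^1$. 3. For each path component $C$ there is a diffeomorphism $(0,1)\times S^1\to C$ which extends to a continuous map $[0,1]\times S^1\to R(Z,SU(3))$ sending $\{0\}\times S^1$ and $\{1\}\times S^1$ into $R^{\mathrm{ab}}$. Write $\gamma_0,\gamma_1\colon S^1\to R^{\mathrm{ab}}$ for the two restrictions. The closure of $C$ in $R(Z,SU(3))$ is $C\cup\gamma_0(S^1)\cup\gamma_1(S^1)$. Each $\gamma_i$ is a noninjective smooth immersion: it pulls functions smooth at $\gamma_i(\theta)$ back to functions smooth at $\theta$, and for every $\theta\in S^1$ some function smooth at $\gamma_i(\theta)$ has nonzero derivative along $\gamma_i$ at $\theta$. The combined map $\gamma_0\sqcup\gamma_1\colon S^1\sqcup S^1\to R^{\mathrm{ab}}$ takes every value at most twice, and only finitely many values twice, so its multiple points are isolated double points. -/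

import Mathlib

open Set Filter Topology TopologicalSpace
open scoped Manifold ContDiff

noncomputable section

/-- The Brieskorn manifold `Σ(p,q,r) = {x ^ p + y ^ q + z ^ r = 0} ∩ S⁵` in `ℂ³`. -/
def brieskornSphere (p q r : ℕ) : Set (Fin 3 → ℂ) :=
  {v | v 0 ^ p + v 1 ^ q + v 2 ^ r = 0 ∧ ∑ i, ‖v i‖ ^ 2 = 1}

/-- The singular `r`-fiber of `Σ(p,q,r)`: the orbit on which the third coordinate vanishes. For
pairwise coprime `p, q, r` it is the orbit with isotropy of order `r` of the circle action
`t • (x, y, z) = (t ^ (q r) x, t ^ (p r) y, t ^ (p q) z)`. -/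
def singularFiber (p q r : ℕ) : Set (Fin 3 → ℂ) :=
  {v | v ∈ brieskornSphere p q r ∧ v 2 = 0}

/-- The complement `Z` of the singular `r`-fiber in `Σ(p,q,r)`. -/
def fiberComplement (p q r : ℕ) : Set (Fin 3 → ℂ) :=
  brieskornSphere p q r \ singularFiber p q r

/-- The fundamental group `π₁(Z, z₀)`. -/
abbrev fiberGroup (p q r : ℕ) (z₀ : fiberComplement p q r) : Type :=
  FundamentalGroup (fiberComplement p q r) z₀

/-- The group `SU(3)`, with the topology induced from the complex matrices. -/
abbrev SU3 : Type := Matrix.specialUnitaryGroup (Fin 3) ℂ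

/-- `Hom(G, SU(3))`. -/
abbrev SU3Hom (G : Type) [Group G] : Type := G →* SU3

/-- `Hom(G, SU(3))` carries the topology of pointwise convergence. -/
instance SU3Hom.instTopologicalSpace (G : Type) [Group G] : TopologicalSpace (SU3Hom G) :=
  TopologicalSpace.induced (fun (ρ : SU3Hom G) (g : G) => ρ g) inferInstance

/-- Conjugacy of representations by elements of `SU(3)`. -/
instance SU3Hom.conjSetoid (G : Type) [Group G] : Setoid (SU3Hom G) where
  r ρ σ := ∃ a : SU3, ∀ g : G, σ g = a * ρ g * a⁻¹
  iseqv :=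
    { refl := fun ρ => ⟨1, fun g => by simp⟩
      symm := by
        rintro ρ σ ⟨a, ha⟩
        exact ⟨a⁻¹, fun g => by rw [ha g]; group⟩
      trans := by
        rintro ρ σ τ ⟨a, ha⟩ ⟨b, hb⟩
        exact ⟨b * a, fun g => by rw [hb g, ha g]; group⟩ }

/-- The representation variety `R(G, SU(3)) = Hom(G, SU(3)) / conjugation`, with the quotient
topology. -/
abbrev RepVariety (G : Type) [Group G] : Type := Quotient (SU3Hom.conjSetoid G)

/-- The conjugacy class `[ρ]`. -/
def repClass {G : Type} [Group G] (ρ : SU3Hom G) : RepVariety G := Quotient.mk _ ρ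

/-- A representation is abelian if its image is commutative. -/
def SU3Hom.IsAbelian {G : Type} [Group G] (ρ : SU3Hom G) : Prop :=
  ∀ g h : G, ρ g * ρ h = ρ h * ρ g

/-- A representation is reducible if some proper nonzero subspace of `ℂ³` is invariant. -/
def SU3Hom.IsReducible {G : Type} [Group G] (ρ : SU3Hom G) : Prop :=
  ∃ W : Submodule ℂ (Fin 3 → ℂ), W ≠ ⊥ ∧ W ≠ ⊤ ∧
    ∀ g : G, ∀ v ∈ W, (ρ g : Matrix (Fin 3) (Fin 3) ℂ).mulVec v ∈ W

/-- The stratum `R^red` of conjugacy classes of nonabelian reducible representations. -/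
def redStratum (G : Type) [Group G] : Set (RepVariety G) :=
  {c | ∃ ρ : SU3Hom G, repClass ρ = c ∧ ρ.IsReducible ∧ ¬ ρ.IsAbelian}

/-- The stratum `R^ab` of conjugacy classes of abelian representations. -/
def abStratum (G : Type) [Group G] : Set (RepVariety G) :=
  {c | ∃ ρ : SU3Hom G, repClass ρ = c ∧ ρ.IsAbelian}

/-- Smooth functions on a stratum `S` of the representation variety: `f : S → ℝ` is smooth at `c`
if the function `ρ ↦ f [ρ]`, which is defined on those representations whose class lies in `S`,
agrees near each representative of `c` with a smooth function of the matrix entries of finitely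
many `ρ (w i)`. This is the smooth structure that `S` inherits as a quotient of a subset of
`Hom(G, SU(3)) ⊆ Mat₃(ℂ) ^ G`. -/
def StratumSmoothAt {G : Type} [Group G] {S : Set (RepVariety G)} (f : S → ℝ) (c : S) : Prop :=
  ∀ ρ : SU3Hom G, repClass ρ = (c : RepVariety G) →
    ∃ (n : ℕ) (w : Fin n → G) (F : (Fin n → Fin 3 → Fin 3 → ℂ) → ℝ), ContDiff ℝ ∞ F ∧
      ∀ᶠ σ : SU3Hom G in 𝓝 ρ, ∀ hσ : repClass σ ∈ S,
        f ⟨repClass σ, hσ⟩ =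
          F (fun i j k => (σ (w i) : Matrix (Fin 3) (Fin 3) ℂ) j k)

/-- `γ : S¹ → S` is a smooth immersion for the smooth structure of the stratum `S`: it pulls smooth
functions back to smooth functions, and at every point some smooth function on `S` has nonzero
derivative along `γ` (with respect to the angle `t` of `exp (i t) ∈ S¹`). -/
structure IsImmersedCircle {G : Type} [Group G] {S : Set (RepVariety G)}
    (γ : Circle → S) : Prop where
  smooth : ∀ (t : ℝ) (f : S → ℝ), StratumSmoothAt f (γ (Circle.exp t)) →
    ContDiffAt ℝ ∞ (fun u : ℝ => f (γ (Circle.exp u))) t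
  immersive : ∀ t : ℝ, ∃ f : S → ℝ, StratumSmoothAt f (γ (Circle.exp t)) ∧
    deriv (fun u : ℝ => f (γ (Circle.exp u))) t ≠ 0

/-- A manifold structure on a stratum `S` is the one inherited from `Hom(G, SU(3))` if on every
open subset it has the same smooth functions. -/
def IsInheritedSmoothStructure {G : Type} [Group G] (S : Set (RepVariety G))
    [ChartedSpace (EuclideanSpace ℝ (Fin 2)) S] : Prop :=
  ∀ (U : Opens S) (f : S → ℝ),
    ContMDiffOn (𝓡 2) 𝓘(ℝ, ℝ) ∞ f (U : Set S) ↔ ∀ c ∈ U, StratumSmoothAt f c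

/-- The open interval `(0,1)` as a one-dimensional manifold. -/
def openUnitInterval : Opens ℝ := ⟨Ioo 0 1, isOpen_Ioo⟩

end

/-! The group. A weighted rescaling identifies `Z` with the affine model `x ^ p + y ^ q = z ^ r`,
`|z| = 1`; the signs are absorbed because `p` and `q` are odd. Neighborhoods of the circles `x = 0`
and `y = 0` cover the model. Each of them, and also their intersection, is the quotient of a
star-shaped domain by `ℤ`, and the generator for the intersection is the `p`-th power of the first
core loop and the `q`-th power of the second. The two halves of van Kampen's theorem follow:
subdividing a loop shows that the core loops `u`, `v` generate (`CyclicAmalgam.mem_of_loops_mem`),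
and elements with `A ^ p = B ^ q` glue to a flat torsor whose monodromy sends `u` to `A` and `v` to
`B` (`CyclicAmalgam.exists_hom`). So `π₁(Z)` is the group of the `(p,q)` torus knot, and `r` plays
no further role.

The stratum. A nonabelian reducible representation preserves a line and acts on the orthogonal plane
without a common eigenvector. On the plane `u ^ p = v ^ q` commutes with everything, hence is
scalar, so the eigenvalues of `u` have as ratio a nontrivial `p`-th root of unity `ζ`, and those of
`v` a nontrivial `q`-th root `η`. Ordering the eigenvalues puts both ratios in the upper half plane,
which leaves `(p - 1) / 2 * ((q - 1) / 2)` choices. The remaining parameters are a common scale `τ`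
in the circle and the squared cosine `s` in `(0,1)` of the angle between the eigenlines of `u` and
`v` (`exists_repClass_stdRep`).

The parameters can be read off from characters. The commutator of `u` and `v` acts trivially on the
invariant line, so Cayley-Hamilton expresses the trace of any word on the plane through traces in
`SU(3)` (`planeTrace_eq`). The denominator is a positive multiple of `s (1 - s)`
(`trace_commutator_stdRep`), nonzero exactly off the abelian locus. The plane traces of `u`, `v` and
`u * v` recover the component, `τ` and `s`. These formulas are continuous, which gives a
homeomorphism with a disjoint union of cylinders, and smooth in the matrix entries, which identifies
the inherited smooth structure (`contDiffOn_stratumEmbedding_iff`).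

The boundary. At `s = 0` and `s = 1` the standard representation sends `u`, `v` to the `q`-th and
`p`-th powers of one diagonal matrix, `τ` times fixed weights on the plane. Compactness of the
closed cylinder and of `SU(3)` gives the closure of a component. The trace of the diagonal matrix
determines its spectrum, so coincidences on the boundary circles become equations between roots of
unity of coprime odd orders: these allow at most double points (`encard_boundaryTrace_le`) and only
at finitely many `τ` (`pow_eq_one_of_boundaryTrace_eq`). An explicit cyclic permutation of
eigenvalues yields one double point on each circle. -/

/-! ### Flat torsors and their monodromy -/

/-- The `H`-torsor over `X` whose transition functions are the coboundaries `g j * (g i)⁻¹` of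
arbitrary functions `g i : X → H` is flat as soon as these are locally constant. -/
def flatBundleCore {X H ι : Type*} [TopologicalSpace X] [Group H] [TopologicalSpace H]
    [DiscreteTopology H] (W : ι → Set X) (hW : ∀ i, IsOpen (W i)) (idx : X → ι)
    (hidx : ∀ x, x ∈ W (idx x)) (g : ι → X → H)
    (hg : ∀ i j x, x ∈ W i → x ∈ W j → ∀ᶠ y in 𝓝 x, g j y * (g i y)⁻¹ = g j x * (g i x)⁻¹) :
    FiberBundleCore ι X H where
  baseSet := W
  isOpen_baseSet := hW
  indexAt := idx
  mem_baseSet_at := hidx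
  coordChange i j x v := g j x * (g i x)⁻¹ * v
  coordChange_self i x _ v := by simp
  continuousOn_coordChange i j := by
    rintro ⟨x, v⟩ ⟨⟨hi, hj⟩, -⟩
    apply ContinuousAt.continuousWithinAt
    rw [ContinuousAt, nhds_discrete H, tendsto_pure]
    have h1 : ∀ᶠ p : X × H in 𝓝 (x, v), g j p.1 * (g i p.1)⁻¹ = g j x * (g i x)⁻¹ :=
      (continuous_fst.tendsto (x, v)).eventually (hg i j x hi hj)
    have h2 : ∀ᶠ p : X × H in 𝓝 (x, v), p.2 = v :=
      (continuous_snd.tendsto (x, v)).eventually ((isOpen_discrete {v}).mem_nhds rfl)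
    filter_upwards [h1, h2] with p hp1 hp2
    rw [hp1, hp2]
  coordChange_comp i j k x _ v := by group

/-- Continuity may be tested in the chart `i`, where the fibre coordinate is the left side of `h2`;
in a discrete fibre, continuous means locally constant. -/
theorem continuousAt_flatBundle {X H ι : Type*} [TopologicalSpace X] [Group H] [TopologicalSpace H]
    [DiscreteTopology H] {W : ι → Set X} {hW : ∀ i, IsOpen (W i)} {idx : X → ι}
    {hidx : ∀ x, x ∈ W (idx x)} {g : ι → X → H}
    {hg : ∀ i j x, x ∈ W i → x ∈ W j → ∀ᶠ y in 𝓝 x, g j y * (g i y)⁻¹ = g j x * (g i x)⁻¹}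
    {T : Type*} [TopologicalSpace T] (f : T → X) (l : T → H) (t : T) (i : ι) (hi : f t ∈ W i)
    (h1 : ContinuousAt f t)
    (h2 : ∀ᶠ s in 𝓝 t, g i (f s) * (g (idx (f s)) (f s))⁻¹ * l s =
        g i (f t) * (g (idx (f t)) (f t))⁻¹ * l t) :
    ContinuousAt (fun s => (⟨f s, l s⟩ : (flatBundleCore W hW idx hidx g hg).TotalSpace)) t := by
  set Z := flatBundleCore W hW idx hidx g hg
  have hs : ∀ x (v : H), (⟨x, v⟩ : Z.TotalSpace) ∈ (Z.localTriv i).source ↔ x ∈ W i :=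
    fun x v => Z.mem_localTriv_source i _
  rw [(Z.localTriv i).continuousAt_iff_continuousAt_comp_left]
  · change ContinuousAt (fun s => (f s, g i (f s) * (g (idx (f s)) (f s))⁻¹ * l s)) t
    refine h1.prodMk ?_
    rw [ContinuousAt, nhds_discrete H, tendsto_pure]
    exact h2
  · filter_upwards [h1.preimage_mem_nhds ((hW i).mem_nhds hi)] with s hs'
    exact (hs _ _).2 hs'

/-- Right multiplication by `H` commutes with the transition functions, so the torsor is a quotient
covering by `Hᵐᵒᵖ`, and path lifting gives the homomorphism. The function `l` describes a lift of
`γ` in the discontinuous global gauge `g`; the hypothesis on `l` says exactly that this lift is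
continuous. -/
theorem exists_monodromy_hom_of_discrete {X H ι : Type*} [TopologicalSpace X] [Group H]
    [TopologicalSpace H] [DiscreteTopology H] (W : ι → Set X)
    (hW : ∀ i, IsOpen (W i)) (hcov : ∀ x, ∃ i, x ∈ W i) (g : ι → X → H)
    (hg : ∀ i j x, x ∈ W i → x ∈ W j → ∀ᶠ y in 𝓝 x, g j y * (g i y)⁻¹ = g j x * (g i x)⁻¹)
    (x₀ : X) :
    ∃ ρ : FundamentalGroup X x₀ →* H, ∀ (γ : Path x₀ x₀) (l : unitInterval → H), l 0 = 1 →
      (∀ t, ∃ i, γ t ∈ W i ∧ ∀ᶠ s in 𝓝 t, g i (γ s) * l s = g i (γ t) * l t) →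
      ρ (FundamentalGroup.fromPath (Path.Homotopic.Quotient.mk γ)) = l 1 := by
  choose idx hidx using hcov
  set Z := flatBundleCore W hW idx hidx g hg with hZ
  let v : Z.TotalSpace → H := fun p => p.2
  have htriv : ∀ i (p : Z.TotalSpace),
      Z.localTriv i p = (p.1, g i p.1 * (g (idx p.1) p.1)⁻¹ * v p) := fun i p => rfl
  let act : MulAction Hᵐᵒᵖ Z.TotalSpace :=
    { smul := fun k p => ⟨p.1, (v p * k.unop : H)⟩
      one_smul := fun p => by
        change (⟨p.1, (v p * 1 : H)⟩ : Z.TotalSpace) = p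
        rw [mul_one]
      mul_smul := fun a b p => by
        change (⟨p.1, (v p * (b.unop * a.unop) : H)⟩ : Z.TotalSpace) =
          ⟨p.1, ((v p * b.unop) * a.unop : H)⟩
        rw [mul_assoc] }
  have hsmul : ∀ (k : Hᵐᵒᵖ) (p : Z.TotalSpace), k • p = ⟨p.1, (v p * k.unop : H)⟩ :=
    fun k p => rfl
  have hcov : IsCoveringMap (Bundle.TotalSpace.proj : Z.TotalSpace → X) :=
    FiberBundle.isCoveringMap (F := H) (E := Z.Fiber)
  have hq : IsQuotientCoveringMap (Bundle.TotalSpace.proj : Z.TotalSpace → X) Hᵐᵒᵖ := by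
    rw [isQuotientCoveringMap_iff_isCoveringMap_and]
    refine ⟨hcov, fun x => ⟨⟨x, (1 : H)⟩, rfl⟩, ⟨fun k => ?_⟩, ⟨?_⟩, ?_⟩
    · rw [continuous_iff_continuousAt]
      intro p
      refine continuousAt_flatBundle (fun p : Z.TotalSpace => p.1) (fun p => v p * k.unop) p
        (idx p.1) (hidx p.1) hcov.continuous.continuousAt ?_
      have h1 : ContinuousAt (Z.localTriv (idx p.1)) p :=
        (Z.localTriv (idx p.1)).continuousAt ((Z.mem_localTriv_source _ _).2 (hidx p.1))
      have h2 := h1.snd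
      rw [ContinuousAt, nhds_discrete H, tendsto_pure] at h2
      filter_upwards [h2] with s hs
      simp only [htriv] at hs
      simp only [← mul_assoc]
      exact congrArg (· * k.unop) hs
    · intro a b p h
      have h' : v p * a.unop = v p * b.unop := congrArg v h
      exact MulOpposite.unop_injective (mul_left_cancel h')
    · rintro ⟨x, a⟩ ⟨y, b⟩
      constructor
      · rintro (rfl : x = y)
        refine ⟨MulOpposite.op ((v ⟨x, b⟩)⁻¹ * v ⟨x, a⟩), ?_⟩
        change (⟨x, v ⟨x, b⟩ * ((v ⟨x, b⟩)⁻¹ * v ⟨x, a⟩)⟩ : Z.TotalSpace) = _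
        rw [mul_inv_cancel_left]
      · rintro ⟨k, hk⟩
        exact (congrArg Bundle.TotalSpace.proj hk).symm
  -- This base point has coordinate `1` in the gauge `g`, which is why lifts start with `l 0 = 1`.
  let e₀ : (Bundle.TotalSpace.proj : Z.TotalSpace → X) ⁻¹' {x₀} := ⟨⟨x₀, g (idx x₀) x₀⟩, rfl⟩
  refine ⟨(MulEquiv.opOp H).symm.toMonoidHom.comp (hq.fundamentalGroupToMulOpposite e₀), ?_⟩
  intro γ l hl0 hl
  have key : hq.fundamentalGroupToMulOpposite e₀
      (FundamentalGroup.fromPath (Path.Homotopic.Quotient.mk γ)) =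
      MulOpposite.op (MulOpposite.op (l 1)) := by
    rw [hq.fundamentalGroupToMulOpposite_apply_eq_Iff]
    let Γ : Path (⟨x₀, g (idx x₀) x₀⟩ : Z.TotalSpace) ⟨x₀, g (idx x₀) x₀ * l 1⟩ :=
      { toFun := fun t => ⟨γ t, g (idx (γ t)) (γ t) * l t⟩
        continuous_toFun := by
          rw [continuous_iff_continuousAt]
          intro t
          obtain ⟨i, hi, h⟩ := hl t
          refine continuousAt_flatBundle (fun t => γ t) (fun t => g (idx (γ t)) (γ t) * l t) t i hi
            γ.continuous.continuousAt ?_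
          filter_upwards [h] with s hs
          simpa using hs
        source' := by rw [hl0, mul_one, γ.source]
        target' := by rw [γ.target] }
    have := hq.isCoveringMap.monodromy_eq_of_map_eq (γ := Path.Homotopic.Quotient.mk γ)
      (ex := e₀) (ey := ⟨⟨x₀, g (idx x₀) x₀ * l 1⟩, rfl⟩)
      (Path.Homotopic.Quotient.mk Γ) rfl
    change _ = ((hq.isCoveringMap.monodromy (Path.Homotopic.Quotient.mk γ) e₀ :
      (Bundle.TotalSpace.proj : Z.TotalSpace → X) ⁻¹' {x₀}) : Z.TotalSpace)
    rw [this]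
    rfl
  change (MulEquiv.opOp H).symm (hq.fundamentalGroupToMulOpposite e₀ _) = _
  rw [key]
  rfl

/-- Monodromy of the flat torsor with locally constant transition functions `g j * (g i)⁻¹`. -/
theorem exists_monodromy_hom {X H ι : Type*} [TopologicalSpace X] [Group H] (W : ι → Set X)
    (hW : ∀ i, IsOpen (W i)) (hcov : ∀ x, ∃ i, x ∈ W i) (g : ι → X → H)
    (hg : ∀ i j x, x ∈ W i → x ∈ W j → ∀ᶠ y in 𝓝 x, g j y * (g i y)⁻¹ = g j x * (g i x)⁻¹)
    (x₀ : X) :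
    ∃ ρ : FundamentalGroup X x₀ →* H, ∀ (γ : Path x₀ x₀) (l : unitInterval → H), l 0 = 1 →
      (∀ t, ∃ i, γ t ∈ W i ∧ ∀ᶠ s in 𝓝 t, g i (γ s) * l s = g i (γ t) * l t) →
      ρ (FundamentalGroup.fromPath (Path.Homotopic.Quotient.mk γ)) = l 1 := by
  let _ : TopologicalSpace H := ⊥
  have : DiscreteTopology H := ⟨rfl⟩
  exact exists_monodromy_hom_of_discrete W hW hcov g hg x₀

/-! ### Quotients by the integers -/

/-- A continuous map `proj : Y → X` whose nonempty fibres are the orbits of an action of `ℤ` on `Y`,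
with continuous local sections, and an equivariant height function `Y → ℝ`. -/
structure CyclicCover (X Y : Type*) [TopologicalSpace X] [TopologicalSpace Y] where
  proj : C(Y, X)
  shift : ℤ → Y → Y
  height : C(Y, ℝ)
  continuous_shift : ∀ k, Continuous (shift k)
  shift_zero : ∀ y, shift 0 y = y
  shift_add : ∀ k l y, shift (k + l) y = shift k (shift l y)
  height_shift : ∀ k y, height (shift k y) = height y + k
  proj_shift : ∀ k y, proj (shift k y) = proj y
  exists_shift : ∀ y y', proj y = proj y' → ∃ k, shift k y = y'
  exists_section : ∀ y, ∃ W : Set X, IsOpen W ∧ proj y ∈ W ∧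
    ∃ σ : X → Y, ContinuousOn σ W ∧ ∀ x ∈ W, proj (σ x) = x

namespace CyclicCover

variable {X Y Y₁ Y₂ : Type*} [TopologicalSpace X] [TopologicalSpace Y] [TopologicalSpace Y₁]
  [TopologicalSpace Y₂] (c : CyclicCover X Y)

/-- The homotopy class `g` is represented by the projection of a path from `y` to `y'`. -/
def LiftsTo {x x' : X} (g : Path.Homotopic.Quotient x x') (y y' : Y) : Prop :=
  ∃ (γ : Path x x') (Γ : Path y y'), Path.Homotopic.Quotient.mk γ = g ∧ ∀ t, c.proj (Γ t) = γ t

variable {c}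

theorem LiftsTo.unique [SimplyConnectedSpace Y] {x x' : X} {g g' : Path.Homotopic.Quotient x x'}
    {y y' : Y} (h : c.LiftsTo g y y') (h' : c.LiftsTo g' y y') : g = g' := by
  obtain ⟨γ, Γ, rfl, hγ⟩ := h
  obtain ⟨γ', Γ', rfl, hγ'⟩ := h'
  obtain rfl : c.proj y = x := by simpa using hγ 0
  obtain rfl : c.proj y' = x' := by simpa using hγ 1
  have h1 : γ = Γ.map c.proj.continuous := by ext t; exact (hγ t).symm
  have h2 : γ' = Γ'.map c.proj.continuous := by ext t; exact (hγ' t).symm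
  rw [h1, h2, Path.Homotopic.Quotient.eq]
  exact (SimplyConnectedSpace.paths_homotopic Γ Γ').map c.proj

theorem LiftsTo.trans {x x' x'' : X} {g : Path.Homotopic.Quotient x x'}
    {g' : Path.Homotopic.Quotient x' x''} {y y' y'' : Y} (h : c.LiftsTo g y y')
    (h' : c.LiftsTo g' y' y'') : c.LiftsTo (g.trans g') y y'' := by
  obtain ⟨γ, Γ, rfl, hγ⟩ := h
  obtain ⟨γ', Γ', rfl, hγ'⟩ := h'
  refine ⟨γ.trans γ', Γ.trans Γ', rfl, fun t => ?_⟩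
  simp only [Path.trans_apply]
  split_ifs
  · exact hγ _
  · exact hγ' _

theorem LiftsTo.shift {x x' : X} {g : Path.Homotopic.Quotient x x'} {y y' : Y}
    (h : c.LiftsTo g y y') (k : ℤ) : c.LiftsTo g (c.shift k y) (c.shift k y') := by
  obtain ⟨γ, Γ, rfl, hγ⟩ := h
  exact ⟨γ, Γ.map (c.continuous_shift k), rfl, fun t => by simp [c.proj_shift, hγ]⟩

theorem LiftsTo.proj_right {x x' : X} {g : Path.Homotopic.Quotient x x'} {y y' : Y}
    (h : c.LiftsTo g y y') : c.proj y' = x' := by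
  obtain ⟨γ, Γ, rfl, hγ⟩ := h
  simpa using hγ 1

variable (c) in
theorem exists_liftsTo [PathConnectedSpace Y] {x x' : X} {y y' : Y} (h : c.proj y = x)
    (h' : c.proj y' = x') : ∃ g : Path.Homotopic.Quotient x x', c.LiftsTo g y y' := by
  subst h h'
  exact ⟨_, (PathConnectedSpace.somePath y y').map c.proj.continuous,
    PathConnectedSpace.somePath y y', rfl, fun t => rfl⟩

theorem LiftsTo.map {c₁ : CyclicCover X Y₁} (i : C(Y, Y₁)) (hi : ∀ y, c₁.proj (i y) = c.proj y)
    {x x' : X} {g : Path.Homotopic.Quotient x x'} {y y' : Y} (h : c.LiftsTo g y y') :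
    c₁.LiftsTo g (i y) (i y') := by
  obtain ⟨γ, Γ, rfl, hγ⟩ := h
  exact ⟨γ, Γ.map i.continuous, rfl, fun t => by simp [hi, hγ]⟩

variable (c)

/-- In a simply connected space, the path from `b` to `c.shift k b` is unique up to homotopy, so its
projection depends only on `k`. A path for `l` followed by the `l`-shift of a path for `k` is a path
for `k + l`. -/
theorem exists_loop_hom [SimplyConnectedSpace Y] {x : X} {b : Y} (hb : c.proj b = x) :
    ∃ f : Multiplicative ℤ →* FundamentalGroup X x,
      ∀ (k : ℤ) (g : Path.Homotopic.Quotient x x), c.LiftsTo g b (c.shift k b) ↔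
        g = f (Multiplicative.ofAdd k) := by
  have h : ∀ k : ℤ, ∃ g : Path.Homotopic.Quotient x x, c.LiftsTo g b (c.shift k b) := fun k =>
    c.exists_liftsTo hb (by rw [c.proj_shift, hb])
  choose f hf using h
  refine ⟨MonoidHom.mk' (fun k => FundamentalGroup.fromPath (f k.toAdd)) fun k l => ?_,
    fun k g => ⟨fun hg => hg.unique (hf k), fun hg => hg ▸ hf k⟩⟩
  refine (hf _).unique ?_
  rw [FundamentalGroup.mul_def]
  rw [toAdd_mul, add_comm, c.shift_add]
  exact (hf l.toAdd).trans (by simpa [← c.shift_add, add_comm] using (hf k.toAdd).shift l.toAdd)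

/-- The height difference of two lifts is continuous and takes integer values, hence is locally
constant, and it determines the shift. -/
theorem eventually_eq_shift {T : Type*} [TopologicalSpace T] {f f' : T → Y} {t : T}
    (hf : ContinuousAt f t) (hf' : ContinuousAt f' t)
    (h : ∀ᶠ s in 𝓝 t, c.proj (f s) = c.proj (f' s)) : ∃ k, ∀ᶠ s in 𝓝 t, f' s = c.shift k (f s) := by
  obtain ⟨k, hk⟩ := c.exists_shift _ _ h.self_of_nhds
  refine ⟨k, ?_⟩
  have hc : ContinuousAt (fun s => c.height (f' s) - c.height (f s)) t :=
    (c.height.continuous.continuousAt.comp hf').sub (c.height.continuous.continuousAt.comp hf)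
  have hk' : c.height (f' t) - c.height (f t) = k := by rw [← hk, c.height_shift]; ring
  have hn := hc.eventually (Metric.ball_mem_nhds _ one_pos)
  filter_upwards [h, hn] with s hs hs'
  obtain ⟨l, hl⟩ := c.exists_shift _ _ hs
  have : c.height (f' s) - c.height (f s) = l := by rw [← hl, c.height_shift]; ring
  rw [this, hk', Real.dist_eq] at hs'
  have : l = k := by
    have h1 : |((l - k : ℤ) : ℝ)| < 1 := by push_cast; exact hs'
    rw [← Int.cast_abs] at h1
    have h2 : |l - k| < 1 := by exact_mod_cast h1
    have := Int.abs_lt_one_iff.1 h2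
    omega
  rw [← this, hl]

end CyclicCover

/-! ### Van Kampen, first half: the core loops generate -/

/-- A space covered by the images of two cyclic covers, whose overlap is the image of a third one
with compatible deck transformations. -/
structure CyclicAmalgam (X Y Y₁ Y₂ : Type*) [TopologicalSpace X] [TopologicalSpace Y]
    [TopologicalSpace Y₁] [TopologicalSpace Y₂] (p q : ℕ) where
  c : CyclicCover X Y
  c₁ : CyclicCover X Y₁
  c₂ : CyclicCover X Y₂
  i₁ : C(Y, Y₁)
  i₂ : C(Y, Y₂)
  proj_i₁ : ∀ y, c₁.proj (i₁ y) = c.proj y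
  proj_i₂ : ∀ y, c₂.proj (i₂ y) = c.proj y
  shift_i₁ : ∀ k y, i₁ (c.shift k y) = c₁.shift (p * k) (i₁ y)
  shift_i₂ : ∀ k y, i₂ (c.shift k y) = c₂.shift (q * k) (i₂ y)
  overlap : ∀ y₁ y₂, c₁.proj y₁ = c₂.proj y₂ → ∃ y, c.proj y = c₁.proj y₁
  cover : ∀ x, (∃ y, c₁.proj y = x) ∨ ∃ y, c₂.proj y = x
  base : Y
  height_base₁ : c₁.height (i₁ base) = 0
  height_base₂ : c₂.height (i₂ base) = 0

namespace CyclicAmalgam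

variable {X Y Y₁ Y₂ : Type*} [TopologicalSpace X] [TopologicalSpace Y] [TopologicalSpace Y₁]
  [TopologicalSpace Y₂] {p q : ℕ} (D : CyclicAmalgam X Y Y₁ Y₂ p q)

/-- The amalgam with the two pieces exchanged. -/
def swap : CyclicAmalgam X Y Y₂ Y₁ q p where
  c := D.c
  c₁ := D.c₂
  c₂ := D.c₁
  i₁ := D.i₂
  i₂ := D.i₁
  proj_i₁ := D.proj_i₂
  proj_i₂ := D.proj_i₁
  shift_i₁ := D.shift_i₂
  shift_i₂ := D.shift_i₁
  overlap y₁ y₂ h := by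
    obtain ⟨y, hy⟩ := D.overlap y₂ y₁ h.symm
    exact ⟨y, hy.trans h.symm⟩
  cover x := (D.cover x).symm
  base := D.base
  height_base₁ := D.height_base₂
  height_base₂ := D.height_base₁

/-- The base point. -/
def basePt : X := D.c.proj D.base

/-- The class `g` is a product of a loop in `K` and the projection of a path in the first piece. -/
def Good (K : Subgroup (FundamentalGroup X D.basePt)) {x : X}
    (g : Path.Homotopic.Quotient D.basePt x) : Prop :=
  ∃ (κ : Path.Homotopic.Quotient D.basePt D.basePt) (δ : Path.Homotopic.Quotient D.basePt x)
    (y : Y₁), FundamentalGroup.fromPath κ ∈ K ∧ g = κ.trans δ ∧ D.c₁.LiftsTo δ (D.i₁ D.base) y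

variable {D}

/-- Over the overlap, the end of the path in the first piece is a shift of a point of the overlap.
The path is therefore a core loop of the first piece, absorbed into `K`, followed by a path in the
overlap, which can be viewed in the second piece. -/
theorem Good.swap [PathConnectedSpace Y] [SimplyConnectedSpace Y₁] [SimplyConnectedSpace Y₂]
    {K : Subgroup (FundamentalGroup X D.basePt)}
    (hK : ∀ (k : ℤ) (g : Path.Homotopic.Quotient D.basePt D.basePt),
      D.c₁.LiftsTo g (D.i₁ D.base) (D.c₁.shift k (D.i₁ D.base)) →
        FundamentalGroup.fromPath g ∈ K)
    {x : X} {g : Path.Homotopic.Quotient D.basePt x} (hg : D.Good K g) {y₂ : Y₂}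
    (hy₂ : D.c₂.proj y₂ = x) : D.swap.Good K g := by
  obtain ⟨κ, δ, y₁, hκ, rfl, hδ⟩ := hg
  obtain ⟨w, hw⟩ := D.overlap y₁ y₂ (hδ.proj_right.trans hy₂.symm)
  obtain ⟨k, hk⟩ := D.c₁.exists_shift (D.i₁ w) y₁ (by rw [D.proj_i₁, hw])
  obtain ⟨δ', hδ'⟩ := D.c.exists_liftsTo (x := D.basePt) (x' := x) (y := D.base) (y' := w) rfl
    (by rw [hw, hδ.proj_right])
  obtain ⟨κ', hκ'⟩ := D.c₁.exists_liftsTo (x := D.basePt) (x' := D.basePt)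
    (y := D.i₁ D.base) (y' := D.c₁.shift k (D.i₁ D.base)) (by rw [D.proj_i₁]; rfl)
    (by rw [D.c₁.proj_shift, D.proj_i₁]; rfl)
  have h1 : D.c₁.LiftsTo (κ'.trans δ') (D.i₁ D.base) y₁ := by
    rw [← hk]
    exact hκ'.trans ((hδ'.map D.i₁ D.proj_i₁).shift k)
  obtain rfl := hδ.unique h1
  refine ⟨κ.trans κ', δ', D.i₂ w, ?_, (Path.Homotopic.Quotient.trans_assoc ..).symm, hδ'.map D.i₂ D.proj_i₂⟩
  exact K.mul_mem (hK k κ' hκ') hκ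

theorem Good.trans {K : Subgroup (FundamentalGroup X D.basePt)} {x : X}
    {g : Path.Homotopic.Quotient D.basePt x} (hg : D.Good K g) {W : Set X} {σ : X → Y₁}
    (hσ : ContinuousOn σ W) (hσ' : ∀ x ∈ W, D.c₁.proj (σ x) = x) {x' : X} (γ : Path x x')
    (hγ : ∀ t, γ t ∈ W) : D.Good K (g.trans (Path.Homotopic.Quotient.mk γ)) := by
  obtain ⟨κ, δ, y, hκ, rfl, hδ⟩ := hg
  have hx : x ∈ W := by simpa using hγ 0
  obtain ⟨k, rfl⟩ := D.c₁.exists_shift (σ x) y (by rw [hσ' x hx, hδ.proj_right])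
  let Γ : Path (σ x) (σ x') :=
    { toFun := fun t => σ (γ t)
      continuous_toFun := hσ.comp_continuous γ.continuous hγ
      source' := by simp
      target' := by simp }
  have hΓ : D.c₁.LiftsTo (Path.Homotopic.Quotient.mk γ) (σ x) (σ x') :=
    ⟨γ, Γ, rfl, fun t => hσ' _ (hγ t)⟩
  exact ⟨κ, δ.trans (Path.Homotopic.Quotient.mk γ), _, hκ, by simp, hδ.trans (hΓ.shift k)⟩

theorem Good.mem [SimplyConnectedSpace Y₁] {K : Subgroup (FundamentalGroup X D.basePt)}
    (hK : ∀ (k : ℤ) (g : Path.Homotopic.Quotient D.basePt D.basePt),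
      D.c₁.LiftsTo g (D.i₁ D.base) (D.c₁.shift k (D.i₁ D.base)) →
        FundamentalGroup.fromPath g ∈ K)
    {g : Path.Homotopic.Quotient D.basePt D.basePt} (hg : D.Good K g) :
    FundamentalGroup.fromPath g ∈ K := by
  obtain ⟨κ, δ, y, hκ, rfl, hδ⟩ := hg
  obtain ⟨k, rfl⟩ := D.c₁.exists_shift (D.i₁ D.base) y (by rw [hδ.proj_right, D.proj_i₁]; rfl)
  exact K.mul_mem (hK k δ hδ) hκ

/-- By compactness, a loop is cut into finitely many arcs, each in the domain of a local section of
one of the two covers. By induction, every initial segment is an element of `K` followed by a path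
in a single piece; the piece is switched when the next arc requires it. -/
theorem mem_of_loops_mem [PathConnectedSpace Y] [SimplyConnectedSpace Y₁] [SimplyConnectedSpace Y₂]
    {K : Subgroup (FundamentalGroup X D.basePt)}
    (hK₁ : ∀ (k : ℤ) (g : Path.Homotopic.Quotient D.basePt D.basePt),
      D.c₁.LiftsTo g (D.i₁ D.base) (D.c₁.shift k (D.i₁ D.base)) →
        FundamentalGroup.fromPath g ∈ K)
    (hK₂ : ∀ (k : ℤ) (g : Path.Homotopic.Quotient D.basePt D.basePt),
      D.c₂.LiftsTo g (D.i₂ D.base) (D.c₂.shift k (D.i₂ D.base)) →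
        FundamentalGroup.fromPath g ∈ K)
    (g : FundamentalGroup X D.basePt) : g ∈ K := by
  obtain ⟨γ, rfl⟩ := Path.Homotopic.Quotient.mk_surjective g
  let P₁ : Set X → Prop := fun W => ∃ σ : X → Y₁, ContinuousOn σ W ∧ ∀ x ∈ W, D.c₁.proj (σ x) = x
  let P₂ : Set X → Prop := fun W => ∃ σ : X → Y₂, ContinuousOn σ W ∧ ∀ x ∈ W, D.c₂.proj (σ x) = x
  obtain ⟨t, ht0, htm, ⟨n, htn⟩, hsub⟩ := exists_monotone_Icc_subset_open_cover_unitInterval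
    (ι := {W : Set X // IsOpen W ∧ (P₁ W ∨ P₂ W)}) (c := fun W => γ ⁻¹' W.1)
    (fun W => W.2.1.preimage γ.continuous) (fun s _ => by
      rw [mem_iUnion]
      rcases D.cover (γ s) with ⟨y, hy⟩ | ⟨y, hy⟩
      · obtain ⟨W, hW, hyW, hσ⟩ := D.c₁.exists_section y
        exact ⟨⟨W, hW, Or.inl hσ⟩, by rw [hy] at hyW; exact hyW⟩
      · obtain ⟨W, hW, hyW, hσ⟩ := D.c₂.exists_section y
        exact ⟨⟨W, hW, Or.inr hσ⟩, by rw [hy] at hyW; exact hyW⟩)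
  let G : ∀ s : unitInterval, Path.Homotopic.Quotient D.basePt (γ s) := fun s =>
    (Path.Homotopic.Quotient.mk (γ.subpath 0 s)).cast γ.source.symm rfl
  have hG : ∀ s s', G s' = (G s).trans (Path.Homotopic.Quotient.mk (γ.subpath s s')) := by
    intro s s'
    have := Path.Homotopic.Quotient.eq.2 ⟨Path.Homotopy.subpathTransSubpath γ 0 s s'⟩
    rw [Path.Homotopic.Quotient.mk_trans] at this
    simp only [G]
    rw [← this]
    generalize_proofs h
    revert h
    generalize Path.Homotopic.Quotient.mk (γ.subpath 0 s) = A
    revert A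
    generalize γ 0 = a
    rintro A rfl
    simp only [Path.Homotopic.Quotient.cast_rfl_rfl]
  have key : ∀ m, D.Good K (G (t m)) ∨ D.swap.Good K (G (t m)) := by
    intro m
    induction m with
    | zero =>
      left
      refine ⟨Path.Homotopic.Quotient.refl _, G (t 0), D.i₁ D.base, K.one_mem, by simp, ?_⟩
      have h0 : ∀ s, s = 0 → D.c₁.LiftsTo (G s) (D.i₁ D.base) (D.i₁ D.base) := by
        rintro s rfl
        refine ⟨(γ.subpath 0 0).cast γ.source.symm rfl, Path.refl _, rfl, fun s => ?_⟩
        simp only [Path.refl_apply, D.proj_i₁, Path.subpath_self, Path.cast_coe]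
        exact γ.source.symm
      exact h0 _ ht0
    | succ m ih =>
      obtain ⟨⟨W, hW, hP⟩, hsW⟩ := hsub m
      have hin : ∀ s, γ.subpath (t m) (t (m + 1)) s ∈ W := by
        intro s
        have : γ.subpath (t m) (t (m + 1)) s ∈ range (γ.subpath (t m) (t (m + 1))) := ⟨s, rfl⟩
        rw [Path.range_subpath_of_le _ _ _ (htm (Nat.le_succ m))] at this
        obtain ⟨s', hs', h⟩ := this
        rw [← h]
        exact hsW hs'
      have hx : γ (t m) ∈ W := hsW ⟨le_rfl, htm (Nat.le_succ m)⟩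
      rw [hG (t m) (t (m + 1))]
      rcases hP with ⟨σ, hσ, hσ'⟩ | ⟨σ, hσ, hσ'⟩
      · left
        have : D.Good K (G (t m)) := ih.elim id fun h =>
          Good.swap (D := D.swap) hK₂ h (hσ' _ hx)
        exact this.trans hσ hσ' _ hin
      · right
        have : D.swap.Good K (G (t m)) := ih.elim (fun h => Good.swap hK₁ h (hσ' _ hx)) id
        exact Good.trans (D := D.swap) this hσ hσ' _ hin
  -- The last subdivision point equals `1` only propositionally, so the endpoint type has to be
  -- transported.
  have hlast : ∀ s (hs : s = 1), (G s).cast rfl (by rw [hs, γ.target]) =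
      Path.Homotopic.Quotient.mk γ := by
    rintro s rfl
    simp only [G, Path.subpath_zero_one, ← Path.Homotopic.Quotient.mk_cast]
    rfl
  have hfin : ∀ (a : X) (h : D.basePt = a) (A : Path.Homotopic.Quotient D.basePt a),
      (D.Good K A ∨ D.swap.Good K A) → FundamentalGroup.fromPath (A.cast rfl h) ∈ K := by
    rintro a rfl A hA
    simp only [Path.Homotopic.Quotient.cast_rfl_rfl]
    exact hA.elim (Good.mem hK₁) (Good.mem (D := D.swap) hK₂)
  have := hfin _ (by rw [htn n le_rfl, γ.target]) _ (key n)
  rwa [hlast _ (htn n le_rfl)] at this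

end CyclicAmalgam

/-! ### Van Kampen, second half: homomorphisms from glued torsors -/

namespace CyclicCover

variable {X Y : Type*} [TopologicalSpace X] [TopologicalSpace Y] (c : CyclicCover X Y)

/-- A function `Y → H` on which the deck transformations act by left translation by powers of
`A⁻¹`. -/
noncomputable def twist {H : Type*} [Group H] (A : H) (y : Y) : H := A ^ (-⌊c.height y⌋)

theorem twist_shift {H : Type*} [Group H] (A : H) (k : ℤ) (y : Y) :
    c.twist A (c.shift k y) = A ^ (-k) * c.twist A y := by
  rw [twist, twist, c.height_shift, Int.floor_add_intCast, ← zpow_add]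
  congr 1
  ring

theorem twist_of_height_eq_zero {H : Type*} [Group H] (A : H) {y : Y} (h : c.height y = 0) :
    c.twist A y = 1 := by simp [twist, h]

/-- The local sections of a cyclic cover. -/
abbrev LocalSection : Type _ :=
  {s : Set X × (X → Y) // IsOpen s.1 ∧ ContinuousOn s.2 s.1 ∧ ∀ x ∈ s.1, c.proj (s.2 x) = x}

theorem exists_localSection (y : Y) : ∃ s : c.LocalSection, c.proj y ∈ s.1.1 := by
  obtain ⟨W, hW, hy, σ, h1, h2⟩ := c.exists_section y
  exact ⟨⟨(W, σ), hW, h1, h2⟩, hy⟩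

variable {c} in
theorem LocalSection.continuousAt (s : c.LocalSection) {x : X} (hx : x ∈ s.1.1) :
    ContinuousAt s.1.2 x := s.2.2.1.continuousAt (s.2.1.mem_nhds hx)

end CyclicCover

namespace CyclicAmalgam

variable {X Y Y₁ Y₂ : Type*} [TopologicalSpace X] [TopologicalSpace Y] [TopologicalSpace Y₁]
  [TopologicalSpace Y₂] {p q : ℕ} (D : CyclicAmalgam X Y Y₁ Y₂ p q) {H : Type*} [Group H]

open Classical in
/-- The gauge transformation relating the two twists over the overlap. -/
noncomputable def gauge (A B : H) (x : X) : H :=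
  if h : ∃ y, D.c.proj y = x then (D.c₂.twist B (D.i₂ h.choose))⁻¹ * D.c₁.twist A (D.i₁ h.choose)
  else 1

/-- Another preimage in the overlap is a `k`-shift, which multiplies the two twists on the left by
`A ^ (-(p * k))` and `B ^ (-(q * k))`. These agree because `A ^ p = B ^ q`, so they cancel in the
quotient. -/
theorem gauge_proj {A B : H} (hAB : A ^ p = B ^ q) (y : Y) :
    D.gauge A B (D.c.proj y) = (D.c₂.twist B (D.i₂ y))⁻¹ * D.c₁.twist A (D.i₁ y) := by
  have h : ∃ y', D.c.proj y' = D.c.proj y := ⟨y, rfl⟩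
  rw [gauge, dif_pos h]
  obtain ⟨k, hk⟩ := D.c.exists_shift _ _ h.choose_spec
  have hA : ∀ n : ℤ, A ^ (-((p : ℤ) * n)) = B ^ (-((q : ℤ) * n)) := fun n => by
    rw [← mul_neg, ← mul_neg, zpow_mul, zpow_mul, zpow_natCast, zpow_natCast, hAB]
  conv_rhs => rw [← hk, D.shift_i₁, D.shift_i₂, CyclicCover.twist_shift, CyclicCover.twist_shift,
    hA]
  group

/-- The local gauges of the torsor glued from the two twists. -/
noncomputable def localGauge (A B : H) : D.c₁.LocalSection ⊕ D.c₂.LocalSection → X → H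
  | .inl s, x => D.c₁.twist A (s.1.2 x)
  | .inr s, x => D.c₂.twist B (s.1.2 x) * D.gauge A B x

/-- The domains of the local gauges. -/
noncomputable def localDomain : D.c₁.LocalSection ⊕ D.c₂.LocalSection → Set X
  | .inl s => s.1.1
  | .inr s => s.1.1

theorem _root_.CyclicCover.eventually_twist_mul_inv {T : Type*} [TopologicalSpace T]
    (c : CyclicCover X Y) (A : H)
    {f f' : T → Y} {t : T} (hf : ContinuousAt f t) (hf' : ContinuousAt f' t)
    (h : ∀ᶠ s in 𝓝 t, c.proj (f s) = c.proj (f' s)) :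
    ∃ k : H, ∀ᶠ s in 𝓝 t, c.twist A (f' s) = k * c.twist A (f s) := by
  obtain ⟨k, hk⟩ := c.eventually_eq_shift hf hf' h
  exact ⟨A ^ (-k), hk.mono fun s hs => by rw [hs, c.twist_shift]⟩

/-- Both sections are compared with a local section `τ` of the overlap cover. Each comparison
contributes a constant left factor, and along `τ` the gauge turns one twist into the other. -/
theorem eventually_localGauge_inl_inr {A B : H} (hAB : A ^ p = B ^ q) (s : D.c₁.LocalSection)
    (s' : D.c₂.LocalSection) {x : X} (hx : x ∈ s.1.1) (hx' : x ∈ s'.1.1) :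
    ∃ k : H, ∀ᶠ z in 𝓝 x,
      D.localGauge A B (.inr s') z * (D.localGauge A B (.inl s) z)⁻¹ = k := by
  obtain ⟨w, hw⟩ := D.overlap (s.1.2 x) (s'.1.2 x) (by rw [s.2.2.2 x hx, s'.2.2.2 x hx'])
  rw [s.2.2.2 x hx] at hw
  obtain ⟨τ, hτ⟩ := D.c.exists_localSection w
  rw [hw] at hτ
  have e1 := s.2.1.mem_nhds hx
  have e2 := s'.2.1.mem_nhds hx'
  have e3 := τ.2.1.mem_nhds hτ
  obtain ⟨k₁, hk₁⟩ := D.c₁.eventually_twist_mul_inv A (f := fun z => D.i₁ (τ.1.2 z))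
    (D.i₁.continuous.continuousAt.comp (τ.continuousAt hτ)) (s.continuousAt hx) (by
      filter_upwards [e1, e3] with z h1 h3
      rw [D.proj_i₁, τ.2.2.2 z h3, s.2.2.2 z h1])
  obtain ⟨k₂, hk₂⟩ := D.c₂.eventually_twist_mul_inv B (f := fun z => D.i₂ (τ.1.2 z))
    (D.i₂.continuous.continuousAt.comp (τ.continuousAt hτ)) (s'.continuousAt hx') (by
      filter_upwards [e2, e3] with z h2 h3
      rw [D.proj_i₂, τ.2.2.2 z h3, s'.2.2.2 z h2])
  refine ⟨k₂ * k₁⁻¹, ?_⟩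
  filter_upwards [hk₁, hk₂, e3] with z h1 h2 h3
  have hg := D.gauge_proj hAB (τ.1.2 z)
  rw [τ.2.2.2 z h3] at hg
  simp only [localGauge, hg, h1, h2]
  group

theorem eventually_localGauge {A B : H} (hAB : A ^ p = B ^ q) :
    ∀ i j x, x ∈ D.localDomain i → x ∈ D.localDomain j → ∀ᶠ z in 𝓝 x,
      D.localGauge A B j z * (D.localGauge A B i z)⁻¹ =
        D.localGauge A B j x * (D.localGauge A B i x)⁻¹ := by
  suffices h : ∀ i j x, x ∈ D.localDomain i → x ∈ D.localDomain j → ∃ k : H, ∀ᶠ z in 𝓝 x,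
      D.localGauge A B j z * (D.localGauge A B i z)⁻¹ = k by
    intro i j x hi hj
    obtain ⟨k, hk⟩ := h i j x hi hj
    exact hk.mono fun z hz => by rw [hz, hk.self_of_nhds]
  rintro (s | s) (s' | s') x hx hx'
  · obtain ⟨k, hk⟩ := D.c₁.eventually_twist_mul_inv A (s.continuousAt hx) (s'.continuousAt hx') (by
      filter_upwards [s.2.1.mem_nhds hx, s'.2.1.mem_nhds hx'] with z h h'
      rw [s.2.2.2 z h, s'.2.2.2 z h'])
    exact ⟨k, hk.mono fun z hz => by simp [localGauge, hz]⟩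
  · exact D.eventually_localGauge_inl_inr hAB s s' hx hx'
  · obtain ⟨k, hk⟩ := D.eventually_localGauge_inl_inr hAB s' s hx' hx
    exact ⟨k⁻¹, hk.mono fun z hz => by rw [← hz, mul_inv_rev, inv_inv]⟩
  · obtain ⟨k, hk⟩ := D.c₂.eventually_twist_mul_inv B (s.continuousAt hx) (s'.continuousAt hx') (by
      filter_upwards [s.2.1.mem_nhds hx, s'.2.1.mem_nhds hx'] with z h h'
      rw [s.2.2.2 z h, s'.2.2.2 z h'])
    refine ⟨k, hk.mono fun z hz => ?_⟩
    simp only [localGauge, hz]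
    group

/-- The glued torsor is flat, and along a path in a cover the inverse of the twist is a parallel
section. From the base point to its unit shift it goes from `1` to `A`, respectively `B`. -/
theorem exists_hom {A B : H} (hAB : A ^ p = B ^ q) :
    ∃ ρ : FundamentalGroup X D.basePt →* H,
      (∀ g : Path.Homotopic.Quotient D.basePt D.basePt,
        D.c₁.LiftsTo g (D.i₁ D.base) (D.c₁.shift 1 (D.i₁ D.base)) →
          ρ (FundamentalGroup.fromPath g) = A) ∧
      ∀ g : Path.Homotopic.Quotient D.basePt D.basePt,
        D.c₂.LiftsTo g (D.i₂ D.base) (D.c₂.shift 1 (D.i₂ D.base)) →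
          ρ (FundamentalGroup.fromPath g) = B := by
  have hcov : ∀ x, ∃ i, x ∈ D.localDomain i := by
    intro x
    rcases D.cover x with ⟨y, rfl⟩ | ⟨y, rfl⟩
    · obtain ⟨s, hs⟩ := D.c₁.exists_localSection y
      exact ⟨.inl s, hs⟩
    · obtain ⟨s, hs⟩ := D.c₂.exists_localSection y
      exact ⟨.inr s, hs⟩
  obtain ⟨ρ, hρ⟩ := exists_monodromy_hom D.localDomain
    (by rintro (s | s); exacts [s.2.1, s.2.1]) hcov (D.localGauge A B)
    (D.eventually_localGauge hAB) D.basePt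
  refine ⟨ρ, ?_, ?_⟩
  · rintro g ⟨γ, Γ, rfl, hγ⟩
    rw [hρ γ (fun t => (D.c₁.twist A (Γ t))⁻¹)]
    · rw [Γ.target, D.c₁.twist_shift, D.c₁.twist_of_height_eq_zero A D.height_base₁]
      simp
    · rw [Γ.source, D.c₁.twist_of_height_eq_zero A D.height_base₁, inv_one]
    · intro t
      obtain ⟨s, hs⟩ := D.c₁.exists_localSection (Γ t)
      rw [hγ] at hs
      refine ⟨.inl s, hs, ?_⟩
      obtain ⟨k, hk⟩ := D.c₁.eventually_twist_mul_inv A (f := Γ) (f' := fun t => s.1.2 (γ t))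
        Γ.continuous.continuousAt (ContinuousAt.comp (s.continuousAt hs) γ.continuous.continuousAt)
        (by
          filter_upwards [γ.continuous.continuousAt.preimage_mem_nhds (s.2.1.mem_nhds hs)] with t ht
          rw [hγ, s.2.2.2 _ ht])
      have := hk.self_of_nhds
      filter_upwards [hk] with z hz
      simp only [localGauge, hz, this]
      group
  · rintro g ⟨γ, Γ, rfl, hγ⟩
    have hb : D.gauge A B D.basePt = 1 := by
      rw [basePt, D.gauge_proj hAB, D.c₁.twist_of_height_eq_zero A D.height_base₁,
        D.c₂.twist_of_height_eq_zero B D.height_base₂]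
      simp
    rw [hρ γ (fun t => (D.c₂.twist B (Γ t) * D.gauge A B (γ t))⁻¹)]
    · rw [Γ.target, D.c₂.twist_shift, D.c₂.twist_of_height_eq_zero B D.height_base₂, γ.target, hb]
      simp
    · rw [Γ.source, D.c₂.twist_of_height_eq_zero B D.height_base₂, γ.source, hb]
      simp
    · intro t
      obtain ⟨s, hs⟩ := D.c₂.exists_localSection (Γ t)
      rw [hγ] at hs
      refine ⟨.inr s, hs, ?_⟩
      obtain ⟨k, hk⟩ := D.c₂.eventually_twist_mul_inv B (f := Γ) (f' := fun t => s.1.2 (γ t))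
        Γ.continuous.continuousAt (ContinuousAt.comp (s.continuousAt hs) γ.continuous.continuousAt)
        (by
          filter_upwards [γ.continuous.continuousAt.preimage_mem_nhds (s.2.1.mem_nhds hs)] with t ht
          rw [hγ, s.2.2.2 _ ht])
      have := hk.self_of_nhds
      filter_upwards [hk] with z hz
      simp only [localGauge, hz, this]
      group

end CyclicAmalgam

/-- `G` is generated by `u` and `v`, and has the presentation `⟨u, v | u ^ p = v ^ q⟩` as far as
homomorphisms to groups in `Type` are concerned. -/
structure IsTorusKnotGroup {G : Type*} [Group G] (p q : ℕ) (u v : G) : Prop where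
  rel : u ^ p = v ^ q
  closure_eq : Subgroup.closure {u, v} = ⊤
  exists_hom : ∀ (H : Type) [Group H] (A B : H), A ^ p = B ^ q → ∃ ρ : G →* H, ρ u = A ∧ ρ v = B

theorem IsTorusKnotGroup.map {G G' : Type*} [Group G] [Group G'] {p q : ℕ} {u v : G}
    (h : IsTorusKnotGroup p q u v) (e : G ≃* G') : IsTorusKnotGroup p q (e u) (e v) where
  rel := by rw [← map_pow, h.rel, map_pow]
  closure_eq := by
    have := congrArg (Subgroup.map e.toMonoidHom) h.closure_eq
    rw [MonoidHom.map_closure, Subgroup.map_top_of_surjective _ e.surjective] at this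
    rw [← this, image_pair]
    rfl
  exists_hom H _ A B hAB := by
    obtain ⟨ρ, h1, h2⟩ := h.exists_hom H A B hAB
    exact ⟨ρ.comp e.symm.toMonoidHom, by simp [h1], by simp [h2]⟩

/-- The relation comes from the generating loop of the overlap, which is the shift by `p` in one
piece and by `q` in the other. -/
theorem CyclicAmalgam.exists_isTorusKnotGroup {X Y Y₁ Y₂ : Type*} [TopologicalSpace X]
    [TopologicalSpace Y] [TopologicalSpace Y₁] [TopologicalSpace Y₂] {p q : ℕ}
    (D : CyclicAmalgam X Y Y₁ Y₂ p q) [PathConnectedSpace Y] [SimplyConnectedSpace Y₁]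
    [SimplyConnectedSpace Y₂] :
    ∃ u v : FundamentalGroup X D.basePt, IsTorusKnotGroup p q u v := by
  obtain ⟨f₁, hf₁⟩ := D.c₁.exists_loop_hom (x := D.basePt) (b := D.i₁ D.base)
    (by rw [D.proj_i₁]; rfl)
  obtain ⟨f₂, hf₂⟩ := D.c₂.exists_loop_hom (x := D.basePt) (b := D.i₂ D.base)
    (by rw [D.proj_i₂]; rfl)
  have e₁ : ∀ k : ℤ, f₁ (Multiplicative.ofAdd k) = f₁ (Multiplicative.ofAdd 1) ^ k := fun k => by
    rw [← map_zpow, ← ofAdd_zsmul, smul_eq_mul, mul_one]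
  have e₂ : ∀ k : ℤ, f₂ (Multiplicative.ofAdd k) = f₂ (Multiplicative.ofAdd 1) ^ k := fun k => by
    rw [← map_zpow, ← ofAdd_zsmul, smul_eq_mul, mul_one]
  refine ⟨f₁ (Multiplicative.ofAdd 1), f₂ (Multiplicative.ofAdd 1), ?_, ?_, ?_⟩
  · obtain ⟨g, hg⟩ := D.c.exists_liftsTo (x := D.basePt) (x' := D.basePt) (y := D.base)
      (y' := D.c.shift 1 D.base) rfl (D.c.proj_shift _ _)
    have h1 := hg.map D.i₁ D.proj_i₁
    have h2 := hg.map D.i₂ D.proj_i₂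
    rw [D.shift_i₁, hf₁, e₁, mul_one, zpow_natCast] at h1
    rw [D.shift_i₂, hf₂, e₂, mul_one, zpow_natCast] at h2
    exact h1.symm.trans h2
  · rw [eq_top_iff]
    rintro g -
    refine CyclicAmalgam.mem_of_loops_mem ?_ ?_ g
    · intro k g hg
      rw [hf₁, e₁] at hg
      rw [hg]
      exact Subgroup.zpow_mem _ (Subgroup.subset_closure (by simp)) k
    · intro k g hg
      rw [hf₂, e₂] at hg
      rw [hg]
      exact Subgroup.zpow_mem _ (Subgroup.subset_closure (by simp)) k
  · intro H _ A B hAB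
    obtain ⟨ρ, h1, h2⟩ := D.exists_hom hAB
    exact ⟨ρ, h1 _ ((hf₁ 1 _).2 rfl), h2 _ ((hf₂ 1 _).2 rfl)⟩

/-! ### Angles on the circle and common roots -/

/-- The point `exp (2 π i a)` of the unit circle. -/
noncomputable def unitExp (a : ℝ) : Circle := Circle.exp (2 * Real.pi * a)

theorem unitExp_add (a b : ℝ) : unitExp (a + b) = unitExp a * unitExp b := by
  rw [unitExp, mul_add, Circle.exp_add]; rfl

theorem unitExp_zero : unitExp 0 = 1 := by simp [unitExp]

theorem unitExp_neg (a : ℝ) : unitExp (-a) = (unitExp a)⁻¹ := by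
  rw [unitExp, mul_neg, Circle.exp_neg]; rfl

theorem unitExp_nat_mul (n : ℕ) (a : ℝ) : unitExp (n * a) = unitExp a ^ n := by
  rw [unitExp, unitExp, ← Circle.exp_natCast_mul]
  congr 1
  ring

theorem unitExp_eq_iff {a b : ℝ} : unitExp a = unitExp b ↔ ∃ n : ℤ, a = b + n := by
  rw [unitExp, unitExp, Circle.exp_eq_exp]
  have := Real.pi_pos
  refine exists_congr fun n => ⟨fun h => ?_, fun h => by rw [h]; ring⟩
  have : 2 * Real.pi * (a - (b + n)) = 0 := by linarith
  rcases mul_eq_zero.1 this with h | h <;> linarith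

theorem unitExp_int (n : ℤ) : unitExp n = 1 := by
  rw [← unitExp_zero, unitExp_eq_iff]; exact ⟨n, by ring⟩

theorem unitExp_eq_one_iff {a : ℝ} : unitExp a = 1 ↔ ∃ n : ℤ, a = n := by
  rw [← unitExp_zero, unitExp_eq_iff]; simp

@[fun_prop]
theorem continuous_unitExp : Continuous unitExp :=
  Circle.exp.continuous.comp (continuous_const.mul continuous_id)

/-- A local inverse of `unitExp` near `a`. -/
noncomputable def localAngle (a : ℝ) (w : ℂ) : ℝ :=
  a + Complex.arg (w * (unitExp (-a) : ℂ)) / (2 * Real.pi)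

theorem unitExp_localAngle (a : ℝ) {w : ℂ} (hw : ‖w‖ = 1) : (unitExp (localAngle a w) : ℂ) = w := by
  have h1 : unitExp (Complex.arg (w * (unitExp (-a) : ℂ)) / (2 * Real.pi)) =
      Circle.exp (Complex.arg (w * (unitExp (-a) : ℂ))) := by
    rw [unitExp]
    congr 1
    field_simp [Real.pi_ne_zero]
  rw [localAngle, unitExp_add, h1, Circle.coe_mul, Circle.coe_exp]
  have h2 := Complex.norm_mul_exp_arg_mul_I (w * (unitExp (-a) : ℂ))
  rw [norm_mul, hw, Circle.norm_coe, one_mul, Complex.ofReal_one, one_mul] at h2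
  rw [h2, unitExp_neg, Circle.coe_inv]
  field_simp [Circle.coe_ne_zero]

theorem continuousAt_localAngle {a : ℝ} {w : ℂ} (h : w * (unitExp (-a) : ℂ) ∈ Complex.slitPlane) :
    ContinuousAt (localAngle a) w :=
  continuousAt_const.add (((Complex.continuousAt_arg h).comp
    (f := fun w : ℂ => w * (unitExp (-a) : ℂ)) (by fun_prop)).div_const _)

theorem unitExp_mul_unitExp_neg (a : ℝ) : (unitExp a : ℂ) * unitExp (-a) = 1 := by
  rw [← Circle.coe_mul, ← unitExp_add, add_neg_cancel, unitExp_zero, Circle.coe_one]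

theorem exists_int_of_coprime {q r : ℕ} (h : Nat.Coprime q r) {a : ℝ} (hq : ∃ n : ℤ, q * a = n)
    (hr : ∃ n : ℤ, r * a = n) : ∃ n : ℤ, a = n := by
  obtain ⟨m, hm⟩ := hq
  obtain ⟨n, hn⟩ := hr
  have hb : ((q : ℝ) * Nat.gcdA q r + r * Nat.gcdB q r) = 1 := by
    have := Nat.gcd_eq_gcd_ab q r
    rw [h.gcd_eq_one] at this
    exact_mod_cast this.symm
  refine ⟨m * Nat.gcdA q r + n * Nat.gcdB q r, ?_⟩
  push_cast
  rw [← hm, ← hn]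
  linear_combination -a * hb

/-- The common root `s` with `s ^ q = z` and `s ^ r = c` when `c ^ q = z ^ r` and `q`, `r` are
coprime. -/
noncomputable def commonRoot (q r : ℕ) (z c : ℂ) : ℂ := z ^ Nat.gcdA q r * c ^ Nat.gcdB q r

section commonRoot

variable {q r : ℕ} (h : Nat.Coprime q r)
include h

theorem gcd_coprime_eq : (q : ℤ) * Nat.gcdA q r + r * Nat.gcdB q r = 1 := by
  have := Nat.gcd_eq_gcd_ab q r
  rw [h.gcd_eq_one] at this
  exact_mod_cast this.symm

theorem commonRoot_pow_left {z c : ℂ} (hz : z ≠ 0) (hzc : c ^ q = z ^ r) :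
    commonRoot q r z c ^ q = z := by
  calc commonRoot q r z c ^ q = (z ^ (Nat.gcdA q r * q)) * (c ^ q) ^ Nat.gcdB q r := by
        rw [commonRoot, mul_pow, ← zpow_natCast, ← zpow_mul, ← zpow_natCast (c ^ Nat.gcdB q r),
          ← zpow_mul, mul_comm (Nat.gcdB q r), zpow_mul c, zpow_natCast c]
    _ = z ^ ((q : ℤ) * Nat.gcdA q r + r * Nat.gcdB q r) := by
        rw [hzc, ← zpow_natCast z r, ← zpow_mul, ← zpow_add₀ hz, mul_comm (q : ℤ)]
    _ = z := by rw [gcd_coprime_eq h, zpow_one]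

theorem commonRoot_pow_right {z c : ℂ} (hc : c ≠ 0) (hzc : c ^ q = z ^ r) :
    commonRoot q r z c ^ r = c := by
  calc commonRoot q r z c ^ r = (z ^ r) ^ Nat.gcdA q r * (c ^ (Nat.gcdB q r * r)) := by
        rw [commonRoot, mul_pow, ← zpow_natCast, ← zpow_mul, ← zpow_natCast (c ^ Nat.gcdB q r),
          ← zpow_mul, mul_comm (Nat.gcdA q r), zpow_mul z, zpow_natCast z]
    _ = c ^ ((q : ℤ) * Nat.gcdA q r + r * Nat.gcdB q r) := by
        rw [← hzc, ← zpow_natCast c q, ← zpow_mul, ← zpow_add₀ hc, mul_comm (r : ℤ)]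
    _ = c := by rw [gcd_coprime_eq h, zpow_one]

end commonRoot

theorem norm_commonRoot {q r : ℕ} {z c : ℂ} (hz : ‖z‖ = 1) (hc : ‖c‖ = 1) :
    ‖commonRoot q r z c‖ = 1 := by simp [commonRoot, hz, hc]

theorem ContinuousAt.commonRoot {T : Type*} [TopologicalSpace T] {q r : ℕ} {f g : T → ℂ} {t : T}
    (hf : ContinuousAt f t) (hg : ContinuousAt g t) (hf0 : f t ≠ 0) (hg0 : g t ≠ 0) :
    ContinuousAt (fun s => commonRoot q r (f s) (g s)) t :=
  (hf.zpow₀ _ (Or.inl hf0)).mul (hg.zpow₀ _ (Or.inl hg0))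

theorem commonRoot_pow_pow {q r : ℕ} (h : Nat.Coprime q r) {s : ℂ} (hs : s ≠ 0) :
    commonRoot q r (s ^ q) (s ^ r) = s := by
  rw [commonRoot, ← zpow_natCast, ← zpow_natCast, ← zpow_mul, ← zpow_mul, ← zpow_add₀ hs,
    gcd_coprime_eq h, zpow_one]

theorem exists_continuousOn_codRestrict {X Y : Type*} [TopologicalSpace X] [TopologicalSpace Y]
    {S : Set Y} (y₀ : S) {W : Set X} {f : X → Y} (hf : ContinuousOn f W) (h : MapsTo f W S) :
    ∃ σ : X → S, ContinuousOn σ W ∧ ∀ x ∈ W, (σ x : Y) = f x := by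
  classical
  refine ⟨fun x => if hx : f x ∈ S then ⟨f x, hx⟩ else y₀, ?_, fun x hx => ?_⟩
  · rw [IsInducing.subtypeVal.continuousOn_iff]
    exact hf.congr fun x hx => by simp [h hx]
  · simp [h hx]

/-! ### Neighborhoods of the singular fibers in the affine model -/

/-- The affine model `{(x, y, z) | x ^ p + y ^ q = z ^ r, |z| = 1}` of the fiber complement. -/
def fiberModel (p q r : ℕ) : Set (ℂ × ℂ × Circle) :=
  {v | v.1 ^ p + v.2.1 ^ q = (v.2.2 : ℂ) ^ r}

/-- The domain of the parametrization of a neighborhood of the singular fiber `x = 0`. -/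
def pieceDomain (p : ℕ) : Set (ℂ × ℝ) := {y | 1 - y.1 ^ p ∈ Complex.slitPlane}

theorem cpow_inv_pow {q : ℕ} (hq : q ≠ 0) (b : ℂ) : (b ^ ((q : ℂ)⁻¹)) ^ q = b :=
  Complex.cpow_nat_inv_pow b hq

theorem cpow_inv_ne_zero {q : ℕ} (hq : q ≠ 0) {b : ℂ} (hb : b ≠ 0) : b ^ ((q : ℂ)⁻¹) ≠ 0 := by
  intro h
  have := cpow_inv_pow hq b
  rw [h, zero_pow hq] at this
  exact hb this.symm

section piece

variable {p q r : ℕ}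

/-- The second coordinate of a point of the model, divided by its principal value. -/
noncomputable def phase (q r : ℕ) (y z : ℂ) : ℂ := y / (y ^ q / z ^ r) ^ ((q : ℂ)⁻¹)

theorem phase_pow (hq : q ≠ 0) {y z : ℂ} (hy : y ≠ 0) (hz : z ≠ 0) : phase q r y z ^ q = z ^ r := by
  rw [phase, div_pow, cpow_inv_pow hq]
  field_simp

theorem norm_phase (hq : q ≠ 0) {y z : ℂ} (hy : y ≠ 0) (hz : ‖z‖ = 1) : ‖phase q r y z‖ = 1 := by
  have h := congrArg norm (phase_pow (r := r) hq hy (norm_ne_zero_iff.1 (hz ▸ one_ne_zero)))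
  rw [norm_pow, norm_pow, hz, one_pow] at h
  exact (pow_eq_one_iff_of_nonneg (norm_nonneg _) hq).1 h

theorem ne_zero_of_slit (hq : q ≠ 0) {y z : ℂ} (h : y ^ q / z ^ r ∈ Complex.slitPlane) : y ≠ 0 := by
  rintro rfl
  rw [zero_pow hq, zero_div] at h
  exact Complex.slitPlane_ne_zero h rfl

theorem phase_mul (hq : q ≠ 0) {y z : ℂ} (h : y ^ q / z ^ r ∈ Complex.slitPlane) :
    (y ^ q / z ^ r) ^ ((q : ℂ)⁻¹) * phase q r y z = y := by
  rw [phase]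
  field_simp [cpow_inv_ne_zero hq (Complex.slitPlane_ne_zero h)]

theorem continuousAt_phase {T : Type*} [TopologicalSpace T] (hq : q ≠ 0) {f g : T → ℂ} {t : T}
    (hf : ContinuousAt f t) (hg : ContinuousAt g t) (hg0 : g t ≠ 0)
    (h : f t ^ q / g t ^ r ∈ Complex.slitPlane) :
    ContinuousAt (fun s => phase q r (f s) (g s)) t := by
  refine hf.div ?_ (cpow_inv_ne_zero hq (Complex.slitPlane_ne_zero h))
  exact ContinuousAt.comp (f := fun s => f s ^ q / g s ^ r) (continuousAt_cpow_const h)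
    ((hf.pow q).div (hg.pow r) (pow_ne_zero _ hg0))

theorem pieceProj_mem (hp : p ≠ 0) (hq : q ≠ 0) (y : ℂ × ℝ) :
    (y.1 * (unitExp (q * r * y.2 / p) : ℂ), (1 - y.1 ^ p) ^ ((q : ℂ)⁻¹) * (unitExp (r * y.2) : ℂ),
      unitExp (q * y.2)) ∈ fiberModel p q r := by
  have hp' : (p : ℝ) ≠ 0 := Nat.cast_ne_zero.2 hp
  simp only [fiberModel, mem_ofPred_eq, mul_pow, cpow_inv_pow hq]
  have h1 : ((unitExp (q * r * y.2 / p) : ℂ)) ^ p = unitExp (q * r * y.2) := by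
    rw [← Circle.coe_pow, ← unitExp_nat_mul]; congr 2; field_simp
  have h2 : ((unitExp (r * y.2) : ℂ)) ^ q = unitExp (q * r * y.2) := by
    rw [← Circle.coe_pow, ← unitExp_nat_mul]; congr 2; ring
  have h3 : ((unitExp (q * y.2) : ℂ)) ^ r = unitExp (q * r * y.2) := by
    rw [← Circle.coe_pow, ← unitExp_nat_mul]; congr 2; ring
  rw [h1, h2, h3]
  ring

/-- The parametrization of a neighborhood of the singular fiber `x = 0`. -/
noncomputable def pieceProj (hp : p ≠ 0) (hq : q ≠ 0) : C(pieceDomain p, fiberModel p q r) where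
  toFun y := ⟨_, pieceProj_mem hp hq y.1⟩
  continuous_toFun := by
    refine Continuous.subtype_mk (Continuous.prodMk (by fun_prop) (Continuous.prodMk ?_
      (by fun_prop))) _
    refine Continuous.mul ?_ (by fun_prop)
    rw [continuous_iff_continuousAt]
    intro y
    exact ContinuousAt.comp (f := fun y : pieceDomain p => 1 - y.1.1 ^ p)
      (continuousAt_cpow_const y.2) (by fun_prop)

/-- The point `unitExp t` is determined by its `q`-th power `z` and its `r`-th power, the phase of
the second coordinate, as `q` and `r` are coprime. Undoing the rotation of the first coordinate then
recovers the parameter `ξ`. -/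
theorem pieceProj_eq (hp : p ≠ 0) (hq : q ≠ 0) (v : fiberModel p q r)
    (hv : v.1.2.1 ^ q / (v.1.2.2 : ℂ) ^ r ∈ Complex.slitPlane) (y : pieceDomain p) 
    (hx : y.1.1 = v.1.1 * unitExp (-(q * r * y.1.2 / p)))
    (ht : (unitExp y.1.2 : ℂ) = commonRoot q r v.1.2.2 (phase q r v.1.2.1 v.1.2.2))
    (hqr : Nat.Coprime q r) : pieceProj hp hq y = v := by
  have hp' : (p : ℝ) ≠ 0 := Nat.cast_ne_zero.2 hp
  obtain ⟨⟨a, b, z⟩, hv0⟩ := v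
  obtain ⟨⟨ξ, t⟩, hy⟩ := y
  dsimp only at *
  have hb := ne_zero_of_slit hq hv
  have hpow := phase_pow (r := r) hq hb z.coe_ne_zero
  have hne : phase q r b z ≠ 0 := norm_ne_zero_iff.1 (by
    rw [norm_phase hq hb z.norm_coe]; exact one_ne_zero)
  have e1 : (unitExp (q * t) : ℂ) = z := by
    rw [unitExp_nat_mul, Circle.coe_pow, ht, commonRoot_pow_left hqr z.coe_ne_zero hpow]
  have e2 : (unitExp (r * t) : ℂ) = phase q r b z := by
    rw [unitExp_nat_mul, Circle.coe_pow, ht, commonRoot_pow_right hqr hne hpow]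
  have e3 : ((unitExp (-(q * r * t / p)) : ℂ)) ^ p = (z ^ r : ℂ)⁻¹ := by
    rw [← e1, ← Circle.coe_pow, ← Circle.coe_pow, ← unitExp_nat_mul, ← unitExp_nat_mul,
      ← Circle.coe_inv, ← unitExp_neg]
    congr 2
    field_simp
  have e4 : 1 - ξ ^ p = b ^ q / (z : ℂ) ^ r := by
    have hz : (z : ℂ) ^ r ≠ 0 := pow_ne_zero _ z.coe_ne_zero
    have : a ^ p + b ^ q = (z : ℂ) ^ r := hv0
    rw [hx, mul_pow, e3]
    field_simp
    linear_combination -this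
  refine Subtype.ext (Prod.ext ?_ (Prod.ext ?_ ?_))
  · change ξ * (unitExp (q * r * t / p) : ℂ) = a
    rw [hx, mul_assoc, mul_comm (unitExp _ : ℂ), unitExp_mul_unitExp_neg, mul_one]
  · change (1 - ξ ^ p) ^ ((q : ℂ)⁻¹) * (unitExp (r * t) : ℂ) = b
    rw [e2, e4, phase_mul hq hv]
  · exact Circle.ext e1

theorem pieceProj_slit (hp : p ≠ 0) (hq : q ≠ 0) (y : pieceDomain p) :
    (pieceProj (r := r) hp hq y).1.2.1 ^ q / ((pieceProj (r := r) hp hq y).1.2.2 : ℂ) ^ r =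
      1 - y.1.1 ^ p := by
  change ((1 - y.1.1 ^ p) ^ ((q : ℂ)⁻¹) * (unitExp (r * y.1.2) : ℂ)) ^ q /
    (unitExp (q * y.1.2) : ℂ) ^ r = _
  rw [mul_pow, cpow_inv_pow hq, ← Circle.coe_pow, ← Circle.coe_pow, ← unitExp_nat_mul,
    ← unitExp_nat_mul, mul_left_comm, mul_div_assoc, div_self (Circle.coe_ne_zero _), mul_one]

theorem pieceProj_commonRoot (hp : p ≠ 0) (hq : q ≠ 0) (hqr : Nat.Coprime q r)
    (y : pieceDomain p) : commonRoot q r (pieceProj (r := r) hp hq y).1.2.2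
      (phase q r (pieceProj (r := r) hp hq y).1.2.1 (pieceProj (r := r) hp hq y).1.2.2) =
      unitExp y.1.2 := by
  rw [phase, pieceProj_slit]
  change commonRoot q r (unitExp (q * y.1.2) : ℂ)
    ((1 - y.1.1 ^ p) ^ ((q : ℂ)⁻¹) * (unitExp (r * y.1.2) : ℂ) / _) = _
  rw [mul_div_cancel_left₀ _ (cpow_inv_ne_zero hq (Complex.slitPlane_ne_zero y.2)),
    unitExp_nat_mul, unitExp_nat_mul, Circle.coe_pow, Circle.coe_pow,
    commonRoot_pow_pow hqr (Circle.coe_ne_zero _)]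

theorem mem_pieceDomain (hp : p ≠ 0) (hq : q ≠ 0) (hqr : Nat.Coprime q r) (v : fiberModel p q r)
    (hv : v.1.2.1 ^ q / (v.1.2.2 : ℂ) ^ r ∈ Complex.slitPlane) {t : ℝ}
    (ht : (unitExp t : ℂ) = commonRoot q r v.1.2.2 (phase q r v.1.2.1 v.1.2.2)) :
    (v.1.1 * (unitExp (-(q * r * t / p)) : ℂ), t) ∈ pieceDomain p := by
  have hp' : (p : ℝ) ≠ 0 := Nat.cast_ne_zero.2 hp
  have hz : (v.1.2.2 : ℂ) ^ r ≠ 0 := pow_ne_zero _ (Circle.coe_ne_zero _)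
  have e1 : (unitExp (q * t) : ℂ) = v.1.2.2 := by
    rw [unitExp_nat_mul, Circle.coe_pow, ht, commonRoot_pow_left hqr (Circle.coe_ne_zero _)
      (phase_pow hq (ne_zero_of_slit hq hv) (Circle.coe_ne_zero _))]
  have e3 : ((unitExp (-(q * r * t / p)) : ℂ)) ^ p = ((v.1.2.2 : ℂ) ^ r)⁻¹ := by
    rw [← e1, ← Circle.coe_pow, ← Circle.coe_pow, ← unitExp_nat_mul, ← unitExp_nat_mul,
      ← Circle.coe_inv, ← unitExp_neg]
    congr 2
    field_simp
  have : v.1.1 ^ p + v.1.2.1 ^ q = (v.1.2.2 : ℂ) ^ r := v.2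
  have e4 : 1 - (v.1.1 * (unitExp (-(q * r * t / p)) : ℂ)) ^ p =
      v.1.2.1 ^ q / (v.1.2.2 : ℂ) ^ r := by
    rw [mul_pow, e3]
    field_simp
    linear_combination -this
  change 1 - (v.1.1 * (unitExp (-(q * r * t / p)) : ℂ)) ^ p ∈ Complex.slitPlane
  rwa [e4]

/-- The neighborhood `{y ^ q / z ^ r ∉ (-∞, 0]}` of the singular fiber `x = 0`, as a quotient of a
contractible space by `ℤ`. -/
noncomputable def pieceCover (hp : p ≠ 0) (hq : q ≠ 0) (hqr : Nat.Coprime q r) :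
    CyclicCover (fiberModel p q r) (pieceDomain p) where
  proj := pieceProj hp hq
  -- A unit translation of `t` fixes the second and third coordinates and rotates the first by `q *
  -- r / p` of a turn; the shift compensates for this rotation.
  shift k y := ⟨(y.1.1 * (unitExp (-(q * r * k / p)) : ℂ), y.1.2 + k), by
    have hp' : (p : ℝ) ≠ 0 := Nat.cast_ne_zero.2 hp
    have : ((unitExp (-(q * r * k / p)) : ℂ)) ^ p = 1 := by
      rw [← Circle.coe_pow, ← unitExp_nat_mul, ← Circle.coe_one, ← unitExp_int (-(q * r * k))]
      congr 2
      push_cast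
      field_simp
    change 1 - (y.1.1 * (unitExp (-(q * r * k / p)) : ℂ)) ^ p ∈ Complex.slitPlane
    rw [mul_pow, this, mul_one]
    exact y.2⟩
  height := ⟨fun y => y.1.2, by fun_prop⟩
  continuous_shift k := by fun_prop
  shift_zero y := by
    refine Subtype.ext (Prod.ext ?_ ?_) <;> simp [unitExp_zero]
  shift_add k l y := by
    refine Subtype.ext (Prod.ext ?_ ?_)
    · simp only [mul_assoc]
      rw [← Circle.coe_mul, ← unitExp_add]
      congr 3
      push_cast
      ring
    · simp only; push_cast; ring
  height_shift k y := rfl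
  proj_shift k y := by
    have hp' : (p : ℝ) ≠ 0 := Nat.cast_ne_zero.2 hp
    have h1 : ((unitExp (-(q * r * k / p)) : ℂ)) ^ p = 1 := by
      rw [← Circle.coe_pow, ← unitExp_nat_mul, ← Circle.coe_one, ← unitExp_int (-(q * r * k))]
      congr 2
      push_cast
      field_simp
    refine Subtype.ext (Prod.ext ?_ (Prod.ext ?_ ?_))
    · change y.1.1 * (unitExp (-(q * r * k / p)) : ℂ) * (unitExp (q * r * (y.1.2 + k) / p) : ℂ) =
        y.1.1 * (unitExp (q * r * y.1.2 / p) : ℂ)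
      rw [mul_assoc, ← Circle.coe_mul, ← unitExp_add]
      congr 3
      ring
    · change (1 - (y.1.1 * (unitExp (-(q * r * k / p)) : ℂ)) ^ p) ^ ((q : ℂ)⁻¹) *
        (unitExp (r * (y.1.2 + k)) : ℂ) = (1 - y.1.1 ^ p) ^ ((q : ℂ)⁻¹) * (unitExp (r * y.1.2) : ℂ)
      have h2 : unitExp (r * (y.1.2 + k)) = unitExp (r * y.1.2) :=
        unitExp_eq_iff.2 ⟨r * k, by push_cast; ring⟩
      rw [mul_pow, h1, mul_one, h2]
    · change unitExp (q * (y.1.2 + k)) = unitExp (q * y.1.2)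
      rw [unitExp_eq_iff]
      exact ⟨q * k, by push_cast; ring⟩
  exists_shift y y' h := by
    have h0 := pieceProj_commonRoot (r := r) hp hq hqr y
    rw [h, pieceProj_commonRoot hp hq hqr, Circle.coe_inj, unitExp_eq_iff] at h0
    obtain ⟨k, hk⟩ := h0
    refine ⟨k, Subtype.ext (Prod.ext ?_ hk.symm)⟩
    have hx : y.1.1 * (unitExp (q * r * y.1.2 / p) : ℂ) =
        y'.1.1 * (unitExp (q * r * y'.1.2 / p) : ℂ) := congrArg (fun v => v.1.1) h
    have e : (unitExp (q * r * y'.1.2 / p) : ℂ) =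
        unitExp (q * r * y.1.2 / p) * unitExp (q * r * k / p) := by
      rw [← Circle.coe_mul, ← unitExp_add, hk]
      congr 2
      ring
    change y.1.1 * (unitExp (-(q * r * k / p)) : ℂ) = y'.1.1
    rw [e] at hx
    have hx' : y.1.1 = y'.1.1 * unitExp (q * r * k / p) :=
      mul_right_cancel₀ (Circle.coe_ne_zero (unitExp (q * r * y.1.2 / p))) (by rw [hx]; ring)
    rw [hx', mul_assoc, unitExp_mul_unitExp_neg, mul_one]
  exists_section y := by
    let s : fiberModel p q r → ℂ := fun v => commonRoot q r v.1.2.2 (phase q r v.1.2.1 v.1.2.2)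
    let U : Set (fiberModel p q r) := {v | v.1.2.1 ^ q / (v.1.2.2 : ℂ) ^ r ∈ Complex.slitPlane}
    have hU : IsOpen U := Complex.isOpen_slitPlane.preimage
      ((by fun_prop : Continuous fun v : fiberModel p q r => v.1.2.1 ^ q).div (by fun_prop)
        fun v => pow_ne_zero _ (Circle.coe_ne_zero _))
    have hs : ∀ v ∈ U, ‖s v‖ = 1 := fun v hv =>
      norm_commonRoot (Circle.norm_coe _) (norm_phase hq (ne_zero_of_slit hq hv) (Circle.norm_coe _))
    have hsc : ContinuousOn s U := fun v hv => by
      have hz : ContinuousAt (fun v : fiberModel p q r => (v.1.2.2 : ℂ)) v := by fun_prop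
      have hy : ContinuousAt (fun v : fiberModel p q r => v.1.2.1) v := by fun_prop
      have hne : phase q r v.1.2.1 v.1.2.2 ≠ 0 := norm_ne_zero_iff.1 (by
        rw [norm_phase hq (ne_zero_of_slit hq hv) (Circle.norm_coe _)]
        exact one_ne_zero)
      exact (hz.commonRoot (continuousAt_phase hq hy hz (Circle.coe_ne_zero _) hv)
        (Circle.coe_ne_zero _) hne).continuousWithinAt
    -- On `W` the common root stays off the ray opposite to `unitExp y.1.2`, so a continuous branch
    -- of its angle exists there.
    let W : Set (fiberModel p q r) :=
      U ∩ (fun v => s v * (unitExp (-y.1.2) : ℂ)) ⁻¹' Complex.slitPlane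
    have hW : IsOpen W := (hsc.mul continuousOn_const).isOpen_inter_preimage hU
      Complex.isOpen_slitPlane
    let τ : fiberModel p q r → ℝ := fun v => localAngle y.1.2 (s v)
    have hτ : ContinuousOn τ W := fun v hv =>
      (continuousAt_localAngle hv.2).comp_continuousWithinAt ((hsc v hv.1).mono inter_subset_left)
    have hτe : ∀ v ∈ W, (unitExp (τ v) : ℂ) = s v := fun v hv =>
      unitExp_localAngle _ (hs v hv.1)
    obtain ⟨σ, hσ, hσ'⟩ := exists_continuousOn_codRestrict (W := W) y
      (f := fun v => (v.1.1 * (unitExp (-(q * r * τ v / p)) : ℂ), τ v))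
      (by
        refine ContinuousOn.prodMk (ContinuousOn.mul (by fun_prop) ?_) hτ
        have : Continuous fun t : ℝ => (unitExp (-(q * r * t / p)) : ℂ) := by fun_prop
        exact this.comp_continuousOn hτ)
      (fun v hv => mem_pieceDomain hp hq hqr v hv.1 (hτe v hv))
    refine ⟨W, hW, ⟨?_, ?_⟩, σ, hσ, fun v hv => ?_⟩
    · change _ ∈ Complex.slitPlane
      rw [pieceProj_slit]
      exact y.2
    · change commonRoot q r _ _ * _ ∈ Complex.slitPlane
      rw [pieceProj_commonRoot hp hq hqr, unitExp_mul_unitExp_neg]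
      exact Complex.one_mem_slitPlane
    · refine pieceProj_eq hp hq v hv.1 (σ v) ?_ ?_ hqr
      · rw [hσ' v hv]
      · rw [hσ' v hv]; exact hτe v hv

theorem exists_pieceProj_eq (hp : p ≠ 0) (hq : q ≠ 0) (hqr : Nat.Coprime q r) (v : fiberModel p q r)
    (hv : v.1.2.1 ^ q / (v.1.2.2 : ℂ) ^ r ∈ Complex.slitPlane) :
    ∃ y, pieceProj hp hq y = v := by
  have ht := unitExp_localAngle 0 (norm_commonRoot (q := q) (r := r) (Circle.norm_coe v.1.2.2)
    (norm_phase (r := r) hq (ne_zero_of_slit hq hv) (Circle.norm_coe v.1.2.2)))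
  exact ⟨⟨_, mem_pieceDomain hp hq hqr v hv ht⟩, pieceProj_eq hp hq v hv _ rfl ht hqr⟩

/-- The domain is star-shaped about the origin: `1 - (b * ξ) ^ p` is the convex combination of `1`
and `1 - ξ ^ p` with weight `b ^ p`, and the slit plane is star-shaped about `1`. -/
instance simplyConnectedSpace_pieceDomain [NeZero p] : SimplyConnectedSpace (pieceDomain p) := by
  have h0 : ((0 : ℂ), (0 : ℝ)) ∈ pieceDomain p := by
    simp [pieceDomain, zero_pow (NeZero.ne p)]
  have hs : StarConvex ℝ ((0 : ℂ), (0 : ℝ)) (pieceDomain p) := by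
    rw [starConvex_iff_forall_pos h0]
    rintro ⟨ξ, t⟩ hξ a b ha hb hab
    have hξ' : 1 - ξ ^ p ∈ Complex.slitPlane := hξ
    change 1 - (a • (0 : ℂ) + b • ξ) ^ p ∈ Complex.slitPlane
    have hb1 : b ^ p ≤ 1 := pow_le_one₀ hb.le (by linarith)
    have := Complex.starConvex_one_slitPlane hξ' (sub_nonneg.2 hb1) (pow_nonneg hb.le p)
      (sub_add_cancel 1 (b ^ p))
    convert this using 1
    simp only [Complex.real_smul]
    push_cast
    ring
  have := hs.contractibleSpace ⟨_, h0⟩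
  infer_instance

end piece

/-- Transport of a cyclic cover along a homeomorphism of the base. -/
def CyclicCover.congr {X X' Y : Type*} [TopologicalSpace X] [TopologicalSpace X']
    [TopologicalSpace Y] (c : CyclicCover X Y) (e : X ≃ₜ X') : CyclicCover X' Y where
  proj := (e : C(X, X')).comp c.proj
  shift := c.shift
  height := c.height
  continuous_shift := c.continuous_shift
  shift_zero := c.shift_zero
  shift_add := c.shift_add
  height_shift := c.height_shift
  proj_shift k y := congrArg e (c.proj_shift k y)
  exists_shift y y' h := c.exists_shift y y' (e.injective h)
  exists_section y := by
    obtain ⟨W, hW, hy, σ, hσ, hσ'⟩ := c.exists_section y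
    refine ⟨e.symm ⁻¹' W, hW.preimage e.symm.continuous, by simpa using hy, σ ∘ e.symm,
      hσ.comp e.symm.continuous.continuousOn fun x hx => hx, fun x hx => ?_⟩
    simp [hσ' _ hx]

/-- Exchanging the coordinates `x` and `y`. -/
def fiberModelSwap (p q r : ℕ) : fiberModel q p r ≃ₜ fiberModel p q r where
  toFun v := ⟨(v.1.2.1, v.1.1, v.1.2.2), by
    have : v.1.1 ^ q + v.1.2.1 ^ p = (v.1.2.2 : ℂ) ^ r := v.2
    rw [add_comm] at this
    exact this⟩
  invFun v := ⟨(v.1.2.1, v.1.1, v.1.2.2), by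
    have : v.1.1 ^ p + v.1.2.1 ^ q = (v.1.2.2 : ℂ) ^ r := v.2
    rw [add_comm] at this
    exact this⟩
  left_inv v := rfl
  right_inv v := rfl
  continuous_toFun := by fun_prop
  continuous_invFun := by fun_prop

/-! ### The overlap and its deck group -/

/-- The domain of the parametrization of the complement of both singular fibers. -/
def overlapDomain : Set (ℂ × ℝ) := {w | w.1 ∈ Complex.slitPlane ∧ 1 - w.1 ∈ Complex.slitPlane}

/-- The slit plane is star-shaped about `1 / 2`, and `α ↦ 1 - α` is affine and fixes this point. -/
instance pathConnectedSpace_overlapDomain : PathConnectedSpace overlapDomain := by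
  have h0 : (((1 / 2 : ℝ) : ℂ), (0 : ℝ)) ∈ overlapDomain := by
    constructor
    · exact Complex.ofReal_mem_slitPlane.2 (by norm_num)
    · have : (1 : ℂ) - ((1 / 2 : ℝ) : ℂ) = ((1 / 2 : ℝ) : ℂ) := by push_cast; norm_num
      change 1 - ((1 / 2 : ℝ) : ℂ) ∈ _
      rw [this]
      exact Complex.ofReal_mem_slitPlane.2 (by norm_num)
  have hs : StarConvex ℝ (((1 / 2 : ℝ) : ℂ), (0 : ℝ)) overlapDomain := by
    rintro ⟨α, t⟩ ⟨h1, h2⟩ a b ha hb hab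
    have hc := Complex.starConvex_ofReal_slitPlane (x := 1 / 2) (by norm_num)
    refine ⟨hc h1 ha hb hab, ?_⟩
    have := hc h2 ha hb hab
    convert this using 1
    simp only [Prod.smul_mk, Prod.mk_add_mk, Complex.real_smul]
    have hab' : (a : ℂ) + b = 1 := by exact_mod_cast hab
    push_cast
    linear_combination -hab'
  have := hs.contractibleSpace ⟨_, h0⟩
  infer_instance

section overlap

variable {p q r : ℕ}

/-- The inclusion of the overlap in a piece. -/
noncomputable def overlapInclusion (hp : p ≠ 0) : C(overlapDomain, pieceDomain p) where
  toFun w := ⟨(w.1.1 ^ ((p : ℂ)⁻¹), p * w.1.2), by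
    change 1 - (w.1.1 ^ ((p : ℂ)⁻¹)) ^ p ∈ Complex.slitPlane
    rw [cpow_inv_pow hp]
    exact w.2.2⟩
  continuous_toFun := by
    refine Continuous.subtype_mk (Continuous.prodMk ?_ (by fun_prop)) _
    rw [continuous_iff_continuousAt]
    intro w
    exact ContinuousAt.comp (f := fun w : overlapDomain => w.1.1)
      (continuousAt_cpow_const w.2.1) (by fun_prop)

/-- The involution `α ↦ 1 - α` of the overlap. -/
def overlapSwap : C(overlapDomain, overlapDomain) where
  toFun w := ⟨(1 - w.1.1, w.1.2), w.2.2, by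
    change 1 - (1 - w.1.1) ∈ _
    rw [sub_sub_cancel]
    exact w.2.1⟩
  continuous_toFun := by fun_prop

/-- Translation of the second coordinate of the overlap. -/
def overlapShift (k : ℤ) (w : overlapDomain) : overlapDomain := ⟨(w.1.1, w.1.2 + k), w.2⟩

theorem overlapInclusion_shift (hp : p ≠ 0) (hq : q ≠ 0) (hqr : Nat.Coprime q r) (k : ℤ)
    (w : overlapDomain) : overlapInclusion hp (overlapShift k w) =
      (pieceCover (r := r) hp hq hqr).shift (p * k) (overlapInclusion hp w) := by
  have hp' : (p : ℝ) ≠ 0 := Nat.cast_ne_zero.2 hp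
  have h1 : unitExp (-(q * r * ((p * k : ℤ) : ℝ) / p)) = 1 := by
    rw [← unitExp_int (-(q * r * k))]
    congr 1
    push_cast
    field_simp
  refine Subtype.ext (Prod.ext ?_ ?_)
  · change _ = w.1.1 ^ ((p : ℂ)⁻¹) * (unitExp (-(q * r * ((p * k : ℤ) : ℝ) / p)) : ℂ)
    rw [h1, Circle.coe_one, mul_one]
    rfl
  · change (p : ℝ) * (w.1.2 + k) = p * w.1.2 + ((p * k : ℤ) : ℝ)
    push_cast
    ring

/-- The formula is symmetric under exchanging `p` with `q`, `α` with `1 - α`, and the first two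
coordinates; hence the two pieces induce the same projection on the overlap. -/
theorem pieceProj_overlapInclusion (hp : p ≠ 0) (hq : q ≠ 0) (w : overlapDomain) :
    (pieceProj (r := r) hp hq (overlapInclusion hp w)).1 =
      (w.1.1 ^ ((p : ℂ)⁻¹) * (unitExp (q * r * w.1.2) : ℂ),
        (1 - w.1.1) ^ ((q : ℂ)⁻¹) * (unitExp (p * r * w.1.2) : ℂ), unitExp (p * q * w.1.2)) := by
  have hp' : (p : ℝ) ≠ 0 := Nat.cast_ne_zero.2 hp
  refine Prod.ext ?_ (Prod.ext ?_ ?_)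
  · change w.1.1 ^ ((p : ℂ)⁻¹) * (unitExp (q * r * (p * w.1.2) / p) : ℂ) = _
    congr 3
    field_simp
  · change (1 - (w.1.1 ^ ((p : ℂ)⁻¹)) ^ p) ^ ((q : ℂ)⁻¹) * (unitExp (r * (p * w.1.2)) : ℂ) = _
    rw [cpow_inv_pow hp]
    congr 3
    ring
  · change unitExp (q * (p * w.1.2)) = _
    congr 1
    ring

theorem pieceProj_overlapSwap (hp : p ≠ 0) (hq : q ≠ 0) (w : overlapDomain) :
    fiberModelSwap p q r (pieceProj (r := r) hq hp (overlapInclusion hq (overlapSwap w))) =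
      pieceProj (r := r) hp hq (overlapInclusion hp w) := by
  have h1 := pieceProj_overlapInclusion (r := r) hp hq w
  have h2 := pieceProj_overlapInclusion (r := r) hq hp (overlapSwap w)
  refine Subtype.ext ?_
  rw [h1]
  change ((pieceProj (r := r) hq hp (overlapInclusion hq (overlapSwap w))).1.2.1,
    (pieceProj (r := r) hq hp (overlapInclusion hq (overlapSwap w))).1.1,
    (pieceProj (r := r) hq hp (overlapInclusion hq (overlapSwap w))).1.2.2) = _
  rw [h2]
  change ((1 - (1 - w.1.1)) ^ ((p : ℂ)⁻¹) * (unitExp (q * r * w.1.2) : ℂ),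
    (1 - w.1.1) ^ ((q : ℂ)⁻¹) * (unitExp (p * r * w.1.2) : ℂ), unitExp (q * p * w.1.2)) = _
  rw [sub_sub_cancel, mul_comm (q : ℝ) p]

/-- The parameter `ξ` differs from the principal `p`-th root of `ξ ^ p` by a `p`-th root of unity.
Deck transformations multiply `ξ` by powers of a primitive one, since `q * r` is coprime to `p`, so
one of them makes `ξ` principal. -/
theorem exists_overlap (hp : p ≠ 0) (hq : q ≠ 0) (hpq : Nat.Coprime p q) (hpr : Nat.Coprime p r)
    (hqr : Nat.Coprime q r) (y₁ : pieceDomain p)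
    (h : (pieceProj (r := r) hp hq y₁).1.1 ^ p / ((pieceProj (r := r) hp hq y₁).1.2.2 : ℂ) ^ r ∈
      Complex.slitPlane) :
    ∃ w, pieceProj (r := r) hp hq (overlapInclusion hp w) = pieceProj hp hq y₁ := by
  have hp' : (p : ℝ) ≠ 0 := Nat.cast_ne_zero.2 hp
  have hz : ((pieceProj (r := r) hp hq y₁).1.2.2 : ℂ) ^ r ≠ 0 :=
    pow_ne_zero _ (Circle.coe_ne_zero _)
  have hα : (pieceProj (r := r) hp hq y₁).1.1 ^ p / ((pieceProj (r := r) hp hq y₁).1.2.2 : ℂ) ^ r =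
      y₁.1.1 ^ p := by
    have e1 := pieceProj_slit (r := r) hp hq y₁
    have e2 : (pieceProj (r := r) hp hq y₁).1.1 ^ p + (pieceProj (r := r) hp hq y₁).1.2.1 ^ q =
      ((pieceProj (r := r) hp hq y₁).1.2.2 : ℂ) ^ r := (pieceProj (r := r) hp hq y₁).2
    rw [← eq_sub_iff_add_eq] at e2
    rw [e2, sub_div, div_self hz, e1, sub_sub_cancel]
  rw [hα] at h
  obtain ⟨⟨ξ, t⟩, hy⟩ := y₁
  dsimp only at h
  have hξ : ξ ≠ 0 := by
    rintro rfl
    rw [zero_pow hp] at h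
    exact Complex.slitPlane_ne_zero h rfl
  set ζ := (ξ ^ p) ^ ((p : ℂ)⁻¹) with hζ
  have hζp : ζ ^ p = ξ ^ p := cpow_inv_pow hp _
  have hζ0 : ζ ≠ 0 := cpow_inv_ne_zero hp (pow_ne_zero _ hξ)
  have hω : (ξ / ζ) ^ p = 1 := by rw [div_pow, hζp, div_self (pow_ne_zero _ hξ)]
  have hωn : ‖ξ / ζ‖ = 1 := by
    have := congrArg norm hω
    rw [norm_pow, norm_one] at this
    exact (pow_eq_one_iff_of_nonneg (norm_nonneg _) hp).1 this
  set θ := localAngle 0 (ξ / ζ)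
  have hθ : (unitExp θ : ℂ) = ξ / ζ := unitExp_localAngle 0 hωn
  have hθp : unitExp (p * θ) = 1 := Circle.ext (by
    rw [unitExp_nat_mul, Circle.coe_pow, hθ, hω, Circle.coe_one])
  obtain ⟨j, hj⟩ := unitExp_eq_one_iff.1 hθp
  have hcop : Nat.Coprime (q * r) p := Nat.Coprime.mul_left hpq.symm hpr.symm
  have hbez := gcd_coprime_eq hcop
  set a := Nat.gcdA (q * r) p
  set b := Nat.gcdB (q * r) p
  have hbez' : ((q : ℝ) * r) * a + p * b = 1 := by exact_mod_cast hbez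
  have hθ' : unitExp (q * r * ((j * a : ℤ) : ℝ) / p) = unitExp θ := by
    rw [unitExp_eq_iff]
    refine ⟨-(j * b), ?_⟩
    push_cast
    rw [← hj]
    field_simp
    linear_combination θ * hbez'
  -- The root of unity `ξ / ζ` has angle `j / p`, and `a` inverts `q * r` modulo `p`, so the shift
  -- by `j * a` removes it.
  refine ⟨⟨(ξ ^ p, (t + (j * a : ℤ)) / p), h, hy⟩, ?_⟩
  have key : overlapInclusion hp ⟨(ξ ^ p, (t + (j * a : ℤ)) / p), h, hy⟩ =
      (pieceCover (r := r) hp hq hqr).shift (j * a) ⟨(ξ, t), hy⟩ := by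
    refine Subtype.ext (Prod.ext ?_ ?_)
    · change ζ = ξ * (unitExp (-(q * r * ((j * a : ℤ) : ℝ) / p)) : ℂ)
      rw [unitExp_neg, hθ', Circle.coe_inv, hθ]
      field_simp
    · change (p : ℝ) * ((t + (j * a : ℤ)) / p) = t + (j * a : ℤ)
      field_simp
  rw [key]
  exact (pieceCover (r := r) hp hq hqr).proj_shift _ _

/-- The complement of both singular fibers as a quotient by `ℤ`. -/
noncomputable def overlapCover (hp : p ≠ 0) (hq : q ≠ 0) (hpq : Nat.Coprime p q)
    (hpr : Nat.Coprime p r) (hqr : Nat.Coprime q r) :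
    CyclicCover (fiberModel p q r) overlapDomain where
  proj := (pieceProj hp hq).comp (overlapInclusion hp)
  shift := overlapShift
  height := ⟨fun w => w.1.2, by fun_prop⟩
  continuous_shift k := by unfold overlapShift; fun_prop
  shift_zero w := Subtype.ext (Prod.ext rfl (by simp [overlapShift]))
  shift_add k l w := Subtype.ext (Prod.ext rfl (by simp [overlapShift]; ring))
  height_shift k w := rfl
  proj_shift k w := by
    rw [ContinuousMap.comp_apply, overlapInclusion_shift (r := r) hp hq hqr]
    exact (pieceCover (r := r) hp hq hqr).proj_shift _ _
  exists_shift w w' h := by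
    have hα : w.1.1 = w'.1.1 := by
      have := pieceProj_slit (r := r) hp hq (overlapInclusion hp w)
      rw [← ContinuousMap.comp_apply, h, ContinuousMap.comp_apply, pieceProj_slit] at this
      change 1 - (w'.1.1 ^ ((p : ℂ)⁻¹)) ^ p = 1 - (w.1.1 ^ ((p : ℂ)⁻¹)) ^ p at this
      rw [cpow_inv_pow hp, cpow_inv_pow hp] at this
      exact (sub_right_injective this).symm
    obtain ⟨k, hk⟩ := (pieceCover (r := r) hp hq hqr).exists_shift (overlapInclusion hp w)
      (overlapInclusion hp w') h
    obtain ⟨l, hl⟩ := (pieceCover (r := r) hq hp hpr).exists_shift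
      (overlapInclusion hq (overlapSwap w)) (overlapInclusion hq (overlapSwap w'))
      ((fiberModelSwap p q r).injective (by
        change fiberModelSwap p q r (pieceProj hq hp _) = fiberModelSwap p q r (pieceProj hq hp _)
        rw [pieceProj_overlapSwap, pieceProj_overlapSwap]
        exact h))
    have hk' : (p : ℝ) * w.1.2 + k = p * w'.1.2 := congrArg (fun y => y.1.2) hk
    have hl' : (q : ℝ) * w.1.2 + l = q * w'.1.2 := congrArg (fun y => y.1.2) hl
    -- The pieces show that `p` times and `q` times the height difference are integers; by
    -- coprimality the difference itself is one.
    obtain ⟨n, hn⟩ := exists_int_of_coprime hpq (a := w'.1.2 - w.1.2) ⟨k, by linarith⟩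
      ⟨l, by linarith⟩
    exact ⟨n, Subtype.ext (Prod.ext hα (by
      change w.1.2 + n = w'.1.2
      rw [← hn]; ring))⟩
  exists_section w := by
    obtain ⟨W₁, hW₁, hw₁, σ₁, hσ₁, hσ₁'⟩ :=
      (pieceCover (r := r) hp hq hqr).exists_section (overlapInclusion hp w)
    obtain ⟨W₂, hW₂, hw₂, σ₂, hσ₂, hσ₂'⟩ :=
      ((pieceCover (r := r) hq hp hpr).congr (fiberModelSwap p q r)).exists_section
        (overlapInclusion hq (overlapSwap w))
    change fiberModelSwap p q r (pieceProj hq hp _) ∈ W₂ at hw₂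
    rw [pieceProj_overlapSwap hp hq] at hw₂
    change ∀ x ∈ W₁, pieceProj hp hq (σ₁ x) = x at hσ₁'
    change ∀ x ∈ W₂, fiberModelSwap p q r (pieceProj hq hp (σ₂ x)) = x at hσ₂'
    have hbez : (p : ℝ) * Nat.gcdA p q + q * Nat.gcdB p q = 1 := by
      exact_mod_cast gcd_coprime_eq hpq
    -- Up to integers, the sections of the two pieces have heights `p * t` and `q * t`. Their Bezout
    -- combination is `t` up to an integer, and is continuous, unlike a pointwise choice.
    have key : ∀ v ∈ W₁ ∩ W₂, ∃ w' : overlapDomain,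
        w'.1 = (v.1.1 ^ p / (v.1.2.2 : ℂ) ^ r,
          Nat.gcdA p q * (σ₁ v).1.2 + Nat.gcdB p q * (σ₂ v).1.2) ∧
        pieceProj hp hq (overlapInclusion hp w') = v := by
      rintro v ⟨hv₁, hv₂⟩
      have hsl : v.1.1 ^ p / (v.1.2.2 : ℂ) ^ r ∈ Complex.slitPlane := by
        have := pieceProj_slit (r := r) hq hp (σ₂ v)
        rw [← hσ₂' v hv₂]
        change (pieceProj (r := r) hq hp (σ₂ v)).1.2.1 ^ p /
          ((pieceProj (r := r) hq hp (σ₂ v)).1.2.2 : ℂ) ^ r ∈ _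
        rw [this]
        exact (σ₂ v).2
      obtain ⟨w', hw'⟩ := exists_overlap hp hq hpq hpr hqr (σ₁ v) (by
        rw [hσ₁' v hv₁]; exact hsl)
      rw [hσ₁' v hv₁] at hw'
      obtain ⟨k, hk⟩ := (pieceCover (r := r) hp hq hqr).exists_shift (overlapInclusion hp w')
        (σ₁ v) (hw'.trans (hσ₁' v hv₁).symm)
      obtain ⟨l, hl⟩ := (pieceCover (r := r) hq hp hpr).exists_shift
        (overlapInclusion hq (overlapSwap w')) (σ₂ v) ((fiberModelSwap p q r).injective (by
          change fiberModelSwap p q r (pieceProj hq hp _) = fiberModelSwap p q r (pieceProj hq hp _)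
          rw [pieceProj_overlapSwap, hw', hσ₂' v hv₂]))
      have hk' : (p : ℝ) * w'.1.2 + k = (σ₁ v).1.2 := congrArg (fun y => y.1.2) hk
      have hl' : (q : ℝ) * w'.1.2 + l = (σ₂ v).1.2 := congrArg (fun y => y.1.2) hl
      refine ⟨overlapShift (Nat.gcdA p q * k + Nat.gcdB p q * l) w', Prod.ext ?_ ?_, ?_⟩
      · change w'.1.1 = _
        have e1 := pieceProj_overlapInclusion (r := r) hp hq w'
        rw [hw'] at e1
        rw [e1]
        change w'.1.1 = (w'.1.1 ^ ((p : ℂ)⁻¹) * (unitExp (q * r * w'.1.2) : ℂ)) ^ p /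
          (unitExp (p * q * w'.1.2) : ℂ) ^ r
        rw [mul_pow, cpow_inv_pow hp, ← Circle.coe_pow, ← Circle.coe_pow, ← unitExp_nat_mul,
          ← unitExp_nat_mul, mul_div_assoc]
        have e2 : (p : ℝ) * (q * r * w'.1.2) = r * (p * q * w'.1.2) := by ring
        rw [e2, div_self (Circle.coe_ne_zero _), mul_one]
      · change w'.1.2 + ((Nat.gcdA p q * k + Nat.gcdB p q * l : ℤ) : ℝ) = _
        rw [← hk', ← hl']
        push_cast
        linear_combination -w'.1.2 * hbez
      · rw [overlapInclusion_shift (r := r) hp hq hqr]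
        exact ((pieceCover (r := r) hp hq hqr).proj_shift _ _).trans hw'
    obtain ⟨σ, hσ, hσ'⟩ := exists_continuousOn_codRestrict (W := W₁ ∩ W₂) w
      (f := fun v => (v.1.1 ^ p / (v.1.2.2 : ℂ) ^ r,
          Nat.gcdA p q * (σ₁ v).1.2 + Nat.gcdB p q * (σ₂ v).1.2))
      (by
        have h1 : ContinuousOn (fun v => (σ₁ v).1.2) (W₁ ∩ W₂) :=
          (by fun_prop : Continuous fun y : pieceDomain p => y.1.2).comp_continuousOn
            (hσ₁.mono inter_subset_left)
        have h2 : ContinuousOn (fun v => (σ₂ v).1.2) (W₁ ∩ W₂) :=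
          (by fun_prop : Continuous fun y : pieceDomain q => y.1.2).comp_continuousOn
            (hσ₂.mono inter_subset_right)
        refine ContinuousOn.prodMk (Continuous.continuousOn ?_)
          ((continuousOn_const.mul h1).add (continuousOn_const.mul h2))
        exact (by fun_prop : Continuous fun v : fiberModel p q r => v.1.1 ^ p).div (by fun_prop)
          fun v => pow_ne_zero _ (Circle.coe_ne_zero _))
      (fun v hv => by
        obtain ⟨w', h1, -⟩ := key v hv
        have := w'.2
        rw [h1] at this
        exact this)
    refine ⟨W₁ ∩ W₂, hW₁.inter hW₂, ⟨hw₁, hw₂⟩, σ, hσ, fun v hv => ?_⟩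
    obtain ⟨w', h1, h2⟩ := key v hv
    have : σ v = w' := Subtype.ext ((hσ' v hv).trans h1.symm)
    rw [this]
    exact h2

/-- The two neighborhoods of the singular fibers `x = 0` and `y = 0` cover the model. -/
noncomputable def fiberAmalgam (hp : p ≠ 0) (hq : q ≠ 0) (hpq : Nat.Coprime p q)
    (hpr : Nat.Coprime p r) (hqr : Nat.Coprime q r) :
    CyclicAmalgam (fiberModel p q r) overlapDomain (pieceDomain p) (pieceDomain q) p q where
  c := overlapCover hp hq hpq hpr hqr
  c₁ := pieceCover hp hq hqr
  c₂ := (pieceCover hq hp hpr).congr (fiberModelSwap p q r)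
  i₁ := overlapInclusion hp
  i₂ := (overlapInclusion hq).comp overlapSwap
  proj_i₁ w := rfl
  proj_i₂ w := pieceProj_overlapSwap hp hq w
  shift_i₁ k w := overlapInclusion_shift hp hq hqr k w
  shift_i₂ k w := overlapInclusion_shift hq hp hpr k (overlapSwap w)
  overlap y₁ y₂ h := by
    refine exists_overlap hp hq hpq hpr hqr y₁ ?_
    change pieceProj hp hq y₁ = fiberModelSwap p q r (pieceProj hq hp y₂) at h
    rw [h]
    change (pieceProj (r := r) hq hp y₂).1.2.1 ^ p /
      ((pieceProj (r := r) hq hp y₂).1.2.2 : ℂ) ^ r ∈ _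
    rw [pieceProj_slit]
    exact y₂.2
  cover v := by
    have hz : (v.1.2.2 : ℂ) ^ r ≠ 0 := pow_ne_zero _ (Circle.coe_ne_zero _)
    have hv : v.1.1 ^ p + v.1.2.1 ^ q = (v.1.2.2 : ℂ) ^ r := v.2
    by_cases h : v.1.2.1 ^ q / (v.1.2.2 : ℂ) ^ r ∈ Complex.slitPlane
    · exact Or.inl (exists_pieceProj_eq hp hq hqr v h)
    · right
      have h' : v.1.1 ^ p / (v.1.2.2 : ℂ) ^ r ∈ Complex.slitPlane := by
        have e : v.1.1 ^ p / (v.1.2.2 : ℂ) ^ r = 1 - v.1.2.1 ^ q / (v.1.2.2 : ℂ) ^ r := by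
          field_simp
          linear_combination hv
        -- Outside the slit plane `y ^ q / z ^ r` has nonpositive real part, so its complement to
        -- `1` has positive real part.
        rw [e]
        rw [Complex.mem_slitPlane_iff] at h ⊢
        push Not at h
        left
        rw [Complex.sub_re, Complex.one_re]
        linarith [h.1]
      obtain ⟨y, hy⟩ := exists_pieceProj_eq hq hp hpr ((fiberModelSwap p q r).symm v) h'
      exact ⟨y, (congrArg (fiberModelSwap p q r) hy).trans
        ((fiberModelSwap p q r).apply_symm_apply v)⟩
  base := ⟨(1 / 2, 0), by
    constructor
    · exact Complex.mem_slitPlane_iff.2 (Or.inl (by norm_num))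
    · exact Complex.mem_slitPlane_iff.2 (Or.inl (by norm_num))⟩
  height_base₁ := mul_zero _
  height_base₂ := mul_zero _

end overlap

instance pathConnectedSpace_fiberModel {p q r : ℕ} [hp : NeZero p] [hq : NeZero q]
    [hpq : Fact (Nat.Coprime p q)] [hpr : Fact (Nat.Coprime p r)] [hqr : Fact (Nat.Coprime q r)] :
    PathConnectedSpace (fiberModel p q r) := by
  let D := fiberAmalgam hp.1 hq.1 hpq.1 hpr.1 hqr.1
  have key : ∀ x, Joined D.basePt x := by
    intro x
    rcases D.cover x with ⟨y, hy⟩ | ⟨y, hy⟩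
    · have := (PathConnectedSpace.joined (D.i₁ D.base) y).map D.c₁.proj.continuous
      rwa [hy, D.proj_i₁] at this
    · have := (PathConnectedSpace.joined (D.i₂ D.base) y).map D.c₂.proj.continuous
      rwa [hy, D.proj_i₂] at this
  exact ⟨⟨D.basePt⟩, fun x y => (key x).symm.trans (key y)⟩

/-! ### From the affine model to the Brieskorn sphere -/

/-- A homeomorphism induces an isomorphism of fundamental groups. -/
noncomputable def Homeomorph.fundamentalGroupMulEquiv {X Y : Type*} [TopologicalSpace X]
    [TopologicalSpace Y] (e : X ≃ₜ Y) (x : X) :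
    FundamentalGroup X x ≃* FundamentalGroup Y (e x) :=
  MulEquiv.ofBijective (FundamentalGroup.map (e : C(X, Y)) x) (by
    refine Function.bijective_iff_has_inverse.2
      ⟨FundamentalGroup.mapOfEq (e.symm : C(Y, X)) (e.symm_apply_apply x), fun a => ?_, fun a => ?_⟩
    · rw [FundamentalGroup.mapOfEq_apply]
      induction a using Path.Homotopic.Quotient.ind
      next γ =>
        refine congrArg Path.Homotopic.Quotient.mk (Path.ext (funext fun t => ?_))
        exact e.symm_apply_apply (γ t)
    · rw [FundamentalGroup.mapOfEq_apply]
      induction a using Path.Homotopic.Quotient.ind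
      next γ =>
        refine congrArg Path.Homotopic.Quotient.mk (Path.ext (funext fun t => ?_))
        exact e.apply_symm_apply (γ t))

/-- Comparing `a` with the solution `ρ t` amounts to comparing `f t a` with `c`, an open condition
on `t` for each fixed `a`. No joint continuity of `f` is needed. -/
theorem continuous_of_strictMono_solution {T : Type*} [TopologicalSpace T] {f : T → ℝ → ℝ}
    {ρ : T → ℝ} {c : ℝ} (hρ : ∀ t, 0 < ρ t) (hf : ∀ t, StrictMonoOn (f t) (Ioi 0))
    (hc : ∀ a, Continuous fun t => f t a) (h : ∀ t, f t (ρ t) = c) : Continuous ρ := by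
  rw [continuous_iff_continuousAt]
  intro t
  refine tendsto_order.2 ⟨fun a ha => ?_, fun b hb => ?_⟩
  · rcases le_or_gt a 0 with ha0 | ha0
    · exact Eventually.of_forall fun s => ha0.trans_lt (hρ s)
    · have h1 : f t a < c := (h t) ▸ hf t ha0 (hρ t) ha
      filter_upwards [(hc a).continuousAt.eventually (gt_mem_nhds h1)] with s hs
      rw [← h s] at hs
      exact ((hf s).lt_iff_lt ha0 (hρ s)).1 hs
  · have hb0 : 0 < b := (hρ t).trans hb
    have h1 : c < f t b := (h t) ▸ hf t (hρ t) hb0 hb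
    filter_upwards [(hc b).continuousAt.eventually (lt_mem_nhds h1)] with s hs
    rw [← h s] at hs
    exact ((hf s).lt_iff_lt (hρ s) hb0).1 hs

/-- The squared norm of a point moved along the weighted scaling flow. -/
noncomputable def weightedNormSq (p q r : ℕ) (v : ℂ × ℂ) (ρ : ℝ) : ℝ :=
  ‖v.1‖ ^ 2 * ρ ^ (2 * (r / p : ℝ)) + ‖v.2‖ ^ 2 * ρ ^ (2 * (r / q : ℝ)) + ρ ^ 2

section scaling
variable {p q r : ℕ}

theorem strictMonoOn_weightedNormSq (v : ℂ × ℂ) :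
    StrictMonoOn (weightedNormSq p q r v) (Ioi 0) := by
  intro a ha b hb hab
  have ha' : 0 < a := ha
  have h1 : a ^ (2 * (r / p : ℝ)) ≤ b ^ (2 * (r / p : ℝ)) :=
    Real.rpow_le_rpow ha'.le hab.le (by positivity)
  have h2 : a ^ (2 * (r / q : ℝ)) ≤ b ^ (2 * (r / q : ℝ)) :=
    Real.rpow_le_rpow ha'.le hab.le (by positivity)
  have h3 : a ^ 2 < b ^ 2 := pow_lt_pow_left₀ hab ha'.le two_ne_zero
  have h4 := mul_le_mul_of_nonneg_left h1 (sq_nonneg ‖v.1‖)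
  have h5 := mul_le_mul_of_nonneg_left h2 (sq_nonneg ‖v.2‖)
  simp only [weightedNormSq]
  linarith

theorem exists_weightedNormSq_eq (hp : p ≠ 0) (hq : q ≠ 0) (hr : r ≠ 0) (v : ℂ × ℂ) :
    ∃ ρ, 0 < ρ ∧ weightedNormSq p q r v ρ = 1 := by
  have e1 : 0 < 2 * (r / p : ℝ) := by positivity
  have e2 : 0 < 2 * (r / q : ℝ) := by positivity
  have hc : Continuous (weightedNormSq p q r v) := by
    unfold weightedNormSq
    have := Real.continuous_rpow_const e1.le
    have := Real.continuous_rpow_const e2.le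
    fun_prop
  have h0 : weightedNormSq p q r v 0 = 0 := by
    simp [weightedNormSq, Real.zero_rpow e1.ne', Real.zero_rpow e2.ne']
  have h1 : 1 ≤ weightedNormSq p q r v 1 := by
    simp only [weightedNormSq, Real.one_rpow]
    nlinarith [sq_nonneg ‖v.1‖, sq_nonneg ‖v.2‖]
  obtain ⟨ρ, hρ, h⟩ := intermediate_value_Icc zero_le_one hc.continuousOn
    (show (1 : ℝ) ∈ Icc _ _ from ⟨by rw [h0]; exact zero_le_one, h1⟩)
  refine ⟨ρ, lt_of_le_of_ne hρ.1 ?_, h⟩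
  rintro rfl
  rw [h0] at h
  exact zero_ne_one h

/-- The scaling parameter that moves a point of the model to the unit sphere. -/
noncomputable def sphereScale (hp : p ≠ 0) (hq : q ≠ 0) (hr : r ≠ 0) (v : ℂ × ℂ) : ℝ :=
  (exists_weightedNormSq_eq hp hq hr v).choose

theorem sphereScale_pos (hp : p ≠ 0) (hq : q ≠ 0) (hr : r ≠ 0) (v : ℂ × ℂ) :
    0 < sphereScale hp hq hr v := (exists_weightedNormSq_eq hp hq hr v).choose_spec.1

theorem weightedNormSq_sphereScale (hp : p ≠ 0) (hq : q ≠ 0) (hr : r ≠ 0) (v : ℂ × ℂ) :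
    weightedNormSq p q r v (sphereScale hp hq hr v) = 1 :=
  (exists_weightedNormSq_eq hp hq hr v).choose_spec.2

theorem sphereScale_eq (hp : p ≠ 0) (hq : q ≠ 0) (hr : r ≠ 0) {v : ℂ × ℂ} {ρ : ℝ} (h0 : 0 < ρ)
    (h : weightedNormSq p q r v ρ = 1) : sphereScale hp hq hr v = ρ :=
  (strictMonoOn_weightedNormSq v).injOn (sphereScale_pos hp hq hr v) h0
    ((weightedNormSq_sphereScale hp hq hr v).trans h.symm)

theorem continuous_sphereScale (hp : p ≠ 0) (hq : q ≠ 0) (hr : r ≠ 0) :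
    Continuous (sphereScale hp hq hr) :=
  continuous_of_strictMono_solution (sphereScale_pos hp hq hr) strictMonoOn_weightedNormSq
    (fun a => by unfold weightedNormSq; fun_prop) (weightedNormSq_sphereScale hp hq hr)

theorem rpow_div_pow (hp : p ≠ 0) {ρ : ℝ} (h : 0 < ρ) : (ρ ^ (r / p : ℝ)) ^ p = ρ ^ r := by
  rw [← Real.rpow_mul_natCast h.le, div_mul_cancel₀ _ (by exact_mod_cast hp), Real.rpow_natCast]

theorem sq_norm_mul_rpow (x : ℂ) {ρ a : ℝ} (h : 0 < ρ) :
    ‖-x * ((ρ ^ a : ℝ) : ℂ)‖ ^ 2 = ‖x‖ ^ 2 * ρ ^ (2 * a) := by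
  rw [norm_mul, norm_neg, Complex.norm_of_nonneg (Real.rpow_nonneg h.le _), mul_pow,
    ← Real.rpow_natCast (ρ ^ a), ← Real.rpow_mul h.le, mul_comm a]
  norm_num

theorem fiberComplement_ne_zero {v : Fin 3 → ℂ} (hv : v ∈ fiberComplement p q r) : v 2 ≠ 0 :=
  fun h => hv.2 ⟨hv.1, h⟩

theorem norm_pos_of_fiberComplement (v : fiberComplement p q r) : 0 < ‖v.1 2‖ :=
  norm_pos_iff.2 (fiberComplement_ne_zero v.2)

/-- The complement of the singular fiber is homeomorphic to the model. -/
noncomputable def fiberComplementHomeomorph (hp : Odd p) (hq : Odd q) (hr : r ≠ 0) :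
    fiberComplement p q r ≃ₜ fiberModel p q r where
  -- Weighted scaling multiplies all three monomials by the same factor and normalizes `|z|` to `1`.
  -- Since `p` and `q` are odd, negating `x` and `y` moves their monomials to the other side of the
  -- equation.
  toFun v := ⟨(-v.1 0 * (((‖v.1 2‖ ^ (r / p : ℝ) : ℝ) : ℂ))⁻¹,
      -v.1 1 * (((‖v.1 2‖ ^ (r / q : ℝ) : ℝ) : ℂ))⁻¹,
      ⟨v.1 2 / ‖v.1 2‖, by
        have := norm_pos_of_fiberComplement v
        simp [Submonoid.unitSphere, this.ne']⟩), by
    have h := norm_pos_of_fiberComplement v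
    have e1 := rpow_div_pow (r := r) hp.pos.ne' h
    have e2 := rpow_div_pow (r := r) hq.pos.ne' h
    have h3 := v.2.1.1
    have h4 : ((‖v.1 2‖ : ℝ) : ℂ) ≠ 0 := by exact_mod_cast h.ne'
    change (_ : ℂ) ^ p + (_ : ℂ) ^ q = (v.1 2 / ‖v.1 2‖) ^ r
    rw [mul_pow, mul_pow, inv_pow, inv_pow, hp.neg_pow, hq.neg_pow, ← Complex.ofReal_pow, e1,
      ← Complex.ofReal_pow, e2, div_pow, Complex.ofReal_pow]
    field_simp
    linear_combination -h3⟩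
  invFun w := ⟨![-w.1.1 * ((sphereScale hp.pos.ne' hq.pos.ne' hr (w.1.1, w.1.2.1) ^ (r / p : ℝ) : ℝ) : ℂ),
      -w.1.2.1 * ((sphereScale hp.pos.ne' hq.pos.ne' hr (w.1.1, w.1.2.1) ^ (r / q : ℝ) : ℝ) : ℂ),
      w.1.2.2 * (sphereScale hp.pos.ne' hq.pos.ne' hr (w.1.1, w.1.2.1) : ℂ)], by
    have h := sphereScale_pos hp.pos.ne' hq.pos.ne' hr (w.1.1, w.1.2.1)
    have h' := weightedNormSq_sphereScale hp.pos.ne' hq.pos.ne' hr (w.1.1, w.1.2.1)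
    set ρ := sphereScale hp.pos.ne' hq.pos.ne' hr (w.1.1, w.1.2.1)
    have e1 := rpow_div_pow (r := r) hp.pos.ne' h
    have e2 := rpow_div_pow (r := r) hq.pos.ne' h
    have h3 : w.1.1 ^ p + w.1.2.1 ^ q = (w.1.2.2 : ℂ) ^ r := w.2
    refine ⟨⟨?_, ?_⟩, fun hs => ?_⟩
    · simp only [Matrix.cons_val_zero, Matrix.cons_val_one, Matrix.cons_val]
      rw [mul_pow, mul_pow, hp.neg_pow, hq.neg_pow, ← Complex.ofReal_pow, e1,
        ← Complex.ofReal_pow, e2, mul_pow, Complex.ofReal_pow]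
      linear_combination -(ρ : ℂ) ^ r * h3
    · rw [Fin.sum_univ_three]
      simp only [Matrix.cons_val_zero, Matrix.cons_val_one, Matrix.cons_val]
      rw [sq_norm_mul_rpow _ h, sq_norm_mul_rpow _ h, norm_mul, Circle.norm_coe, one_mul,
        Complex.norm_of_nonneg h.le]
      exact h'
    · have := hs.2
      simp [h.ne'] at this⟩
  left_inv v := by
    have h := norm_pos_of_fiberComplement v
    have e : sphereScale hp.pos.ne' hq.pos.ne' hr
        (-v.1 0 * (((‖v.1 2‖ ^ (r / p : ℝ) : ℝ) : ℂ))⁻¹,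
          -v.1 1 * (((‖v.1 2‖ ^ (r / q : ℝ) : ℝ) : ℂ))⁻¹) = ‖v.1 2‖ := by
      refine sphereScale_eq _ _ _ h ?_
      have h3 := v.2.1.2
      rw [Fin.sum_univ_three] at h3
      simp only [weightedNormSq]
      rw [← sq_norm_mul_rpow _ h, ← sq_norm_mul_rpow _ h, ← h3, ← neg_mul, neg_neg, ← neg_mul, neg_neg,
        inv_mul_cancel_right₀ (by exact_mod_cast (Real.rpow_pos_of_pos h _).ne'),
        inv_mul_cancel_right₀ (by exact_mod_cast (Real.rpow_pos_of_pos h _).ne')]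
    refine Subtype.ext (funext fun i => ?_)
    have h4 : ((‖v.1 2‖ : ℝ) : ℂ) ≠ 0 := by exact_mod_cast h.ne'
    fin_cases i
    · simp only [e]
      simp [(Real.rpow_pos_of_pos h _).ne']
    · simp only [e]
      simp [(Real.rpow_pos_of_pos h _).ne']
    · simp only [e]
      simp [h4]
  right_inv w := by
    have h := sphereScale_pos hp.pos.ne' hq.pos.ne' hr (w.1.1, w.1.2.1)
    set ρ := sphereScale hp.pos.ne' hq.pos.ne' hr (w.1.1, w.1.2.1)
    have e : ‖(w.1.2.2 : ℂ) * (ρ : ℂ)‖ = ρ := by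
      rw [norm_mul, Circle.norm_coe, one_mul, Complex.norm_of_nonneg h.le]
    have h4 : (ρ : ℂ) ≠ 0 := by exact_mod_cast h.ne'
    refine Subtype.ext (Prod.ext ?_ (Prod.ext ?_ (Circle.ext ?_)))
    · change -(-w.1.1 * ((ρ ^ (r / p : ℝ) : ℝ) : ℂ)) *
        ((‖(w.1.2.2 : ℂ) * (ρ : ℂ)‖ ^ (r / p : ℝ) : ℝ) : ℂ)⁻¹ = w.1.1
      rw [e, ← neg_mul, neg_neg,
        mul_inv_cancel_right₀ (by exact_mod_cast (Real.rpow_pos_of_pos h _).ne')]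
    · change -(-w.1.2.1 * ((ρ ^ (r / q : ℝ) : ℝ) : ℂ)) *
        ((‖(w.1.2.2 : ℂ) * (ρ : ℂ)‖ ^ (r / q : ℝ) : ℝ) : ℂ)⁻¹ = w.1.2.1
      rw [e, ← neg_mul, neg_neg,
        mul_inv_cancel_right₀ (by exact_mod_cast (Real.rpow_pos_of_pos h _).ne')]
    · change (w.1.2.2 : ℂ) * (ρ : ℂ) / (‖(w.1.2.2 : ℂ) * (ρ : ℂ)‖ : ℂ) = w.1.2.2
      rw [e, mul_div_cancel_right₀ _ h4]
  continuous_toFun := by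
    have h (i : Fin 3) : Continuous fun v : fiberComplement p q r => v.1 i :=
      (continuous_apply i).comp continuous_subtype_val
    refine Continuous.subtype_mk (Continuous.prodMk ?_ (Continuous.prodMk ?_
      (Continuous.subtype_mk ?_ _))) _
    · refine (h 0).neg.mul (Continuous.inv₀ (Complex.continuous_ofReal.comp ?_) fun v => ?_)
      · exact (h 2).norm.rpow_const fun v => Or.inl (norm_pos_of_fiberComplement v).ne'
      · exact_mod_cast (Real.rpow_pos_of_pos (norm_pos_of_fiberComplement v) _).ne'
    · refine (h 1).neg.mul (Continuous.inv₀ (Complex.continuous_ofReal.comp ?_) fun v => ?_)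
      · exact (h 2).norm.rpow_const fun v => Or.inl (norm_pos_of_fiberComplement v).ne'
      · exact_mod_cast (Real.rpow_pos_of_pos (norm_pos_of_fiberComplement v) _).ne'
    · exact (h 2).div (Complex.continuous_ofReal.comp (h 2).norm) fun v => by
        exact_mod_cast (norm_pos_of_fiberComplement v).ne'
  continuous_invFun := by
    have hc : Continuous fun w : fiberModel p q r =>
        sphereScale hp.pos.ne' hq.pos.ne' hr (w.1.1, w.1.2.1) :=
      (continuous_sphereScale hp.pos.ne' hq.pos.ne' hr).comp (by fun_prop)
    refine Continuous.subtype_mk (continuous_pi fun i => ?_) _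
    fin_cases i
    · exact Continuous.mul (by fun_prop) (Complex.continuous_ofReal.comp
        (hc.rpow_const fun w => Or.inr (by positivity)))
    · exact Continuous.mul (by fun_prop) (Complex.continuous_ofReal.comp
        (hc.rpow_const fun w => Or.inr (by positivity)))
    · exact Continuous.mul (by fun_prop) (Complex.continuous_ofReal.comp hc)

/-- The complement of the singular `r`-fiber has the group of a `(p,q)` torus knot. -/
theorem exists_isTorusKnotGroup_fiberGroup (hp : Odd p) (hq : Odd q) (hr : r ≠ 0)
    (hpq : Nat.Coprime p q) (hpr : Nat.Coprime p r) (hqr : Nat.Coprime q r)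
    (z₀ : fiberComplement p q r) : ∃ u v : fiberGroup p q r z₀, IsTorusKnotGroup p q u v := by
  have : NeZero p := ⟨hp.pos.ne'⟩
  have : NeZero q := ⟨hq.pos.ne'⟩
  have := Fact.mk hpq
  have := Fact.mk hpr
  have := Fact.mk hqr
  obtain ⟨u, v, h⟩ := (fiberAmalgam hp.pos.ne' hq.pos.ne' hpq hpr hqr).exists_isTorusKnotGroup
  exact ⟨_, _, h.map ((FundamentalGroup.fundamentalGroupMulEquivOfPathConnected _ _).trans
    ((fiberComplementHomeomorph hp hq hr).fundamentalGroupMulEquiv z₀).symm)⟩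

end scaling

/-! ### Special unitary matrices preserving a plane -/

section matrices

theorem SU3.ext_iff_coe {A B : SU3} : A = B ↔ (A : Matrix (Fin 3) (Fin 3) ℂ) = B := Subtype.ext_iff

theorem SU3.coe_inv (A : SU3) : ((A⁻¹ : SU3) : Matrix (Fin 3) (Fin 3) ℂ) = star A.1 := rfl

instance : IsTopologicalGroup SU3 where
  continuous_mul := continuous_mul
  continuous_inv := Continuous.subtype_mk (continuous_star.comp continuous_subtype_val) _

theorem SU3.inv_apply (A : SU3) (i j : Fin 3) : (A⁻¹ : SU3).1 i j = star (A.1 j i) := rfl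

theorem SU3.mul_star (A : SU3) : A.1 * star A.1 = 1 :=
  (Matrix.mem_unitaryGroup_iff).1 (Matrix.mem_specialUnitaryGroup_iff.1 A.2).1

theorem SU3.star_mul (A : SU3) : star A.1 * A.1 = 1 :=
  (Matrix.mem_unitaryGroup_iff').1 (Matrix.mem_specialUnitaryGroup_iff.1 A.2).1

theorem SU3.det_eq (A : SU3) : A.1.det = 1 := (Matrix.mem_specialUnitaryGroup_iff.1 A.2).2

theorem SU3.sum_row (A : SU3) (i j : Fin 3) :
    A.1 i 0 * star (A.1 j 0) + A.1 i 1 * star (A.1 j 1) + A.1 i 2 * star (A.1 j 2) =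
      if i = j then 1 else 0 := by
  have := congrFun (congrFun A.mul_star i) j
  rwa [Matrix.mul_apply, Fin.sum_univ_three, Matrix.one_apply] at this

theorem SU3.sum_col (A : SU3) (i j : Fin 3) :
    star (A.1 0 i) * A.1 0 j + star (A.1 1 i) * A.1 1 j + star (A.1 2 i) * A.1 2 j =
      if i = j then 1 else 0 := by
  have := congrFun (congrFun A.star_mul i) j
  rwa [Matrix.mul_apply, Fin.sum_univ_three, Matrix.one_apply] at this

theorem Circle.mul_star_coe (a : Circle) : (a : ℂ) * star (a : ℂ) = 1 := by
  have := Complex.mul_conj (a : ℂ)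
  rw [Circle.normSq_coe] at this
  simpa using this

/-- The diagonal matrix with first two entries `a` and `b`. -/
noncomputable def diag3 : Circle × Circle →* SU3 where
  toFun x := ⟨Matrix.diagonal ![x.1, x.2, ((x.1 * x.2)⁻¹ : Circle)], by
    rw [Matrix.mem_specialUnitaryGroup_iff, Matrix.mem_unitaryGroup_iff, Matrix.star_eq_conjTranspose,
      Matrix.diagonal_conjTranspose, Matrix.diagonal_mul_diagonal, Matrix.det_diagonal]
    constructor
    · rw [← Matrix.diagonal_one]
      congr 1
      funext i
      fin_cases i <;> exact Circle.mul_star_coe _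
    · rw [Fin.prod_univ_three]
      simp only [Matrix.cons_val_zero, Matrix.cons_val_one, Matrix.cons_val]
      rw [← Circle.coe_mul, ← Circle.coe_mul, mul_inv_cancel, Circle.coe_one]⟩
  map_one' := by
    apply Subtype.ext
    change Matrix.diagonal _ = 1
    rw [← Matrix.diagonal_one]
    congr 1
    funext i
    fin_cases i <;> simp
  map_mul' x y := by
    apply Subtype.ext
    change Matrix.diagonal _ = Matrix.diagonal _ * Matrix.diagonal _
    rw [Matrix.diagonal_mul_diagonal]
    congr 1
    funext i
    fin_cases i <;> simp [mul_comm, mul_assoc, mul_left_comm]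

theorem coe_diag3 (a b : Circle) : (diag3 (a, b)).1 =
    !![(a : ℂ), 0, 0; 0, b, 0; 0, 0, ((a * b)⁻¹ : Circle)] := by
  change Matrix.diagonal _ = _
  ext i j
  fin_cases i <;> fin_cases j <;> simp

/-- The special unitary matrix with a block in `SU(2)`. -/
noncomputable def blockSU2 (x y : ℂ) (h : x * star x + y * star y = 1) : SU3 :=
  ⟨!![x, -star y, 0; y, star x, 0; 0, 0, 1], by
    rw [Matrix.mem_specialUnitaryGroup_iff, Matrix.mem_unitaryGroup_iff, Matrix.star_eq_conjTranspose]
    constructor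
    · ext i j
      have h' : y * star y + star x * x = 1 := by rw [← h]; ring
      fin_cases i <;> fin_cases j <;>
        simp [Matrix.mul_apply, Fin.sum_univ_three] <;> simp_all <;> ring_nf
      rw [← h]
      simp
      ring
    · rw [Matrix.det_fin_three]
      simp
      simp at h
      rw [← h]
      ring⟩

theorem coe_blockSU2 (x y : ℂ) (h : x * star x + y * star y = 1) :
    (blockSU2 x y h).1 = !![x, -star y, 0; y, star x, 0; 0, 0, 1] := rfl

/-- The special unitary matrices preserving the line spanned by the third basis vector. -/
def planeSubgroup : Subgroup SU3 where
  carrier := {M | M.1 0 2 = 0 ∧ M.1 1 2 = 0 ∧ M.1 2 0 = 0 ∧ M.1 2 1 = 0}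
  one_mem' := by simp
  mul_mem' := by
    rintro A B ⟨a1, a2, a3, a4⟩ ⟨b1, b2, b3, b4⟩
    simp [Matrix.mul_apply, Fin.sum_univ_three, a1, a2, a3, a4, b1, b2, b3, b4]
  inv_mem' := by
    rintro A ⟨a1, a2, a3, a4⟩
    change star _ = _ ∧ star _ = _ ∧ star _ = _ ∧ star _ = _
    simp [a1, a2, a3, a4]

theorem diag3_mem_planeSubgroup (x : Circle × Circle) : diag3 x ∈ planeSubgroup := by
  change (diag3 (x.1, x.2)).1 0 2 = 0 ∧ (diag3 (x.1, x.2)).1 1 2 = 0 ∧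
    (diag3 (x.1, x.2)).1 2 0 = 0 ∧ (diag3 (x.1, x.2)).1 2 1 = 0
  rw [coe_diag3]
  simp

theorem blockSU2_mem_planeSubgroup {x y : ℂ} (h : x * star x + y * star y = 1) :
    blockSU2 x y h ∈ planeSubgroup := by
  change (blockSU2 x y h).1 0 2 = 0 ∧ (blockSU2 x y h).1 1 2 = 0 ∧
    (blockSU2 x y h).1 2 0 = 0 ∧ (blockSU2 x y h).1 2 1 = 0
  rw [coe_blockSU2]
  simp

/-- The rotation of the plane with squared cosine `s`. -/
noncomputable def planeRotation (s : unitInterval) : SU3 :=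
  blockSU2 (√(s : ℝ) : ℝ) (√(1 - s : ℝ) : ℝ) (by
    simp only [Complex.star_def, Complex.conj_ofReal, ← Complex.ofReal_mul]
    rw [Real.mul_self_sqrt s.2.1, Real.mul_self_sqrt (sub_nonneg.2 s.2.2)]
    simp)

/-- With the squared cosine as parameter, the diagonal entries are affine in `s`, so that traces
determine `s`; square roots appear only off the diagonal. -/
theorem coe_planeRotation_mul (s : unitInterval) (a b : Circle) :
    (planeRotation s * diag3 (a, b) * (planeRotation s)⁻¹).1 =
      !![(s : ℝ) * (a : ℂ) + (1 - (s : ℝ)) * b, (√(s : ℝ) : ℝ) * (√(1 - s : ℝ) : ℝ) * ((a : ℂ) - b), 0;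
        (√(s : ℝ) : ℝ) * (√(1 - s : ℝ) : ℝ) * ((a : ℂ) - b), (1 - (s : ℝ)) * a + (s : ℝ) * (b : ℂ), 0;
        0, 0, ((a * b)⁻¹ : Circle)] := by
  have h1 : ((√(s : ℝ) : ℝ) : ℂ) * (√(s : ℝ) : ℝ) = (s : ℝ) := by
    rw [← Complex.ofReal_mul, Real.mul_self_sqrt s.2.1]
  have h2 : ((√(1 - s : ℝ) : ℝ) : ℂ) * (√(1 - s : ℝ) : ℝ) = 1 - (s : ℝ) := by
    rw [← Complex.ofReal_mul, Real.mul_self_sqrt (sub_nonneg.2 s.2.2)]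
    push_cast
    rfl
  rw [← h2, ← h1]
  change (planeRotation s).1 * (diag3 (a, b)).1 * star (planeRotation s).1 = _
  rw [coe_diag3, planeRotation, coe_blockSU2, Matrix.star_eq_conjTranspose]
  ext i j
  fin_cases i <;> fin_cases j <;>
    simp [Matrix.mul_apply, Fin.sum_univ_three] <;> ring

theorem planeRotation_commute (s : unitInterval) (a : Circle) :
    planeRotation s * diag3 (a, a) * (planeRotation s)⁻¹ = diag3 (a, a) := by
  rw [SU3.ext_iff_coe, coe_planeRotation_mul, coe_diag3]
  ext i j
  fin_cases i <;> fin_cases j <;> simp <;> ring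

end matrices

/-! ### Representations determined by two generators -/

section generators
variable {G : Type} [Group G] {p q : ℕ} {u v : G}

namespace IsTorusKnotGroup

theorem hom_ext (h : IsTorusKnotGroup p q u v) {ρ σ : SU3Hom G} (hu : ρ u = σ u) (hv : ρ v = σ v) :
    ρ = σ := by
  refine MonoidHom.eq_of_eqOn_dense h.closure_eq ?_
  rintro g (rfl | rfl)
  · exact hu
  · exact hv

theorem forall_mem (h : IsTorusKnotGroup p q u v) {H : Type*} [Group H] {ρ : G →* H} {K : Subgroup H}
    (hu : ρ u ∈ K) (hv : ρ v ∈ K) (g : G) : ρ g ∈ K := by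
  have : Subgroup.closure {u, v} ≤ K.comap ρ := by
    rw [Subgroup.closure_le]
    rintro g (rfl | rfl)
    · exact hu
    · exact hv
  rw [h.closure_eq] at this
  exact this (Subgroup.mem_top g)

theorem isAbelian_iff (h : IsTorusKnotGroup p q u v) {ρ : SU3Hom G} :
    ρ.IsAbelian ↔ ρ u * ρ v = ρ v * ρ u := by
  refine ⟨fun h => h u v, fun huv => ?_⟩
  have h1 : ∀ g, ρ g ∈ Subgroup.centralizer {ρ u} :=
    h.forall_mem (Subgroup.mem_centralizer_iff.2 (by simp))
      (Subgroup.mem_centralizer_iff.2 (by simpa using huv))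
  have h2 : ∀ g, ρ g ∈ Subgroup.centralizer {ρ v} :=
    h.forall_mem (Subgroup.mem_centralizer_iff.2 (by simpa using huv.symm))
      (Subgroup.mem_centralizer_iff.2 (by simp))
  intro g k
  have h3 : ∀ k, ρ k ∈ Subgroup.centralizer {ρ g} :=
    h.forall_mem (Subgroup.mem_centralizer_iff.2
        (by simpa using (Subgroup.mem_centralizer_iff.1 (h1 g) _ rfl).symm))
      (Subgroup.mem_centralizer_iff.2
        (by simpa using (Subgroup.mem_centralizer_iff.1 (h2 g) _ rfl).symm))
  exact Subgroup.mem_centralizer_iff.1 (h3 k) _ rfl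

theorem continuous_rep (h : IsTorusKnotGroup p q u v) {T : Type*} [TopologicalSpace T]
    {ρ : T → SU3Hom G} (hu : Continuous fun t => ρ t u) (hv : Continuous fun t => ρ t v) :
    Continuous ρ := by
  refine continuous_induced_rng.2 (continuous_pi fun g => ?_)
  have hg : g ∈ Subgroup.closure {u, v} := h.closure_eq ▸ Subgroup.mem_top g
  change Continuous fun t => ρ t g
  induction hg using Subgroup.closure_induction with
  | mem x hx =>
    rcases hx with rfl | rfl
    · exact hu
    · exact hv
  | one => simpa using continuous_const
  | mul x y _ _ hx hy => simp only [map_mul]; exact hx.mul hy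
  | inv x _ hx => simp only [map_inv]; exact hx.inv

theorem contDiffAt_rep (h : IsTorusKnotGroup p q u v) {E : Type*} [NormedAddCommGroup E]
    [NormedSpace ℝ E] {ρ : E → SU3Hom G} {x : E} {n : WithTop ℕ∞}
    (hu : ∀ i j, ContDiffAt ℝ n (fun t => (ρ t u).1 i j) x)
    (hv : ∀ i j, ContDiffAt ℝ n (fun t => (ρ t v).1 i j) x) (g : G) (i j : Fin 3) :
    ContDiffAt ℝ n (fun t => (ρ t g).1 i j) x := by
  have hg : g ∈ Subgroup.closure {u, v} := h.closure_eq ▸ Subgroup.mem_top g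
  induction hg using Subgroup.closure_induction generalizing i j with
  | mem x hx =>
    rcases hx with rfl | rfl
    · exact hu i j
    · exact hv i j
  | one => simpa using contDiffAt_const
  | mul x y _ _ hx hy =>
    simp only [map_mul, Submonoid.coe_mul, Matrix.mul_apply]
    exact ContDiffAt.sum fun k _ => (hx i k).mul (hy k j)
  | inv x _ hx =>
    simp only [map_inv, SU3.inv_apply]
    exact Complex.conjCLE.contDiff.contDiffAt.comp _ (hx j i)

end IsTorusKnotGroup

theorem repClass_eq_iff {ρ σ : SU3Hom G} :
    repClass ρ = repClass σ ↔ ∃ a : SU3, ∀ g, σ g = a * ρ g * a⁻¹ := Quotient.eq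

/-- The conjugate of a representation. -/
def SU3Hom.conj (a : SU3) (ρ : SU3Hom G) : SU3Hom G := (MulAut.conj a).toMonoidHom.comp ρ

theorem SU3Hom.conj_apply (a : SU3) (ρ : SU3Hom G) (g : G) : ρ.conj a g = a * ρ g * a⁻¹ := rfl

theorem repClass_conj (a : SU3) (ρ : SU3Hom G) : repClass (ρ.conj a) = repClass ρ :=
  (repClass_eq_iff.2 ⟨a, fun _ => rfl⟩).symm

theorem isAbelian_congr {ρ σ : SU3Hom G} (h : repClass ρ = repClass σ) (hρ : ρ.IsAbelian) :
    σ.IsAbelian := by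
  obtain ⟨a, ha⟩ := repClass_eq_iff.1 h
  intro g k
  rw [ha, ha, ← MulAut.conj_apply, ← MulAut.conj_apply, ← map_mul, hρ, map_mul]

theorem isReducible_of_mem_planeSubgroup {ρ : SU3Hom G} (h : ∀ g, ρ g ∈ planeSubgroup) :
    ρ.IsReducible := by
  refine ⟨Submodule.span ℂ {Pi.single 2 1}, ?_, ?_, fun g w hw => ?_⟩
  · rw [Ne, Submodule.span_singleton_eq_bot]
    intro h
    simpa using congrFun h 2
  · intro h
    have : (Pi.single 0 1 : Fin 3 → ℂ) ∈ Submodule.span ℂ {(Pi.single 2 1 : Fin 3 → ℂ)} := by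
      rw [h]; trivial
    obtain ⟨c, hc⟩ := Submodule.mem_span_singleton.1 this
    simpa using congrFun hc 0
  · obtain ⟨c, rfl⟩ := Submodule.mem_span_singleton.1 hw
    refine Submodule.mem_span_singleton.2 ⟨c * (ρ g).1 2 2, ?_⟩
    obtain ⟨h1, h2, -, -⟩ := h g
    rw [Matrix.mulVec_smul, Matrix.mulVec_single_one]
    funext i
    fin_cases i <;> simp [Matrix.col_apply, h1, h2]

end generators

/-! ### Normal forms of reducible representations -/

section reduction
variable {G : Type} [Group G] {p q : ℕ} {u v : G}

theorem mul_star_eq_normSq (z : ℂ) : z * star z = ((‖z‖ ^ 2 : ℝ) : ℂ) := by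
  rw [Complex.star_def, Complex.mul_conj, Complex.normSq_eq_norm_sq]

theorem exists_SU3_col (w : Fin 3 → ℂ) (hw : w 0 * star (w 0) + w 1 * star (w 1) + w 2 * star (w 2) = 1) :
    ∃ P : SU3, ∀ i, P.1 i 2 = w i := by
  have hn : ‖(WithLp.toLp 2 w : EuclideanSpace ℂ (Fin 3))‖ = 1 := by
    rw [EuclideanSpace.norm_eq, Real.sqrt_eq_one, Fin.sum_univ_three]
    rw [mul_star_eq_normSq, mul_star_eq_normSq, mul_star_eq_normSq] at hw
    exact_mod_cast hw
  have ho : Orthonormal ℂ (({2} : Set (Fin 3)).domRestrict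
      fun _ => (WithLp.toLp 2 w : EuclideanSpace ℂ (Fin 3))) :=
    ⟨fun _ => hn, fun i j hij => absurd (Subsingleton.elim i j) hij⟩
  obtain ⟨b, hb⟩ := ho.exists_orthonormalBasis_extension_of_card_eq (by simp)
  have hU : (Matrix.of fun i j => b j i) ∈ Matrix.unitaryGroup (Fin 3) ℂ := by
    have := (EuclideanSpace.basisFun (Fin 3) ℂ).toMatrix_orthonormalBasis_mem_unitary b
    convert this using 1
    ext i j
    simp [Module.Basis.toMatrix_apply]
  set U : Matrix (Fin 3) (Fin 3) ℂ := Matrix.of fun i j => b j i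
  have hd : U.det * star U.det = 1 := (Unitary.mem_iff.1 (Matrix.det_of_mem_unitary hU)).2
  -- Scaling the first column corrects the determinant without touching the prescribed third column.
  refine ⟨⟨U * Matrix.diagonal ![star U.det, 1, 1], ?_⟩, fun i => ?_⟩
  · rw [Matrix.mem_specialUnitaryGroup_iff]
    constructor
    · refine mul_mem hU ?_
      rw [Matrix.mem_unitaryGroup_iff, Matrix.star_eq_conjTranspose,
        Matrix.diagonal_conjTranspose, Matrix.diagonal_mul_diagonal, ← Matrix.diagonal_one]
      congr 1
      funext i
      fin_cases i
      · simpa [mul_comm] using hd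
      · simp
      · simp
    · rw [Matrix.det_mul, Matrix.det_diagonal, Fin.prod_univ_three]
      simpa using hd
  · have := hb 2 rfl
    simp [U, Matrix.mul_apply, Matrix.diagonal, this]

/-- The last column has norm one, so its only nonzero entry has modulus one; this entry exhausts the
norm of the last row. -/
theorem SU3.mem_planeSubgroup_of_col {M : SU3} (h0 : M.1 0 2 = 0) (h1 : M.1 1 2 = 0) :
    M ∈ planeSubgroup := by
  have hc := M.sum_col 2 2
  have hr := M.sum_row 2 2
  simp only [h0, h1, star_zero, zero_mul, zero_add, if_true] at hc hr
  rw [mul_comm] at hc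
  rw [hc] at hr
  rw [mul_star_eq_normSq, mul_star_eq_normSq] at hr
  have hr' : ‖M.1 2 0‖ ^ 2 + ‖M.1 2 1‖ ^ 2 = 0 := by
    have : ((‖M.1 2 0‖ ^ 2 + ‖M.1 2 1‖ ^ 2 : ℝ) : ℂ) = 0 := by push_cast at hr ⊢; linear_combination hr
    exact_mod_cast this
  have a : ‖M.1 2 0‖ ^ 2 = 0 := by nlinarith [sq_nonneg ‖M.1 2 0‖, sq_nonneg ‖M.1 2 1‖]
  have b : ‖M.1 2 1‖ ^ 2 = 0 := by nlinarith [sq_nonneg ‖M.1 2 0‖, sq_nonneg ‖M.1 2 1‖]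
  exact ⟨h0, h1, by simpa using a, by simpa using b⟩

/-- A reducible representation has a common eigenvector. -/
theorem SU3Hom.IsReducible.exists_eigenvector {ρ : SU3Hom G} (h : ρ.IsReducible) :
    ∃ w : Fin 3 → ℂ, w ≠ 0 ∧ ∀ g, ∃ c : ℂ, (ρ g).1.mulVec w = c • w := by
  obtain ⟨W, hb, ht, hW⟩ := h
  have key : ∀ V : Submodule ℂ (Fin 3 → ℂ), Module.finrank ℂ V = 1 →
      (∀ g : G, ∀ v ∈ V, (ρ g).1.mulVec v ∈ V) →
      ∃ w : Fin 3 → ℂ, w ≠ 0 ∧ ∀ g, ∃ c : ℂ, (ρ g).1.mulVec w = c • w := by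
    intro V h1 hV
    obtain ⟨w, hw0, hw⟩ := finrank_eq_one_iff'.1 h1
    refine ⟨w, fun h => hw0 (Subtype.ext h), fun g => ?_⟩
    obtain ⟨c, hc⟩ := hw ⟨_, hV g w w.2⟩
    exact ⟨c, (congrArg Subtype.val hc).symm⟩
  have h3 : Module.finrank ℂ W < 3 := by
    simpa using Submodule.finrank_lt ht
  have h0 : 0 < Module.finrank ℂ W := by
    have : Nontrivial W := Submodule.nontrivial_iff_ne_bot.2 hb
    exact Module.finrank_pos
  rcases (by omega : Module.finrank ℂ W = 1 ∨ Module.finrank ℂ W = 2) with h1 | h2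
  · exact key W h1 hW
  -- For an invariant plane, the orthogonal complement is an invariant line, because the adjoint of
  -- a unitary matrix is its inverse.
  · let e := (WithLp.linearEquiv 2 ℂ (Fin 3 → ℂ)).symm
    let W' : Submodule ℂ (EuclideanSpace ℂ (Fin 3)) := W.map e.toLinearMap
    have hW' : Module.finrank ℂ W' = 2 := by rw [← h2]; exact LinearEquiv.finrank_map_eq e W
    have hO : Module.finrank ℂ W'ᗮ = 1 := by
      have := W'.finrank_add_finrank_orthogonal
      rw [hW', finrank_euclideanSpace_fin] at this
      omega
    refine key (W'ᗮ.map e.symm.toLinearMap) ?_ ?_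
    · exact (LinearEquiv.finrank_map_eq e.symm _).trans hO
    · rintro g _ ⟨x, hx, rfl⟩
      refine ⟨WithLp.toLp 2 ((ρ g).1.mulVec (WithLp.ofLp x)), ?_, rfl⟩
      rw [SetLike.mem_coe, Submodule.mem_orthogonal] at hx ⊢
      rintro _ ⟨y, hy, rfl⟩
      have h4 := hx (e ((ρ g⁻¹).1.mulVec y)) ⟨_, hW _ _ hy, rfl⟩
      rw [← h4]
      change dotProduct ((ρ g).1.mulVec (WithLp.ofLp x)) (star y) =
        dotProduct (WithLp.ofLp x) (star ((ρ g⁻¹).1.mulVec y))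
      rw [Matrix.star_mulVec, map_inv, SU3.coe_inv, Matrix.star_eq_conjTranspose,
        Matrix.conjTranspose_conjTranspose, dotProduct_comm, Matrix.dotProduct_mulVec, dotProduct_comm]

/-- A normalized common eigenvector is the third column of some `P` in `SU(3)`, and conjugation by
its inverse moves the eigenvector to the third basis vector. -/
theorem SU3Hom.IsReducible.exists_conj_mem_planeSubgroup {ρ : SU3Hom G} (h : ρ.IsReducible) :
    ∃ P : SU3, ∀ g, ρ.conj P g ∈ planeSubgroup := by
  obtain ⟨w, hw0, hw⟩ := h.exists_eigenvector
  set N : ℝ := ‖w 0‖ ^ 2 + ‖w 1‖ ^ 2 + ‖w 2‖ ^ 2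
  have hN : 0 < N := by
    obtain ⟨i, hi⟩ := Function.ne_iff.1 hw0
    have : 0 < ‖w i‖ ^ 2 := by
      have := norm_pos_iff.2 hi
      positivity
    fin_cases i <;> simp at this <;> positivity
  have hs : (√N : ℂ) ≠ 0 := by exact_mod_cast (Real.sqrt_pos.2 hN).ne'
  have hs2 : (√N : ℂ) * √N = N := by exact_mod_cast Real.mul_self_sqrt hN.le
  obtain ⟨P, hP⟩ := exists_SU3_col (fun i => w i / √N) (by
    have : ∀ z : ℂ, z / √N * star (z / √N) = ((‖z‖ ^ 2 : ℝ) : ℂ) / N := by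
      intro z
      rw [star_div₀, Complex.star_def, Complex.conj_ofReal, div_mul_div_comm, hs2,
        ← Complex.star_def, mul_star_eq_normSq]
    rw [this, this, this, ← add_div, ← add_div, ← Complex.ofReal_add, ← Complex.ofReal_add]
    exact div_self (by exact_mod_cast hN.ne'))
  refine ⟨P⁻¹, fun g => ?_⟩
  obtain ⟨c, hc⟩ := hw g
  have h1 : ∀ i, ((ρ g).1 * P.1) i 2 = c * P.1 i 2 := by
    intro i
    have := congrFun hc i
    rw [Matrix.mulVec, dotProduct, Fin.sum_univ_three] at this
    rw [Matrix.mul_apply, Fin.sum_univ_three]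
    simp only [hP]
    simp only [Pi.smul_apply, smul_eq_mul] at this
    field_simp
    exact this
  have h2 : ∀ i, (ρ.conj P⁻¹ g).1 i 2 = c * (1 : Matrix (Fin 3) (Fin 3) ℂ) i 2 := by
    intro i
    rw [SU3Hom.conj_apply, inv_inv, ← P.star_mul]
    change (star P.1 * (ρ g).1 * P.1) i 2 = _
    rw [mul_assoc, Matrix.mul_apply, Matrix.mul_apply, Finset.mul_sum]
    refine Finset.sum_congr rfl fun j _ => ?_
    rw [h1]
    ring
  refine SU3.mem_planeSubgroup_of_col ?_ ?_
  · rw [h2]; simp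
  · rw [h2]; simp

/-- Block matrices are diagonalizable by special unitary blocks. -/
theorem exists_blockSU2_diag {M : SU3} (hM : M ∈ planeSubgroup) :
    ∃ (x y : ℂ) (h : x * star x + y * star y = 1) (a b : Circle),
      M = blockSU2 x y h * diag3 (a, b) * (blockSU2 x y h)⁻¹ := by
  obtain ⟨m1, m2, m3, m4⟩ := hM
  let A : Matrix (Fin 2) (Fin 2) ℂ := !![M.1 0 0, M.1 0 1; M.1 1 0, M.1 1 1]
  obtain ⟨μ, hμ⟩ := Module.End.exists_eigenvalue (Matrix.toLin' A)
  obtain ⟨w, hw⟩ := hμ.exists_hasEigenvector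
  have h1 := congrFun hw.apply_eq_smul 0
  have h2 := congrFun hw.apply_eq_smul 1
  simp [Matrix.toLin'_apply, Matrix.mulVec, dotProduct, Fin.sum_univ_two, A] at h1 h2
  set N : ℝ := ‖w 0‖ ^ 2 + ‖w 1‖ ^ 2
  have hN : 0 < N := by
    obtain ⟨i, hi⟩ := Function.ne_iff.1 hw.2
    have : 0 < ‖w i‖ ^ 2 := by
      have := norm_pos_iff.2 hi
      positivity
    fin_cases i <;> simp at this <;> positivity
  have hs : (√N : ℂ) ≠ 0 := by exact_mod_cast (Real.sqrt_pos.2 hN).ne'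
  have hs2 : (√N : ℂ) * √N = N := by exact_mod_cast Real.mul_self_sqrt hN.le
  have hxy : w 0 / √N * star (w 0 / √N) + w 1 / √N * star (w 1 / √N) = 1 := by
    have : ∀ z : ℂ, z / √N * star (z / √N) = ((‖z‖ ^ 2 : ℝ) : ℂ) / N := by
      intro z
      rw [star_div₀, Complex.star_def, Complex.conj_ofReal, div_mul_div_comm, hs2,
        ← Complex.star_def, mul_star_eq_normSq]
    rw [this, this, ← add_div, ← Complex.ofReal_add]
    exact div_self (by exact_mod_cast hN.ne')
  set x := w 0 / √N
  set y := w 1 / √N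
  have e1 : M.1 0 0 * x + M.1 0 1 * y = μ * x := by
    simp only [x, y]; field_simp; linear_combination h1
  have e2 : M.1 1 0 * x + M.1 1 1 * y = μ * y := by
    simp only [x, y]; field_simp; linear_combination h2
  set Q := blockSU2 x y hxy with hQ
  set D : SU3 := Q⁻¹ * M * Q with hD
  have hDp : D ∈ planeSubgroup :=
    mul_mem (mul_mem (inv_mem (blockSU2_mem_planeSubgroup hxy)) ⟨m1, m2, m3, m4⟩)
      (blockSU2_mem_planeSubgroup hxy)
  have d10 : D.1 1 0 = 0 := by
    change (star Q.1 * M.1 * Q.1) 1 0 = 0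
    rw [hQ, coe_blockSU2, mul_assoc, Matrix.star_eq_conjTranspose]
    simp [Matrix.mul_apply, Fin.sum_univ_three]
    rw [e1, e2]
    ring
  obtain ⟨d1, d2, d3, d4⟩ := hDp
  -- A triangular unitary matrix is diagonal: the first column already gives `D.1 0 0` modulus one,
  -- which exhausts the first row.
  have d01 : D.1 0 1 = 0 := by
    have hc := D.sum_col 0 0
    have hr := D.sum_row 0 0
    simp only [d10, d1, d3, star_zero, zero_mul, add_zero, if_true] at hc hr
    rw [mul_comm] at hc
    rw [hc] at hr
    simpa using hr
  have c0 := D.sum_row 0 0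
  have c1 := D.sum_row 1 1
  simp only [d10, d01, d1, d2, star_zero, zero_mul, add_zero, zero_add, if_true] at c0 c1
  have n0 : ‖D.1 0 0‖ = 1 := by
    rw [mul_star_eq_normSq] at c0
    exact (pow_eq_one_iff_of_nonneg (norm_nonneg _) two_ne_zero).1 (by exact_mod_cast c0)
  have n1 : ‖D.1 1 1‖ = 1 := by
    rw [mul_star_eq_normSq] at c1
    exact (pow_eq_one_iff_of_nonneg (norm_nonneg _) two_ne_zero).1 (by exact_mod_cast c1)
  let a : Circle := ⟨D.1 0 0, by simpa [Submonoid.unitSphere] using n0⟩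
  let b : Circle := ⟨D.1 1 1, by simpa [Submonoid.unitSphere] using n1⟩
  have hdet := D.det_eq
  rw [Matrix.det_fin_three] at hdet
  simp only [d10, d01, d1, d2, d3, d4, zero_mul, mul_zero, add_zero, sub_zero] at hdet
  have hDab : D = diag3 (a, b) := by
    rw [SU3.ext_iff_coe, coe_diag3]
    have h22 : D.1 2 2 = ((a * b)⁻¹ : Circle) := by
      rw [Circle.coe_inv, Circle.coe_mul]
      exact eq_inv_of_mul_eq_one_right hdet
    ext i j
    fin_cases i <;> fin_cases j
    · rfl
    · exact d01
    · exact d1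
    · exact d10
    · rfl
    · exact d2
    · exact d3
    · exact d4
    · exact h22
  refine ⟨x, y, hxy, a, b, ?_⟩
  rw [← hDab, hD, ← hQ]
  group

/-- The columns of the block are exchanged, with the sign that keeps the determinant. This makes the
order of the two eigenvalues free. -/
theorem blockSU2_swap {x y : ℂ} (h : x * star x + y * star y = 1) (a b : Circle) :
    ∃ (x' y' : ℂ) (h' : x' * star x' + y' * star y' = 1),
      blockSU2 x y h * diag3 (a, b) * (blockSU2 x y h)⁻¹ =
        blockSU2 x' y' h' * diag3 (b, a) * (blockSU2 x' y' h')⁻¹ := by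
  refine ⟨-star y, star x, by rw [← h]; simp; ring, ?_⟩
  rw [SU3.ext_iff_coe]
  change (blockSU2 x y h).1 * (diag3 (a, b)).1 * star (blockSU2 x y h).1 =
    (blockSU2 _ _ _).1 * (diag3 (b, a)).1 * star (blockSU2 _ _ _).1
  rw [coe_diag3, coe_diag3, coe_blockSU2, coe_blockSU2, Matrix.star_eq_conjTranspose,
    Matrix.star_eq_conjTranspose, mul_comm b a]
  ext i j
  fin_cases i <;> fin_cases j <;>
    simp [Matrix.mul_apply, Fin.sum_univ_three] <;> ring

/-- Conjugation by diagonal matrices brings a special unitary block to a rotation. -/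
theorem exists_diag3_blockSU2 {x y : ℂ} (h : x * star x + y * star y = 1) :
    ∃ (a b c : Circle) (s : unitInterval),
      diag3 (a, b) * blockSU2 x y h * diag3 (1, c) = planeRotation s := by
  have hn : ‖x‖ ^ 2 + ‖y‖ ^ 2 = 1 := by
    rw [mul_star_eq_normSq, mul_star_eq_normSq] at h
    exact_mod_cast h
  have polar (z : ℂ) : ∃ a : Circle, (a : ℂ) * z = (‖z‖ : ℝ) ∧ (a : ℂ) * (‖z‖ : ℝ) = star z := by
    refine ⟨Circle.exp (-z.arg), ?_, ?_⟩
    · rw [Circle.coe_exp]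
      conv_lhs => rw [← Complex.norm_mul_exp_arg_mul_I z]
      rw [mul_left_comm, ← Complex.exp_add]
      simp
    · rw [Circle.coe_exp, Complex.star_def]
      conv_rhs => rw [← Complex.norm_mul_exp_arg_mul_I z]
      rw [map_mul, ← Complex.exp_conj]
      simp [mul_comm]
  obtain ⟨a, ha, ha'⟩ := polar x
  obtain ⟨b, hb, hb'⟩ := polar y
  -- The phases `a` and `b` make the first column real and nonnegative; the determinant of the block
  -- then dictates the phase of the second column.
  refine ⟨a, b, (a * b)⁻¹, ⟨‖x‖ ^ 2, sq_nonneg _, by nlinarith [sq_nonneg ‖y‖]⟩, ?_⟩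
  have e1 : √(1 - ‖x‖ ^ 2) = ‖y‖ := by
    rw [← hn, add_sub_cancel_left, Real.sqrt_sq (norm_nonneg y)]
  have ea := Circle.mul_star_coe a
  have eb := Circle.mul_star_coe b
  have ha0 : (a : ℂ) ≠ 0 := Circle.coe_ne_zero a
  have hb0 : (b : ℂ) ≠ 0 := Circle.coe_ne_zero b
  rw [SU3.ext_iff_coe]
  change (diag3 (a, b)).1 * (blockSU2 x y h).1 * (diag3 _).1 = (blockSU2 _ _ _).1
  rw [coe_diag3, coe_diag3, coe_blockSU2, coe_blockSU2]
  simp only [Complex.star_def] at ha' hb'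
  ext i j
  fin_cases i <;> fin_cases j <;>
    simp [Matrix.mul_apply, Fin.sum_univ_three, e1, ha, hb, ← ha', ← hb', Real.sqrt_sq] <;> field_simp

end reduction

/-! ### Common roots and roots of unity in the upper half plane -/

section roots

/-- If `p * m + q * n = 1`, then `t = a ^ n * b ^ m` works. It turns the equality of the scalars `u
^ p` and `v ^ q` into a common scale `τ`. -/
theorem exists_common_pow {A : Type*} [CommGroup A] {p q : ℕ} (hpq : Nat.Coprime p q) {a b : A}
    (h : a ^ p = b ^ q) : ∃ t : A, t ^ q = a ∧ t ^ p = b := by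
  have h1 := gcd_coprime_eq hpq
  set m := Nat.gcdA p q
  set n := Nat.gcdB p q
  have h2 : a ^ (p : ℤ) = b ^ (q : ℤ) := by exact_mod_cast h
  refine ⟨a ^ n * b ^ m, ?_, ?_⟩
  · rw [← zpow_natCast, mul_zpow, ← zpow_mul, ← zpow_mul, mul_comm m, zpow_mul b, ← h2, ← zpow_mul,
      ← zpow_add]
    conv_rhs => rw [← zpow_one a, ← h1]
    congr 1
    ring
  · rw [← zpow_natCast, mul_zpow, ← zpow_mul, ← zpow_mul, mul_comm n, zpow_mul a, h2, ← zpow_mul,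
      ← zpow_add]
    conv_rhs => rw [← zpow_one b, ← h1]
    congr 1
    ring

/-- The nontrivial `p`-th roots of unity in the upper half plane. -/
noncomputable def halfRoot (p : ℕ) (a : Fin ((p - 1) / 2)) : Circle :=
  unitExp (((a : ℕ) + 1 : ℕ) / p)

theorem halfRoot_pow {p : ℕ} (a : Fin ((p - 1) / 2)) : halfRoot p a ^ p = 1 := by
  have hp : (p : ℝ) ≠ 0 := by
    have := a.2
    exact_mod_cast (by omega : p ≠ 0)
  rw [halfRoot, ← unitExp_nat_mul, mul_div_cancel₀ _ hp]
  exact_mod_cast unitExp_int ((a : ℕ) + 1 : ℕ)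

theorem halfRoot_ne_one {p : ℕ} (a : Fin ((p - 1) / 2)) : halfRoot p a ≠ 1 := by
  have ha := a.2
  have hp : (0 : ℝ) < p := by exact_mod_cast (by omega : 0 < p)
  rw [halfRoot, Ne, unitExp_eq_one_iff]
  rintro ⟨n, hn⟩
  rw [div_eq_iff hp.ne'] at hn
  have h1 : (((a : ℕ) + 1 : ℕ) : ℤ) = n * p := by exact_mod_cast hn
  have h2 : (p : ℤ) ∣ (((a : ℕ) + 1 : ℕ) : ℤ) := ⟨n, by rw [h1, mul_comm]⟩
  have := Nat.le_of_dvd (by omega) (Int.natCast_dvd_natCast.1 h2)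
  omega

theorem Circle.coe_ne_one {z : Circle} (h : z ≠ 1) : (z : ℂ) ≠ 1 :=
  fun h' => h (Circle.ext h')

theorem one_add_ne_zero_of_odd_pow {p : ℕ} (hp : Odd p) {z : Circle} (h : z ^ p = 1) :
    1 + (z : ℂ) ≠ 0 := by
  intro h'
  have h1 : (z : ℂ) = -1 := by linear_combination h'
  have h2 : (z : ℂ) ^ p = 1 := by rw [← Circle.coe_pow, h, Circle.coe_one]
  rw [h1, hp.neg_one_pow] at h2
  norm_num at h2

/-- The squared norm of `1 + unitExp t` is `2 + 2 * cos (2 π t)`, and cosine is injective on `[0,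
π]`. This norm occurs as the absolute value of a plane trace, so it distinguishes components
independently of `τ`. -/
theorem norm_one_add_halfRoot_injective (p : ℕ) :
    Function.Injective fun a : Fin ((p - 1) / 2) => ‖1 + (halfRoot p a : ℂ)‖ := by
  intro a b hab
  have ha := a.2
  have hb := b.2
  have hp : (0 : ℝ) < p := by exact_mod_cast (by omega : 0 < p)
  have key (t : ℝ) : ‖1 + (unitExp t : ℂ)‖ ^ 2 = 2 + 2 * Real.cos (2 * Real.pi * t) := by
    rw [← Complex.normSq_eq_norm_sq, unitExp, Circle.coe_exp, Complex.normSq_apply]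
    simp only [Complex.add_re, Complex.one_re, Complex.add_im, Complex.one_im,
      Complex.exp_ofReal_mul_I_re, Complex.exp_ofReal_mul_I_im]
    nlinarith [Real.sin_sq_add_cos_sq (2 * Real.pi * t)]
  have h1 := congrArg (· ^ 2) hab
  simp only [halfRoot, key] at h1
  have mem (c : Fin ((p - 1) / 2)) :
      2 * Real.pi * (((c : ℕ) + 1 : ℕ) / p : ℝ) ∈ Icc 0 Real.pi := by
    have hc := c.2
    have h3 : (((c : ℕ) + 1 : ℕ) : ℝ) * 2 ≤ p := by exact_mod_cast (by omega : (c + 1) * 2 ≤ p)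
    refine ⟨by positivity, ?_⟩
    rw [← mul_div_assoc, div_le_iff₀ hp]
    nlinarith [Real.pi_pos]
  have h2 := Real.injOn_cos (mem a) (mem b) (by linarith)
  have h3 := mul_left_cancel₀ (by positivity) h2
  rw [div_left_inj' hp.ne'] at h3
  have h4 : (a : ℕ) + 1 = b + 1 := by exact_mod_cast h3
  exact Fin.ext (by omega)

/-- For odd `p`, the number `-1` is not a `p`-th root of unity, so the nontrivial roots form
conjugate pairs with one member in the upper half plane. -/
theorem exists_halfRoot {p : ℕ} (hp : Odd p) {z : Circle} (h : z ^ p = 1) (hz : z ≠ 1) :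
    ∃ a, z = halfRoot p a ∨ z⁻¹ = halfRoot p a := by
  have hp0 : (p : ℝ) ≠ 0 := by exact_mod_cast hp.pos.ne'
  obtain ⟨x, rfl⟩ : ∃ x, z = unitExp x := ⟨(z : ℂ).arg / (2 * Real.pi), by
    rw [unitExp, mul_div_cancel₀ _ (by positivity), Circle.exp_arg]⟩
  rw [← unitExp_nat_mul, unitExp_eq_one_iff] at h
  obtain ⟨n, hn⟩ := h
  have hx : x = n / p := by field_simp; linarith
  have hpz : (0 : ℤ) < p := by exact_mod_cast hp.pos
  have h1 := Int.emod_nonneg n hpz.ne'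
  have h2 := Int.emod_lt_of_pos n hpz
  have h3 := Int.mul_ediv_add_emod n p
  obtain ⟨k, hk⟩ := Int.eq_ofNat_of_zero_le h1
  have hxk : unitExp x = unitExp (k / p) := by
    rw [unitExp_eq_iff]
    refine ⟨n / p, ?_⟩
    rw [hx, div_add' _ _ _ hp0]
    congr 1
    rw [hk] at h3
    have : ((n : ℤ) : ℝ) = ((p * (n / p) + (k : ℤ) : ℤ) : ℝ) := by exact_mod_cast h3.symm
    rw [this]
    push_cast
    ring
  have hk0 : k ≠ 0 := by
    rintro rfl
    rw [hxk] at hz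
    simp [unitExp_zero] at hz
  have hkp : k < p := by omega
  obtain ⟨m, hm⟩ := hp
  by_cases hkm : k ≤ (p - 1) / 2
  · refine ⟨⟨k - 1, by omega⟩, Or.inl ?_⟩
    rw [hxk, halfRoot]
    simp only
    rw [Nat.sub_add_cancel (by omega)]
  · refine ⟨⟨p - k - 1, by omega⟩, Or.inr ?_⟩
    rw [hxk, halfRoot, ← unitExp_neg, unitExp_eq_iff]
    refine ⟨-1, ?_⟩
    simp only
    rw [Nat.sub_add_cancel (by omega), Nat.cast_sub hkp.le]
    field_simp
    push_cast
    ring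

end roots

/-! ### Standard representations -/

section stdRep
variable {G : Type} [Group G] {p q : ℕ} {u v : G}

/-- Both powers have the same scalar `x.2 ^ (p * q)` on the plane, and the rotation commutes with
matrices that are scalar there. -/
theorem stdRep_rel {p q : ℕ} {ζ η : Circle} (hζ : ζ ^ p = 1) (hη : η ^ q = 1)
    (x : unitInterval × Circle) : diag3 (x.2 ^ q, x.2 ^ q * ζ) ^ p =
      (planeRotation x.1 * diag3 (x.2 ^ p, x.2 ^ p * η) * (planeRotation x.1)⁻¹) ^ q := by
  rw [conj_pow, ← map_pow, ← map_pow]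
  simp only [Prod.pow_mk, mul_pow, hζ, hη, mul_one, ← pow_mul]
  rw [planeRotation_commute, mul_comm]

/-- The reducible representation with parameters `(s, τ)` and eigenvalue ratios `ζ, η`. -/
noncomputable def stdRep (h : IsTorusKnotGroup p q u v) {ζ η : Circle} (hζ : ζ ^ p = 1)
    (hη : η ^ q = 1) (x : unitInterval × Circle) : SU3Hom G :=
  (h.exists_hom SU3 (diag3 (x.2 ^ q, x.2 ^ q * ζ))
    (planeRotation x.1 * diag3 (x.2 ^ p, x.2 ^ p * η) * (planeRotation x.1)⁻¹) (stdRep_rel hζ hη x)).choose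

variable (h : IsTorusKnotGroup p q u v) {ζ η : Circle} (hζ : ζ ^ p = 1) (hη : η ^ q = 1)
  (x : unitInterval × Circle)

theorem stdRep_left : stdRep h hζ hη x u = diag3 (x.2 ^ q, x.2 ^ q * ζ) :=
  (h.exists_hom SU3 _ _ (stdRep_rel hζ hη x)).choose_spec.1

theorem stdRep_right : stdRep h hζ hη x v =
    planeRotation x.1 * diag3 (x.2 ^ p, x.2 ^ p * η) * (planeRotation x.1)⁻¹ :=
  (h.exists_hom SU3 _ _ (stdRep_rel hζ hη x)).choose_spec.2

theorem coe_stdRep_left : (stdRep h hζ hη x u).1 =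
    !![(x.2 : ℂ) ^ q, 0, 0; 0, (x.2 : ℂ) ^ q * ζ, 0; 0, 0, star ((x.2 : ℂ) ^ (2 * q) * ζ)] := by
  rw [stdRep_left, coe_diag3]
  simp [-Circle.coe_inv, Circle.coe_inv_eq_conj]
  ring

theorem coe_stdRep_right : (stdRep h hζ hη x v).1 =
    !![(x.2 : ℂ) ^ p * ((x.1 : ℝ) + (1 - (x.1 : ℝ)) * η),
        (x.2 : ℂ) ^ p * ((√(x.1 : ℝ) : ℝ) * (√(1 - x.1 : ℝ) : ℝ) * (1 - η)), 0;
      (x.2 : ℂ) ^ p * ((√(x.1 : ℝ) : ℝ) * (√(1 - x.1 : ℝ) : ℝ) * (1 - η)),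
        (x.2 : ℂ) ^ p * ((1 - (x.1 : ℝ)) + (x.1 : ℝ) * η), 0;
      0, 0, star ((x.2 : ℂ) ^ (2 * p) * η)] := by
  rw [stdRep_right, coe_planeRotation_mul]
  ext i j
  fin_cases i <;> fin_cases j <;> simp [-Circle.coe_inv, Circle.coe_inv_eq_conj] <;> ring

theorem stdRep_mem_planeSubgroup (g : G) : stdRep h hζ hη x g ∈ planeSubgroup := by
  refine h.forall_mem ?_ ?_ g
  · rw [stdRep_left]
    exact diag3_mem_planeSubgroup _
  · rw [stdRep_right]
    exact mul_mem (mul_mem (blockSU2_mem_planeSubgroup _) (diag3_mem_planeSubgroup _))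
      (inv_mem (blockSU2_mem_planeSubgroup _))

theorem continuous_stdRep : Continuous (stdRep h hζ hη) := by
  refine h.continuous_rep (continuous_induced_rng.2 ?_) (continuous_induced_rng.2 ?_)
  · change Continuous fun x => (stdRep h hζ hη x u).1
    simp only [coe_stdRep_left]
    refine continuous_matrix fun i j => ?_
    fin_cases i <;> fin_cases j <;> simp <;> fun_prop
  · change Continuous fun x => (stdRep h hζ hη x v).1
    simp only [coe_stdRep_right]
    refine continuous_matrix fun i j => ?_
    fin_cases i <;> fin_cases j <;> simp <;> fun_prop

theorem stdRep_isAbelian_iff (hζ1 : ζ ≠ 1) (hη1 : η ≠ 1) :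
    (stdRep h hζ hη x).IsAbelian ↔ (x.1 : ℝ) = 0 ∨ (x.1 : ℝ) = 1 := by
  have e1 : (1 - (ζ : ℂ)) ≠ 0 := sub_ne_zero.2 (Circle.coe_ne_one hζ1).symm
  have e2 : (1 - (η : ℂ)) ≠ 0 := sub_ne_zero.2 (Circle.coe_ne_one hη1).symm
  rw [h.isAbelian_iff, SU3.ext_iff_coe]
  change (stdRep h hζ hη x u).1 * (stdRep h hζ hη x v).1 =
    (stdRep h hζ hη x v).1 * (stdRep h hζ hη x u).1 ↔ _
  rw [coe_stdRep_left, coe_stdRep_right]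
  constructor
  · intro h'
    have h1 := congrFun (congrFun h' 0) 1
    simp [Matrix.mul_apply, Fin.sum_univ_three] at h1
    have h2 : ((√(x.1 : ℝ) : ℝ) : ℂ) * (√(1 - x.1 : ℝ) : ℝ) *
        ((x.2 : ℂ) ^ q * (x.2 : ℂ) ^ p * (1 - η) * (1 - ζ)) = 0 := by linear_combination h1
    have h3 : (x.2 : ℂ) ^ q * (x.2 : ℂ) ^ p * (1 - η) * (1 - ζ) ≠ 0 :=
      mul_ne_zero (mul_ne_zero (mul_ne_zero (pow_ne_zero _ (Circle.coe_ne_zero _))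
        (pow_ne_zero _ (Circle.coe_ne_zero _))) e2) e1
    rcases mul_eq_zero.1 ((mul_eq_zero.1 h2).resolve_right h3) with h4 | h4
    · left
      exact (Real.sqrt_eq_zero x.1.2.1).1 (by exact_mod_cast h4)
    · right
      have := (Real.sqrt_eq_zero (sub_nonneg.2 x.1.2.2)).1 (by exact_mod_cast h4)
      linarith
  · rintro (h1 | h1) <;> rw [h1] <;> ext i j <;> fin_cases i <;> fin_cases j <;>
      simp [Matrix.mul_apply, Fin.sum_univ_three] <;> ring

/-- Every nonabelian reducible representation is conjugate to a standard one. -/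
theorem exists_repClass_stdRep (hp : Odd p) (hq : Odd q) (hpq : Nat.Coprime p q) {ρ : SU3Hom G}
    (hr : ρ.IsReducible) (hρ : ¬ ρ.IsAbelian) :
    ∃ (a : Fin ((p - 1) / 2)) (b : Fin ((q - 1) / 2)) (x : unitInterval × Circle),
      repClass (stdRep h (halfRoot_pow a) (halfRoot_pow b) x) = repClass ρ := by
  obtain ⟨P, hP⟩ := hr.exists_conj_mem_planeSubgroup
  -- The eigenvalues are ordered so that their ratio, once known to be a nontrivial `n`-th root of
  -- unity, lies in the upper half plane.
  have pick : ∀ (n : ℕ) (M : SU3), Odd n → M ∈ planeSubgroup →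
      ∃ (x y : ℂ) (h : x * star x + y * star y = 1) (a b : Circle),
        M = blockSU2 x y h * diag3 (a, b) * (blockSU2 x y h)⁻¹ ∧
        (a ^ n = b ^ n → a ≠ b → ∃ k, b = a * halfRoot n k) := by
    intro n M hn hM
    obtain ⟨x, y, hxy, a, b, e⟩ := exists_blockSU2_diag hM
    by_cases hab : a ^ n = b ^ n ∧ a ≠ b
    · obtain ⟨k, hk | hk⟩ := exists_halfRoot (z := a⁻¹ * b) hn
        (by rw [mul_pow, inv_pow, hab.1, inv_mul_cancel])
        (fun h => hab.2 (inv_mul_eq_one.1 h))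
      · exact ⟨x, y, hxy, a, b, e, fun _ _ => ⟨k, by rw [← hk]; group⟩⟩
      · obtain ⟨x', y', hxy', e'⟩ := blockSU2_swap hxy a b
        exact ⟨x', y', hxy', b, a, e.trans e', fun _ _ => ⟨k, by rw [← hk]; group⟩⟩
    · exact ⟨x, y, hxy, a, b, e, fun h1 h2 => absurd ⟨h1, h2⟩ hab⟩
  obtain ⟨x, y, hxy, a, b, hA, hk⟩ := pick p _ hp (hP u)
  set Q := blockSU2 x y hxy with hQ
  set σ := (ρ.conj P).conj Q⁻¹ with hσ
  have hσu : σ u = diag3 (a, b) := by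
    rw [hσ, SU3Hom.conj_apply, hA]
    group
  have hσp : σ v ∈ planeSubgroup := mul_mem (mul_mem (inv_mem (blockSU2_mem_planeSubgroup hxy))
    (hP v)) (inv_mem (inv_mem (blockSU2_mem_planeSubgroup hxy)))
  have hσρ : repClass σ = repClass ρ := by rw [hσ, repClass_conj, repClass_conj]
  obtain ⟨x', y', hxy', c, d, hB, hk'⟩ := pick q _ hq hσp
  have hσa : ¬ σ.IsAbelian := fun h' => hρ (isAbelian_congr hσρ h')
  have hcomm : ¬ σ u * σ v = σ v * σ u := fun h' => hσa (h.isAbelian_iff.2 h')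
  have plane_comm : ∀ {M : SU3} (t : Circle), M ∈ planeSubgroup →
      diag3 (t, t) * M = M * diag3 (t, t) := by
    rintro M t ⟨m1, m2, m3, m4⟩
    apply Subtype.ext
    change (diag3 (t, t)).1 * M.1 = M.1 * (diag3 (t, t)).1
    rw [coe_diag3]
    ext i j
    fin_cases i <;> fin_cases j <;>
      simp [Matrix.mul_apply, Fin.sum_univ_three, m1, m2, m3, m4, mul_comm]
  have hab : a ≠ b := by
    rintro rfl
    exact hcomm (by rw [hσu]; exact plane_comm a hσp)
  have hcd : c ≠ d := by
    rintro rfl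
    refine hcomm ?_
    rw [hB, ← plane_comm c (blockSU2_mem_planeSubgroup hxy'), mul_inv_cancel_right, hσu,
      ← map_mul, ← map_mul, mul_comm]
  have hpow : σ u ^ p = σ v ^ q := by rw [← map_pow, h.rel, map_pow]
  -- The diagonal matrix `σ u ^ p = σ v ^ q` commutes with `σ v`. If its first two entries were
  -- distinct, `σ v` would be diagonal and `σ` abelian.
  have habp : a ^ p = b ^ p := by
    have h1 : σ u ^ p * σ v = σ v * σ u ^ p := by rw [hpow, ← pow_succ, pow_succ']
    rw [hσu, ← map_pow, Prod.pow_mk, SU3.ext_iff_coe] at h1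
    change (diag3 _).1 * (σ v).1 = (σ v).1 * (diag3 _).1 at h1
    rw [coe_diag3] at h1
    by_contra hne
    have hne' : ((a ^ p : Circle) : ℂ) - (b ^ p : Circle) ≠ 0 :=
      sub_ne_zero.2 fun h' => hne (Circle.ext h')
    have h01 := congrFun (congrFun h1 0) 1
    have h10 := congrFun (congrFun h1 1) 0
    simp only [Matrix.mul_apply, Fin.sum_univ_three] at h01 h10
    simp [-Circle.coe_pow] at h01 h10
    have z01 : (σ v).1 0 1 = 0 := by
      refine (mul_eq_zero.1 (?_ : _ * (σ v).1 0 1 = 0)).resolve_left hne'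
      linear_combination h01
    have z10 : (σ v).1 1 0 = 0 := by
      refine (mul_eq_zero.1 (?_ : _ * (σ v).1 1 0 = 0)).resolve_left hne'
      linear_combination -h10
    obtain ⟨m1, m2, m3, m4⟩ := hσp
    refine hcomm (Subtype.ext ?_)
    change (σ u).1 * (σ v).1 = (σ v).1 * (σ u).1
    rw [hσu, coe_diag3]
    ext i j
    fin_cases i <;> fin_cases j <;>
      simp [Matrix.mul_apply, Fin.sum_univ_three, m1, m2, m3, m4, z01, z10, mul_comm]
  have hpow' : diag3 (c ^ q, d ^ q) = diag3 (a ^ p, a ^ p) := by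
    have h1 : diag3 (a, b) ^ p = blockSU2 x' y' hxy' * diag3 (c, d) ^ q * (blockSU2 x' y' hxy')⁻¹ := by
      rw [← conj_pow, ← hB, ← hpow, hσu]
    rw [← map_pow, ← map_pow, Prod.pow_mk, Prod.pow_mk, ← habp] at h1
    have h2 := plane_comm (a ^ p) (blockSU2_mem_planeSubgroup hxy')
    have h3 : diag3 (c ^ q, d ^ q) =
        (blockSU2 x' y' hxy')⁻¹ * (diag3 (a ^ p, a ^ p) * blockSU2 x' y' hxy') := by
      rw [h1]
      group
    rw [h3, h2, inv_mul_cancel_left]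
  have hpow'' := SU3.ext_iff_coe.1 hpow'
  rw [coe_diag3, coe_diag3] at hpow''
  have hcq : c ^ q = a ^ p := Circle.ext (by simpa using congrFun (congrFun hpow'' 0) 0)
  have hdq : d ^ q = a ^ p := Circle.ext (by simpa using congrFun (congrFun hpow'' 1) 1)
  obtain ⟨k, rfl⟩ := hk habp hab
  obtain ⟨l, rfl⟩ := hk' (hcq.trans hdq.symm) hcd
  obtain ⟨τ, rfl, rfl⟩ := exists_common_pow hpq hcq.symm
  -- Conjugation by `diag3 (t₁, t₂)` fixes the diagonal matrix `σ u`, while the right factor `diag3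
  -- (1, t₃)` is absorbed because it commutes with the diagonal form of `σ v`.
  obtain ⟨t₁, t₂, t₃, s, hs⟩ := exists_diag3_blockSU2 hxy'
  refine ⟨k, l, (s, τ), ?_⟩
  rw [← hσρ, ← repClass_conj (diag3 (t₁, t₂)) σ]
  congr 1
  refine h.hom_ext ?_ ?_
  · rw [stdRep_left, SU3Hom.conj_apply, hσu, ← map_inv, ← map_mul, ← map_mul,
      mul_inv_cancel_comm]
  · rw [stdRep_right, SU3Hom.conj_apply, hB, ← hs]
    have e : diag3 (1, t₃) * diag3 (τ ^ p, τ ^ p * halfRoot q l) =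
        diag3 (τ ^ p, τ ^ p * halfRoot q l) * diag3 (1, t₃) := by
      rw [← map_mul, ← map_mul, mul_comm]
    simp only [mul_inv_rev]
    simp only [mul_assoc]
    congr 2
    rw [← mul_assoc (diag3 (1, t₃)), e, mul_assoc, mul_inv_cancel_left]

end stdRep

/-! ### Characters and traces on the invariant plane -/

section characters
variable {G : Type} [Group G]

/-- The character of `w` as a function of the conjugacy class. -/
noncomputable def character (w : G) : RepVariety G → ℂ :=
  Quotient.lift (fun ρ : SU3Hom G => (ρ w).1.trace) (by
    rintro ρ σ ⟨a, ha⟩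
    simp only [ha]
    change _ = (a.1 * (ρ w).1 * star a.1).trace
    rw [Matrix.trace_mul_comm, ← mul_assoc, SU3.star_mul, one_mul])

theorem character_repClass (w : G) (ρ : SU3Hom G) : character w (repClass ρ) = (ρ w).1.trace := rfl

theorem continuous_eval (w : G) : Continuous fun ρ : SU3Hom G => ρ w :=
  (continuous_apply w).comp continuous_induced_dom

theorem continuous_character (w : G) : Continuous (character w) :=
  Continuous.quotient_lift
    ((Continuous.matrix_trace continuous_id).comp (continuous_subtype_val.comp (continuous_eval w))) _

theorem continuous_repClass : Continuous (repClass : SU3Hom G → RepVariety G) :=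
  continuous_quotient_mk'

/-- The trace of `W` on the plane, from the traces of `K`, `K * K * W`, `K * W` and `W`, where `K`
fixes the third basis vector. -/
noncomputable def planeTrace (a b c d : ℂ) : ℂ := d - (b - (a - 1) * c + d) / (3 - a)

/-- On the plane `K` has determinant `1` and trace `K.1.trace - 1`, so by Cayley-Hamilton `K * K -
(tr K - 1) * K + 1` vanishes there; on the third basis vector it is `3 - tr K`. Taking the trace
against `W` isolates `W.1 2 2`, which is subtracted from the full trace. -/
theorem planeTrace_eq {K W : SU3} (hK : K ∈ planeSubgroup) (hW : W ∈ planeSubgroup)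
    (h : K.1 2 2 = 1) (h3 : 3 - K.1.trace ≠ 0) :
    planeTrace K.1.trace (K * K * W).1.trace (K * W).1.trace W.1.trace = W.1 0 0 + W.1 1 1 := by
  obtain ⟨k1, k2, k3, k4⟩ := hK
  obtain ⟨w1, w2, w3, w4⟩ := hW
  have hd := K.det_eq
  rw [Matrix.det_fin_three] at hd
  simp only [k1, k2, k3, k4, h, zero_mul, mul_zero, add_zero, sub_zero, mul_one] at hd
  rw [planeTrace, sub_eq_iff_eq_add, ← sub_eq_iff_eq_add', eq_div_iff h3]
  change _ = (K.1 * K.1 * W.1).trace - (_ - 1) * (K.1 * W.1).trace + _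
  simp only [Matrix.trace_fin_three, Matrix.mul_apply, Fin.sum_univ_three, k1, k2, k3, k4, w1, w2,
    w3, w4, h]
  linear_combination (W.1 0 0 + W.1 1 1) * hd

/-- The commutator of two group elements, as a word. -/
def commutatorWord (u v : G) : G := u * v * u⁻¹ * v⁻¹

/-- The trace of `w` on the invariant plane, as a function of the conjugacy class. -/
noncomputable def planeCharacter (u v w : G) (c : RepVariety G) : ℂ :=
  planeTrace (character (commutatorWord u v) c)
    (character (commutatorWord u v * commutatorWord u v * w) c)
    (character (commutatorWord u v * w) c) (character w c)

theorem continuousAt_planeCharacter (u v w : G) {c : RepVariety G}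
    (h : 3 - character (commutatorWord u v) c ≠ 0) : ContinuousAt (planeCharacter u v w) c := by
  have H (w : G) := (continuous_character w).continuousAt (x := c)
  exact (H _).sub ((((H _).sub (((H _).sub continuousAt_const).mul (H _))).add (H _)).div
    (continuousAt_const.sub (H _)) h)

end characters

/-! ### Recovering the parameters from characters -/

section invariants
variable {G : Type} [Group G] {p q : ℕ} {u v : G}
variable (h : IsTorusKnotGroup p q u v) {ζ η : Circle} (hζ : ζ ^ p = 1) (hη : η ^ q = 1)
  (x : unitInterval × Circle)

theorem mul_apply_two_two {A B : SU3} (hA : A ∈ planeSubgroup) :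
    (A * B).1 2 2 = A.1 2 2 * B.1 2 2 := by
  obtain ⟨a1, a2, a3, a4⟩ := hA
  change (A.1 * B.1) 2 2 = _
  simp [Matrix.mul_apply, Fin.sum_univ_three, a3, a4]

/-- On `planeSubgroup` the last diagonal entry is a character with values in an abelian group, so it
is trivial on commutators. -/
theorem commutator_apply_two_two {A B : SU3} (hA : A ∈ planeSubgroup) (hB : B ∈ planeSubgroup) :
    (A * B * A⁻¹ * B⁻¹).1 2 2 = 1 := by
  rw [mul_apply_two_two (mul_mem (mul_mem hA hB) (inv_mem hA)), mul_apply_two_two (mul_mem hA hB),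
    mul_apply_two_two hA, SU3.inv_apply, SU3.inv_apply]
  have h1 := A.sum_row 2 2
  have h2 := B.sum_row 2 2
  obtain ⟨a1, a2, a3, a4⟩ := hA
  obtain ⟨b1, b2, b3, b4⟩ := hB
  simp only [a3, a4, b3, b4, zero_mul, zero_add, if_true] at h1 h2
  linear_combination B.1 2 2 * star (B.1 2 2) * h1 + h2

/-- This quantity measures noncommutativity: it is nonzero precisely inside the cylinder, where it
serves as the denominator of the plane traces. -/
theorem trace_commutator_stdRep :
    3 - (stdRep h hζ hη x (commutatorWord u v)).1.trace =
      (((x.1 : ℝ) * (1 - (x.1 : ℝ)) * ‖1 - (ζ : ℂ)‖ ^ 2 * ‖1 - (η : ℂ)‖ ^ 2 : ℝ) : ℂ) := by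
  set A := stdRep h hζ hη x u with hA
  set B := stdRep h hζ hη x v with hB
  have e : (stdRep h hζ hη x (commutatorWord u v)).1 = A.1 * B.1 * star A.1 * star B.1 := by
    simp only [commutatorWord, map_mul, map_inv]
    rfl
  have r1 := B.sum_row 0 0
  have r2 := B.sum_row 1 1
  rw [e]
  have b01 : ((√(x.1 : ℝ) : ℝ) : ℂ) * ((√(1 - x.1 : ℝ) : ℝ) : ℂ) *
      (((√(x.1 : ℝ) : ℝ) : ℂ) * ((√(1 - x.1 : ℝ) : ℝ) : ℂ)) = (x.1 : ℝ) * (1 - (x.1 : ℝ)) := by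
    have h1 : ((√(x.1 : ℝ) : ℝ) : ℂ) * (√(x.1 : ℝ) : ℝ) = (x.1 : ℝ) := by
      rw [← Complex.ofReal_mul, Real.mul_self_sqrt x.1.2.1]
    have h2 : ((√(1 - x.1 : ℝ) : ℝ) : ℂ) * (√(1 - x.1 : ℝ) : ℝ) = 1 - (x.1 : ℝ) := by
      rw [← Complex.ofReal_mul, Real.mul_self_sqrt (sub_nonneg.2 x.1.2.2)]
      push_cast
      rfl
    linear_combination ((√(1 - x.1 : ℝ) : ℝ) : ℂ) * ((√(1 - x.1 : ℝ) : ℝ) : ℂ) * h1 + (x.1 : ℝ) * h2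
  have c1 := Circle.mul_star_coe x.2
  have c2 := Circle.mul_star_coe ζ
  have cp : (x.2 : ℂ) ^ p * star (x.2 : ℂ) ^ p = 1 := by rw [← mul_pow, c1, one_pow]
  have cq : (x.2 : ℂ) ^ q * star (x.2 : ℂ) ^ q = 1 := by rw [← mul_pow, c1, one_pow]
  have hA' : A.1 = _ := coe_stdRep_left h hζ hη x
  have B02 : B.1 0 2 = 0 := (stdRep_mem_planeSubgroup h hζ hη x v).1
  have B12 : B.1 1 2 = 0 := (stdRep_mem_planeSubgroup h hζ hη x v).2.1
  have B20 : B.1 2 0 = 0 := (stdRep_mem_planeSubgroup h hζ hη x v).2.2.1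
  have B21 : B.1 2 1 = 0 := (stdRep_mem_planeSubgroup h hζ hη x v).2.2.2
  have B22 : B.1 2 2 * star (B.1 2 2) = 1 := by
    have := B.sum_row 2 2
    simpa [B20, B21] using this
  have a2 := A.sum_row 2 2
  rw [hA'] at a2
  simp at a2
  have B01 : B.1 0 1 = (x.2 : ℂ) ^ p * ((√(x.1 : ℝ) : ℝ) * (√(1 - x.1 : ℝ) : ℝ) * (1 - η)) := by
    rw [hB, coe_stdRep_right]; simp
  have B10 : B.1 1 0 = (x.2 : ℂ) ^ p * ((√(x.1 : ℝ) : ℝ) * (√(1 - x.1 : ℝ) : ℝ) * (1 - η)) := by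
    rw [hB, coe_stdRep_right]; simp
  have n1 := mul_star_eq_normSq (1 - (ζ : ℂ))
  have n2 := mul_star_eq_normSq (1 - (η : ℂ))
  have hy : B.1 0 1 * star (B.1 0 1) = (x.1 : ℝ) * (1 - (x.1 : ℝ)) * ((‖1 - (η : ℂ)‖ ^ 2 : ℝ) : ℂ) := by
    rw [← n2, B01]
    simp only [star_mul', star_pow, Complex.star_def, Complex.conj_ofReal] at cp ⊢
    rw [← b01]
    linear_combination ((√(x.1 : ℝ) : ℝ) : ℂ) ^ 2 * ((√(1 - x.1 : ℝ) : ℝ) : ℂ) ^ 2 * (1 - η) *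
      (starRingEnd ℂ) (1 - η) * cp
  have hy' : B.1 1 0 = B.1 0 1 := by rw [B01, B10]
  rw [B02, hy'.symm, star_zero, mul_zero, add_zero, if_pos rfl, hy'] at r1
  rw [B12, hy', star_zero, mul_zero, add_zero, if_pos rfl] at r2
  -- As `A` is diagonal with ratio `ζ` on the plane, only the squared modulus of the off-diagonal
  -- entry of `B` survives, weighted by that of `1 - ζ`.
  have fin : 3 - (A.1 * B.1 * star A.1 * star B.1).trace =
      B.1 0 1 * star (B.1 0 1) * ((1 - ζ) * star (1 - (ζ : ℂ))) := by
    rw [hA', Matrix.star_eq_conjTranspose, Matrix.star_eq_conjTranspose]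
    simp only [Matrix.trace_fin_three, Matrix.mul_apply, Fin.sum_univ_three, B02, B12, B20, B21, hy',
      Matrix.conjTranspose_apply]
    simp [-mul_eq_mul_left_iff, -mul_eq_mul_right_iff] at cq c2 a2 r1 r2 B22 ⊢
    linear_combination
      -(B.1 0 0 * (starRingEnd ℂ) (B.1 0 0) + B.1 0 1 * (starRingEnd ℂ) (B.1 0 1) * (starRingEnd ℂ) (ζ : ℂ) +
        B.1 0 1 * (starRingEnd ℂ) (B.1 0 1) * ζ + ζ * (starRingEnd ℂ) (ζ : ℂ) * (B.1 1 1 * (starRingEnd ℂ) (B.1 1 1))) * cq -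
      (B.1 1 1 * (starRingEnd ℂ) (B.1 1 1) + B.1 0 1 * (starRingEnd ℂ) (B.1 0 1)) * c2 - r1 - r2 -
      B.1 2 2 * (starRingEnd ℂ) (B.1 2 2) * a2 - B22
  rw [fin, hy, n1]
  push_cast
  ring

theorem character_commutator_stdRep :
    3 - character (commutatorWord u v) (repClass (stdRep h hζ hη x)) =
      (((x.1 : ℝ) * (1 - (x.1 : ℝ)) * ‖1 - (ζ : ℂ)‖ ^ 2 * ‖1 - (η : ℂ)‖ ^ 2 : ℝ) : ℂ) :=
  trace_commutator_stdRep h hζ hη x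

theorem character_commutator_ne (hζ1 : ζ ≠ 1) (hη1 : η ≠ 1) (hx : (x.1 : ℝ) ∈ Ioo (0 : ℝ) 1) :
    3 - character (commutatorWord u v) (repClass (stdRep h hζ hη x)) ≠ 0 := by
  rw [character_commutator_stdRep]
  have e1 : 0 < ‖1 - (ζ : ℂ)‖ := norm_pos_iff.2 (sub_ne_zero.2 (Circle.coe_ne_one hζ1).symm)
  have e2 : 0 < ‖1 - (η : ℂ)‖ := norm_pos_iff.2 (sub_ne_zero.2 (Circle.coe_ne_one hη1).symm)
  have := mul_pos hx.1 (sub_pos.2 hx.2)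
  exact_mod_cast (by positivity : (0 : ℝ) < _ * _ * _).ne'

section planeCharacter
variable (hζ1 : ζ ≠ 1) (hη1 : η ≠ 1) (hx : (x.1 : ℝ) ∈ Ioo (0 : ℝ) 1)
include hζ1 hη1 hx

theorem planeCharacter_stdRep (w : G) : planeCharacter u v w (repClass (stdRep h hζ hη x)) =
    (stdRep h hζ hη x w).1 0 0 + (stdRep h hζ hη x w).1 1 1 := by
  have h3 := character_commutator_ne h hζ hη x hζ1 hη1 hx
  simp only [planeCharacter, character_repClass, map_mul] at h3 ⊢
  refine planeTrace_eq (stdRep_mem_planeSubgroup ..) (stdRep_mem_planeSubgroup ..) ?_ h3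
  simp only [commutatorWord, map_mul, map_inv]
  exact commutator_apply_two_two (stdRep_mem_planeSubgroup ..) (stdRep_mem_planeSubgroup ..)

theorem planeCharacter_stdRep_left : planeCharacter u v u (repClass (stdRep h hζ hη x)) =
    (x.2 : ℂ) ^ q * (1 + ζ) := by
  rw [planeCharacter_stdRep h hζ hη x hζ1 hη1 hx, coe_stdRep_left]
  simp
  ring

theorem planeCharacter_stdRep_right : planeCharacter u v v (repClass (stdRep h hζ hη x)) =
    (x.2 : ℂ) ^ p * (1 + η) := by
  rw [planeCharacter_stdRep h hζ hη x hζ1 hη1 hx, coe_stdRep_right]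
  simp
  ring

theorem planeCharacter_stdRep_mul : planeCharacter u v (u * v) (repClass (stdRep h hζ hη x)) =
    (x.2 : ℂ) ^ (p + q) * (ζ + η + (x.1 : ℝ) * ((1 - ζ) * (1 - η))) := by
  rw [planeCharacter_stdRep h hζ hη x hζ1 hη1 hx, map_mul]
  change ((stdRep h hζ hη x u).1 * (stdRep h hζ hη x v).1) 0 0 +
    ((stdRep h hζ hη x u).1 * (stdRep h hζ hη x v).1) 1 1 = _
  rw [coe_stdRep_left, coe_stdRep_right]
  simp [Matrix.mul_apply, Fin.sum_univ_three]
  ring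

end planeCharacter

/-- The circle parameter, from the traces of `u` and `v` on the invariant plane. -/
noncomputable def circleParam (ζ η : Circle) (m n : ℕ) (X Y : ℂ) : ℂ :=
  (X / (1 + ζ)) ^ m * star ((Y / (1 + η)) ^ n)

/-- The interval parameter, from the circle parameter and the trace of `u * v` on the invariant
plane. -/
noncomputable def intervalParam (ζ η : Circle) (k : ℕ) (τ Z : ℂ) : ℝ :=
  ((Z * star τ ^ k - ζ - η) / ((1 - ζ) * (1 - η))).re

theorem continuous_circleParam (ζ η : Circle) (m n : ℕ) :
    Continuous fun x : ℂ × ℂ => circleParam ζ η m n x.1 x.2 := by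
  simp only [circleParam, div_eq_mul_inv]
  fun_prop

theorem continuous_intervalParam (ζ η : Circle) (k : ℕ) :
    Continuous fun x : ℂ × ℂ => intervalParam ζ η k x.1 x.2 := by
  simp only [intervalParam, div_eq_mul_inv]
  fun_prop

/-- After division by `1 + ζ` and `1 + η` the two plane traces are `τ ^ q` and `τ ^ p`; the relation
`m * q = n * p + 1` recovers `τ` using only powers and conjugation, which are continuous and smooth
everywhere. -/
theorem circleParam_eq {p q m n : ℕ} {ζ η : Circle} (hζ : 1 + (ζ : ℂ) ≠ 0) (hη : 1 + (η : ℂ) ≠ 0)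
    (hmn : m * q = n * p + 1) (τ : Circle) :
    circleParam ζ η m n ((τ : ℂ) ^ q * (1 + ζ)) ((τ : ℂ) ^ p * (1 + η)) = τ := by
  have c := Circle.mul_star_coe τ
  rw [circleParam, mul_div_cancel_right₀ _ hζ, mul_div_cancel_right₀ _ hη, ← pow_mul, mul_comm q,
    hmn, star_pow, star_pow, ← pow_mul, mul_comm p, pow_succ, mul_right_comm, ← mul_pow, c, one_pow,
    one_mul]

theorem intervalParam_eq {ζ η : Circle} (hζ1 : ζ ≠ 1) (hη1 : η ≠ 1) (k : ℕ) (τ : Circle) (s : ℝ) :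
    intervalParam ζ η k τ ((τ : ℂ) ^ k * (ζ + η + s * ((1 - ζ) * (1 - η)))) = s := by
  have c := Circle.mul_star_coe τ
  have e : (1 - (ζ : ℂ)) * (1 - (η : ℂ)) ≠ 0 := mul_ne_zero
    (sub_ne_zero.2 (Circle.coe_ne_one hζ1).symm) (sub_ne_zero.2 (Circle.coe_ne_one hη1).symm)
  rw [intervalParam, mul_right_comm, ← mul_pow, c, one_pow, one_mul,
    show (ζ : ℂ) + η + s * ((1 - ζ) * (1 - η)) - ζ - η = s * ((1 - ζ) * (1 - η)) by ring,
    mul_div_cancel_right₀ _ e, Complex.ofReal_re]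

theorem exists_bezout_nat {p q : ℕ} (hp : 0 < p) (hq : 0 < q) (h : Nat.Coprime p q) :
    ∃ m n : ℕ, m * q = n * p + 1 := by
  have h1 := gcd_coprime_eq h
  set a := Nat.gcdA p q
  set b := Nat.gcdB p q
  have hp' : (1 : ℤ) ≤ p := by exact_mod_cast hp
  have hq' : (1 : ℤ) ≤ q := by exact_mod_cast hq
  -- Adding the same multiple of `p * q` to both products keeps the Bezout relation and makes the
  -- coefficients nonnegative.
  refine ⟨(b + |b| * p + |a| * p).toNat, (-a + |b| * q + |a| * q).toNat, ?_⟩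
  have e1 : 0 ≤ b + |b| * p + |a| * p := by
    nlinarith [neg_abs_le b, abs_nonneg b, abs_nonneg a]
  have e2 : 0 ≤ -a + |b| * q + |a| * q := by
    nlinarith [le_abs_self a, abs_nonneg b, abs_nonneg a]
  zify
  rw [Int.toNat_of_nonneg e1, Int.toNat_of_nonneg e2]
  linear_combination h1

end invariants

/-! ### The stratum as a disjoint union of cylinders -/

section parametrization
variable {G : Type} [Group G] {p q : ℕ} {u v : G}

/-- The index set of the components of the reducible stratum. -/
abbrev ComponentIndex (p q : ℕ) : Type := Fin ((p - 1) / 2) × Fin ((q - 1) / 2)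

/-- The class of a standard representation. -/
noncomputable def stdClass (h : IsTorusKnotGroup p q u v) (j : ComponentIndex p q)
    (x : unitInterval × Circle) : RepVariety G :=
  repClass (stdRep h (halfRoot_pow j.1) (halfRoot_pow j.2) x)

theorem continuous_stdClass (h : IsTorusKnotGroup p q u v) (j : ComponentIndex p q) :
    Continuous (stdClass h j) :=
  continuous_repClass.comp (continuous_stdRep ..)

/-- A point of the open interval as a point of the closed interval. -/
def openToUnit (s : openUnitInterval) : unitInterval := ⟨s.1, Ioo_subset_Icc_self s.2⟩

theorem continuous_openToUnit : Continuous openToUnit :=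
  Continuous.subtype_mk continuous_subtype_val _

theorem stdClass_mem_redStratum (h : IsTorusKnotGroup p q u v) (j : ComponentIndex p q)
    (s : openUnitInterval) (τ : Circle) : stdClass h j (openToUnit s, τ) ∈ redStratum G :=
  ⟨_, rfl, isReducible_of_mem_planeSubgroup (stdRep_mem_planeSubgroup h _ _ _), fun hab =>
    ((stdRep_isAbelian_iff h _ _ _ (halfRoot_ne_one _) (halfRoot_ne_one _)).1 hab).elim
      s.2.1.ne' s.2.2.ne⟩

/-- The parametrization of the reducible stratum. -/
noncomputable def stratumParam (h : IsTorusKnotGroup p q u v)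
    (x : ComponentIndex p q × openUnitInterval × Circle) : redStratum G :=
  ⟨stdClass h x.1 (openToUnit x.2.1, x.2.2), stdClass_mem_redStratum h _ _ _⟩

variable (h : IsTorusKnotGroup p q u v)

theorem coe_stratumParam (x : ComponentIndex p q × openUnitInterval × Circle) :
    (stratumParam h x).1 =
      repClass (stdRep h (halfRoot_pow x.1.1) (halfRoot_pow x.1.2) (openToUnit x.2.1, x.2.2)) := rfl

theorem continuous_stratumParam : Continuous (stratumParam h) := by
  refine Continuous.subtype_mk (continuous_prod_of_discrete_left.2 fun j => ?_) _
  exact (continuous_stdClass h j).comp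
    ((continuous_openToUnit.comp continuous_fst).prodMk continuous_snd)

section odd
variable (hp : Odd p) (hq : Odd q) (hpq : Nat.Coprime p q)
include hp hq hpq

theorem stratumParam_surjective : Function.Surjective (stratumParam h) := by
  rintro ⟨c, ρ, rfl, hr, ha⟩
  obtain ⟨a, b, ⟨s, τ⟩, hx⟩ := exists_repClass_stdRep h hp hq hpq hr ha
  have hs := (stdRep_isAbelian_iff h (halfRoot_pow a) (halfRoot_pow b) (s, τ) (halfRoot_ne_one _)
    (halfRoot_ne_one _)).not.1 fun h' => ha (isAbelian_congr hx h')
  push Not at hs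
  exact ⟨((a, b), ⟨s, lt_of_le_of_ne s.2.1 hs.1.symm, lt_of_le_of_ne s.2.2 hs.2⟩, τ),
    Subtype.ext hx⟩

omit hp hq hpq in
theorem norm_planeCharacter_stratumParam (x : ComponentIndex p q × openUnitInterval × Circle) :
    ‖planeCharacter u v u (stratumParam h x).1‖ = ‖1 + (halfRoot p x.1.1 : ℂ)‖ ∧
    ‖planeCharacter u v v (stratumParam h x).1‖ = ‖1 + (halfRoot q x.1.2 : ℂ)‖ := by
  have hx : (((openToUnit x.2.1, x.2.2) : unitInterval × Circle).1 : ℝ) ∈ Ioo (0 : ℝ) 1 := x.2.1.2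
  constructor
  · rw [coe_stratumParam, planeCharacter_stdRep_left h _ _ _ (halfRoot_ne_one _)
      (halfRoot_ne_one _) hx, norm_mul, norm_pow, Circle.norm_coe, one_pow, one_mul]
  · rw [coe_stratumParam, planeCharacter_stdRep_right h _ _ _ (halfRoot_ne_one _)
      (halfRoot_ne_one _) hx, norm_mul, norm_pow, Circle.norm_coe, one_pow, one_mul]

omit hpq in
theorem circleParam_stratumParam {m n : ℕ} (hmn : m * q = n * p + 1)
    (x : ComponentIndex p q × openUnitInterval × Circle) :
    circleParam (halfRoot p x.1.1) (halfRoot q x.1.2) m n (planeCharacter u v u (stratumParam h x).1)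
      (planeCharacter u v v (stratumParam h x).1) = x.2.2 := by
  have hx : (((openToUnit x.2.1, x.2.2) : unitInterval × Circle).1 : ℝ) ∈ Ioo (0 : ℝ) 1 := x.2.1.2
  rw [coe_stratumParam, planeCharacter_stdRep_left h _ _ _ (halfRoot_ne_one _)
    (halfRoot_ne_one _) hx, planeCharacter_stdRep_right h _ _ _ (halfRoot_ne_one _)
    (halfRoot_ne_one _) hx]
  exact circleParam_eq (one_add_ne_zero_of_odd_pow hp (halfRoot_pow _))
    (one_add_ne_zero_of_odd_pow hq (halfRoot_pow _)) hmn _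

omit hp hq hpq in
theorem intervalParam_stratumParam (x : ComponentIndex p q × openUnitInterval × Circle) :
    intervalParam (halfRoot p x.1.1) (halfRoot q x.1.2) (p + q) x.2.2
      (planeCharacter u v (u * v) (stratumParam h x).1) = x.2.1 := by
  have hx : (((openToUnit x.2.1, x.2.2) : unitInterval × Circle).1 : ℝ) ∈ Ioo (0 : ℝ) 1 := x.2.1.2
  rw [coe_stratumParam, planeCharacter_stdRep_mul h _ _ _ (halfRoot_ne_one _)
    (halfRoot_ne_one _) hx]
  exact intervalParam_eq (halfRoot_ne_one _) (halfRoot_ne_one _) _ _ _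

/-- The norms of the plane traces of `u` and `v` give the component, then their values give the
circle parameter, and the plane trace of `u * v` gives the interval parameter. -/
theorem stratumParam_injective : Function.Injective (stratumParam h) := by
  intro x y hxy
  obtain ⟨m, n, hmn⟩ := exists_bezout_nat hp.pos hq.pos hpq
  have n1 := norm_planeCharacter_stratumParam h x
  have n2 := norm_planeCharacter_stratumParam h y
  have c1 := circleParam_stratumParam h hp hq hmn x
  have c2 := circleParam_stratumParam h hp hq hmn y
  have s1 := intervalParam_stratumParam h x
  have s2 := intervalParam_stratumParam h y
  rw [hxy] at n1 c1 s1
  have j1 := norm_one_add_halfRoot_injective p (n1.1.symm.trans n2.1)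
  have j2 := norm_one_add_halfRoot_injective q (n1.2.symm.trans n2.2)
  have t : x.2.2 = y.2.2 := Circle.ext (by rw [← c1, ← c2, j1, j2])
  exact Prod.ext (Prod.ext j1 j2) (Prod.ext (Subtype.ext (by rw [← s1, ← s2, j1, j2, t])) t)

omit hp hq hpq in
theorem continuous_planeCharacter_redStratum {E : redStratum G → ComponentIndex p q × openUnitInterval × Circle}
    (hE : ∀ c, stratumParam h (E c) = c) (w : G) :
    Continuous fun c : redStratum G => planeCharacter u v w c := by
  refine continuous_iff_continuousAt.2 fun c => ContinuousAt.comp (f := Subtype.val)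
    (continuousAt_planeCharacter u v w ?_) continuous_subtype_val.continuousAt
  rw [← hE c]
  exact character_commutator_ne h _ _ _ (halfRoot_ne_one _) (halfRoot_ne_one _) (E c).2.1.2

omit hp hq hpq in
-- The finite index set embeds in `ℝ` through the norms of plane traces, which are continuous on the
-- stratum.
theorem continuous_index_of_rightInverse {E : redStratum G → ComponentIndex p q × openUnitInterval × Circle}
    (hE : ∀ c, stratumParam h (E c) = c) : Continuous fun c => (E c).1 := by
  have emb (k : ℕ) : IsInducing fun a : Fin ((k - 1) / 2) => ‖1 + (halfRoot k a : ℂ)‖ :=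
    (continuous_of_discreteTopology.isClosedEmbedding
      (norm_one_add_halfRoot_injective k)).isInducing
  have hc := continuous_planeCharacter_redStratum h hE
  refine Continuous.prodMk ((emb p).continuous_iff.2 ((hc u).norm.congr fun c => ?_))
    ((emb q).continuous_iff.2 ((hc v).norm.congr fun c => ?_))
  · have := (norm_planeCharacter_stratumParam h (E c)).1
    rwa [hE] at this
  · have := (norm_planeCharacter_stratumParam h (E c)).2
    rwa [hE] at this

theorem continuous_circle_of_rightInverse {E : redStratum G → ComponentIndex p q × openUnitInterval × Circle}
    (hE : ∀ c, stratumParam h (E c) = c) : Continuous fun c => (E c).2.2 := by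
  have hc := continuous_planeCharacter_redStratum h hE
  have hj := continuous_index_of_rightInverse h hE
  obtain ⟨m, n, hmn⟩ := exists_bezout_nat hp.pos hq.pos hpq
  have hf : Continuous fun x : ComponentIndex p q × ℂ × ℂ =>
      circleParam (halfRoot p x.1.1) (halfRoot q x.1.2) m n x.2.1 x.2.2 :=
    continuous_prod_of_discrete_left.2 fun j =>
      continuous_circleParam (halfRoot p j.1) (halfRoot q j.2) m n
  have key : Continuous fun c => ((E c).2.2 : ℂ) := by
    have := hf.comp (hj.prodMk ((hc u).prodMk (hc v)))
    refine this.congr fun c => ?_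
    have := circleParam_stratumParam h hp hq hmn (E c)
    rwa [hE] at this
  exact continuous_induced_rng.2 key

theorem continuous_interval_of_rightInverse {E : redStratum G → ComponentIndex p q × openUnitInterval × Circle}
    (hE : ∀ c, stratumParam h (E c) = c) : Continuous fun c => (E c).2.1 := by
  have hc := continuous_planeCharacter_redStratum h hE
  have hj := continuous_index_of_rightInverse h hE
  have ht := continuous_circle_of_rightInverse h hp hq hpq hE
  have hf : Continuous fun x : ComponentIndex p q × ℂ × ℂ =>
      intervalParam (halfRoot p x.1.1) (halfRoot q x.1.2) (p + q) x.2.1 x.2.2 :=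
    continuous_prod_of_discrete_left.2 fun j =>
      continuous_intervalParam (halfRoot p j.1) (halfRoot q j.2) (p + q)
  have key : Continuous fun c => ((E c).2.1 : ℝ) := by
    have := hf.comp (hj.prodMk ((Continuous.comp (g := fun z : Circle => (z : ℂ)) (by fun_prop) ht).prodMk (hc (u * v))))
    refine this.congr fun c => ?_
    have := intervalParam_stratumParam h (E c)
    rwa [hE] at this
  exact continuous_induced_rng.2 key

/-- The reducible stratum is a disjoint union of open cylinders. -/
noncomputable def stratumHomeomorph :
    ComponentIndex p q × openUnitInterval × Circle ≃ₜ redStratum G where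
  toEquiv := Equiv.ofBijective (stratumParam h)
    ⟨stratumParam_injective h hp hq hpq, stratumParam_surjective h hp hq hpq⟩
  continuous_toFun := continuous_stratumParam h
  continuous_invFun := by
    have hE := (Equiv.ofBijective (stratumParam h)
      ⟨stratumParam_injective h hp hq hpq, stratumParam_surjective h hp hq hpq⟩).apply_symm_apply
    exact (continuous_index_of_rightInverse h hE).prodMk
      ((continuous_interval_of_rightInverse h hp hq hpq hE).prodMk
        (continuous_circle_of_rightInverse h hp hq hpq hE))

theorem stratumHomeomorph_apply (x : ComponentIndex p q × openUnitInterval × Circle) :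
    stratumHomeomorph h hp hq hpq x = stratumParam h x := rfl

end odd

end parametrization

/-! ### A single plane chart from concentric annuli -/

section cylinders

/-- The direction of a complex number. -/
noncomputable def unitPart (z : ℂ) : Circle := Circle.exp z.arg

theorem coe_unitPart {z : ℂ} (h : z ≠ 0) : (unitPart z : ℂ) = z / ‖z‖ := by
  rw [eq_div_iff (by exact_mod_cast norm_ne_zero_iff.2 h), unitPart, Circle.coe_exp, mul_comm,
    Complex.norm_mul_exp_arg_mul_I]

theorem isInducing_circle_coe : IsInducing ((↑) : Circle → ℂ) := ⟨rfl⟩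

theorem continuousAt_unitPart {z : ℂ} (h : z ≠ 0) : ContinuousAt unitPart z := by
  refine isInducing_circle_coe.continuousAt_iff.2 ?_
  have h1 : ContinuousAt (fun w : ℂ => w / ‖w‖) z :=
    continuousAt_id.div (by fun_prop) (by exact_mod_cast norm_ne_zero_iff.2 h)
  refine h1.congr ?_
  filter_upwards [isOpen_ne.mem_nhds h] with w hw
  exact (coe_unitPart hw).symm

/-- Truncation of a real number to the open unit interval. -/
noncomputable def openClamp (r : ℝ) : openUnitInterval :=
  if h : r ∈ Ioo (0 : ℝ) 1 then ⟨r, h⟩ else ⟨1 / 2, by constructor <;> norm_num⟩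

theorem coe_openClamp {r : ℝ} (h : r ∈ Ioo (0 : ℝ) 1) : (openClamp r : ℝ) = r := by
  rw [openClamp, dif_pos h]

theorem continuousAt_openClamp {r : ℝ} (h : r ∈ Ioo (0 : ℝ) 1) : ContinuousAt openClamp r := by
  refine IsInducing.subtypeVal.continuousAt_iff.2 (continuousAt_id.congr ?_)
  filter_upwards [isOpen_Ioo.mem_nhds h] with t ht
  exact (coe_openClamp ht).symm

variable {J : Type*} (N : J → ℕ)

/-- Open cylinders as concentric annuli in the plane. -/
noncomputable def annulusMap (x : J × openUnitInterval × Circle) : ℂ :=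
  ((1 + N x.1 + x.2.1 : ℝ) : ℂ) * x.2.2

theorem norm_annulusMap (x : J × openUnitInterval × Circle) :
    ‖annulusMap N x‖ = 1 + N x.1 + x.2.1 := by
  have := x.2.1.2.1
  rw [annulusMap, norm_mul, Circle.norm_coe, mul_one, Complex.norm_of_nonneg (by positivity)]

theorem annulusMap_ne_zero (x : J × openUnitInterval × Circle) : annulusMap N x ≠ 0 := by
  have := x.2.1.2.1
  rw [← norm_ne_zero_iff, norm_annulusMap]
  positivity

theorem annulusMap_div_norm (x : J × openUnitInterval × Circle) :
    annulusMap N x / ‖annulusMap N x‖ = x.2.2 := by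
  have h := norm_ne_zero_iff.2 (annulusMap_ne_zero N x)
  rw [norm_annulusMap] at h ⊢
  rw [annulusMap, mul_div_cancel_left₀ _ (by exact_mod_cast h)]

/-- The inverse of `annulusMap` near the annulus with index `j`. -/
noncomputable def annulusInv (j : J) (z : ℂ) : openUnitInterval × Circle :=
  (openClamp (‖z‖ - 1 - N j), unitPart z)

theorem eventually_annulus (x : J × openUnitInterval × Circle) :
    ∀ᶠ z in 𝓝 (annulusMap N x), z ≠ 0 ∧ ‖z‖ - 1 - N x.1 ∈ Ioo (0 : ℝ) 1 := by
  refine (isOpen_ne.eventually_mem (annulusMap_ne_zero N x)).and ?_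
  have h : ContinuousAt (fun z : ℂ => ‖z‖ - 1 - N x.1) (annulusMap N x) := by fun_prop
  refine h (isOpen_Ioo.mem_nhds ?_)
  change ‖annulusMap N x‖ - 1 - N x.1 ∈ Ioo (0 : ℝ) 1
  rw [norm_annulusMap, show 1 + (N x.1 : ℝ) + x.2.1 - 1 - N x.1 = x.2.1 by ring]
  exact x.2.1.2

theorem annulusMap_annulusInv {j : J} {z : ℂ} (h0 : z ≠ 0) (h : ‖z‖ - 1 - N j ∈ Ioo (0 : ℝ) 1) :
    annulusMap N (j, annulusInv N j z) = z := by
  rw [annulusMap, annulusInv, coe_openClamp h, coe_unitPart h0,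
    show 1 + (N j : ℝ) + (‖z‖ - 1 - N j) = ‖z‖ by ring,
    mul_div_cancel₀ _ (by exact_mod_cast norm_ne_zero_iff.2 h0)]

theorem annulusInv_annulusMap (x : J × openUnitInterval × Circle) :
    annulusInv N x.1 (annulusMap N x) = x.2 := by
  refine Prod.ext (Subtype.ext ?_) (Circle.ext ?_)
  · have := (eventually_annulus N x).self_of_nhds.2
    rw [annulusInv, coe_openClamp this, norm_annulusMap]
    ring
  · rw [annulusInv, coe_unitPart (annulusMap_ne_zero N x), annulusMap_div_norm]

theorem continuousAt_annulusInv (x : J × openUnitInterval × Circle) :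
    ContinuousAt (annulusInv N x.1) (annulusMap N x) := by
  obtain ⟨h0, h⟩ := (eventually_annulus N x).self_of_nhds
  refine ContinuousAt.prodMk ?_ (continuousAt_unitPart h0)
  exact ContinuousAt.comp (f := fun z : ℂ => ‖z‖ - 1 - N x.1) (continuousAt_openClamp h)
    (by fun_prop)

theorem annulusMap_injective (hN : Function.Injective N) : Function.Injective (annulusMap N) := by
  intro x y h
  have hn : x.1 = y.1 := by
    have h1 := congrArg norm h
    rw [norm_annulusMap, norm_annulusMap] at h1
    have hx := x.2.1.2
    have hy := y.2.1.2
    refine hN ?_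
    have a : (N x.1 : ℝ) < N y.1 + 1 := by linarith [hx.1, hy.2]
    have b : (N y.1 : ℝ) < N x.1 + 1 := by linarith [hx.2, hy.1]
    have a' : N x.1 < N y.1 + 1 := by exact_mod_cast a
    have b' : N y.1 < N x.1 + 1 := by exact_mod_cast b
    omega
  refine Prod.ext hn ?_
  rw [← annulusInv_annulusMap N x, ← annulusInv_annulusMap N y, hn, h]

/-- The annulus with index `j` has radii between `1 + N j` and `2 + N j`, so distinct indices give
disjoint annuli. This places the whole stratum in one chart, making compatibility of charts
automatic. -/
theorem isOpenEmbedding_annulusMap [TopologicalSpace J] [DiscreteTopology J]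
    (hN : Function.Injective N) : IsOpenEmbedding (annulusMap N) := by
  refine .of_continuous_injective_isOpenMap ?_ (annulusMap_injective N hN)
    (isOpenMap_iff_nhds_le.2 fun x => ?_)
  · refine continuous_prod_of_discrete_left.2 fun j => ?_
    unfold annulusMap
    have h1 : Continuous fun x : openUnitInterval × Circle => (x.1 : ℝ) :=
      continuous_subtype_val.comp continuous_fst
    have h2 : Continuous fun x : openUnitInterval × Circle => (x.2 : ℂ) := by fun_prop
    exact (Complex.continuous_ofReal.comp
      ((continuous_const (y := 1 + (N j : ℝ))).add h1)).mul h2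
  · have h1 : Tendsto (fun z => (x.1, annulusInv N x.1 z)) (𝓝 (annulusMap N x)) (𝓝 x) := by
      have := (continuousAt_const (y := x.1)).prodMk (continuousAt_annulusInv N x)
      rwa [ContinuousAt, annulusInv_annulusMap] at this
    have h2 := map_mono (m := annulusMap N) h1
    rw [map_map] at h2
    refine le_trans (le_of_eq ?_) h2
    refine Filter.map_id.symm.trans (Filter.map_congr ?_)
    filter_upwards [eventually_annulus N x] with z hz
    exact (annulusMap_annulusInv N hz.1 hz.2).symm

/-- The plane as a Euclidean space. -/
noncomputable abbrev planeIsometry : ℂ ≃ₗᵢ[ℝ] EuclideanSpace ℝ (Fin 2) :=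
  Complex.orthonormalBasisOneI.repr

section chart
variable {S : Type*} [TopologicalSpace S] {κ : S → ℂ} (hκ : IsOpenEmbedding κ)

theorem isOpenEmbedding_planeIsometry_comp (hκ : IsOpenEmbedding κ) :
    IsOpenEmbedding (planeIsometry ∘ κ) :=
  planeIsometry.toHomeomorph.isOpenEmbedding.comp hκ

variable [Nonempty S]

/-- The charted space structure given by an open embedding in the plane. -/
@[reducible] noncomputable def planeChartedSpace (hκ : IsOpenEmbedding κ) :
    ChartedSpace (EuclideanSpace ℝ (Fin 2)) S :=
  (isOpenEmbedding_planeIsometry_comp hκ).singletonChartedSpace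

theorem isManifold_planeChartedSpace (hκ : IsOpenEmbedding κ) :
    letI := planeChartedSpace hκ
    IsManifold (𝓡 2) ∞ S :=
  (isOpenEmbedding_planeIsometry_comp hκ).isManifold_singleton

theorem contMDiff_planeEmbedding (hκ : IsOpenEmbedding κ) :
    letI := planeChartedSpace hκ
    ContMDiff (𝓡 2) 𝓘(ℝ, ℂ) ∞ κ := by
  let _ := planeChartedSpace hκ
  have h1 : ContMDiff (𝓡 2) (𝓡 2) ∞ (planeIsometry ∘ κ) :=
    contMDiff_isOpenEmbedding (I := 𝓡 2) (isOpenEmbedding_planeIsometry_comp hκ)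
  have h2 := (planeIsometry.symm.contDiff (n := ∞)).contMDiff.comp h1
  refine h2.congr fun c => ?_
  simp

/-- With a single chart, smoothness on the manifold is ordinary smoothness on the image in the
plane. -/
theorem contMDiffOn_planeChartedSpace_iff (hκ : IsOpenEmbedding κ) (U : Set S) (f : S → ℝ) :
    letI := planeChartedSpace hκ
    ContMDiffOn (𝓡 2) 𝓘(ℝ, ℝ) ∞ f U ↔ ContDiffOn ℝ ∞ (f ∘ Function.invFun κ) (κ '' U) := by
  let _ := planeChartedSpace hκ
  have hinv (c : S) : Function.invFun κ (κ c) = c := Function.leftInverse_invFun hκ.injective c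
  constructor
  · intro hf
    have h1 := contMDiffOn_isOpenEmbedding_symm (I := 𝓡 2) (n := ∞)
      (isOpenEmbedding_planeIsometry_comp hκ)
    have hs (c : S) : (IsOpenEmbedding.toOpenPartialHomeomorph (planeIsometry ∘ κ)
        (isOpenEmbedding_planeIsometry_comp hκ)).symm (planeIsometry (κ c)) = c :=
      IsOpenEmbedding.toOpenPartialHomeomorph_left_inv _ (isOpenEmbedding_planeIsometry_comp hκ)
    have h2 := hf.comp (h1.mono (image_subset_range (planeIsometry ∘ κ) U)) (by
      rintro _ ⟨c, hc, rfl⟩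
      rw [mem_preimage]
      simp only [Function.comp_apply]
      rwa [hs])
    have h3 := (contMDiffOn_iff_contDiffOn.1 h2).comp (planeIsometry.contDiff (n := ∞)).contDiffOn
      (s := κ '' U) (by
        rintro _ ⟨c, hc, rfl⟩
        exact ⟨c, hc, rfl⟩)
    refine h3.congr ?_
    rintro _ ⟨c, hc, rfl⟩
    simp only [Function.comp_apply]
    rw [hs, hinv]
  · intro hf
    have h1 := hf.contMDiffOn.comp (contMDiff_planeEmbedding hκ).contMDiffOn (s := U)
      (fun c hc => mem_image_of_mem κ hc)
    refine h1.congr fun c _ => ?_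
    simp [hinv]

theorem contMDiff_of_planeEmbedding_comp (hκ : IsOpenEmbedding κ) {E H M : Type*}
    [NormedAddCommGroup E] [NormedSpace ℝ E] [TopologicalSpace H] {I : ModelWithCorners ℝ E H}
    [TopologicalSpace M] [ChartedSpace H M] {f : M → S} (hf : ContMDiff I 𝓘(ℝ, ℂ) ∞ (κ ∘ f)) :
    letI := planeChartedSpace hκ
    ContMDiff I (𝓡 2) ∞ f := by
  let _ := planeChartedSpace hκ
  refine ContMDiff.of_comp_isOpenEmbedding (I' := 𝓡 2) (isOpenEmbedding_planeIsometry_comp hκ) ?_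
  exact (planeIsometry.contDiff (n := ∞)).contMDiff.comp hf

end chart

section cylinder
variable {S : Type*} [TopologicalSpace S] [TopologicalSpace J] [DiscreteTopology J]
  {N : J → ℕ}

theorem isOpenEmbedding_annulusMap_symm (hN : Function.Injective N)
    (e : J × openUnitInterval × Circle ≃ₜ S) : IsOpenEmbedding (annulusMap N ∘ e.symm) :=
  (isOpenEmbedding_annulusMap N hN).comp e.symm.isOpenEmbedding

/-- The component with index `j`. -/
def cylinderOpens (e : J × openUnitInterval × Circle ≃ₜ S) (j : J) : Opens S :=
  ⟨{c | (e.symm c).1 = j}, (isOpen_discrete {j}).preimage (continuous_fst.comp e.symm.continuous)⟩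

variable [Nonempty S]

attribute [local instance] finrank_real_complex_fact'

/-- A component is diffeomorphic to a cylinder. -/
noncomputable def cylinderDiffeomorph (hN : Function.Injective N)
    (e : J × openUnitInterval × Circle ≃ₜ S) (j : J) :
    letI := planeChartedSpace (isOpenEmbedding_annulusMap_symm hN e)
    Diffeomorph (𝓘(ℝ, ℝ).prod (𝓡 1)) (𝓡 2) (openUnitInterval × Circle) (cylinderOpens e j) ∞ :=
  letI := planeChartedSpace (isOpenEmbedding_annulusMap_symm hN e)
  { toFun := fun x => ⟨e (j, x), congrArg Prod.fst (e.symm_apply_apply (j, x))⟩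
    invFun := fun c => (e.symm c).2
    left_inv := fun x => by simp
    right_inv := fun c => Subtype.ext (by
      have : (e.symm c).1 = j := c.2
      have h2 : (j, (e.symm c).2) = e.symm c := Prod.ext this.symm rfl
      exact (congrArg e h2).trans (e.apply_symm_apply c))
    contMDiff_toFun := by
      rw [← ContMDiff.subtypeVal_comp_iff]
      refine contMDiff_of_planeEmbedding_comp (isOpenEmbedding_annulusMap_symm hN e) ?_
      have h1 : ContMDiff (𝓘(ℝ, ℝ).prod (𝓡 1)) 𝓘(ℝ, ℝ) ∞
          fun x : openUnitInterval × Circle => (x.1 : ℝ) :=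
        contMDiff_subtype_val.comp contMDiff_fst
      have h2 : ContMDiff (𝓘(ℝ, ℝ).prod (𝓡 1)) 𝓘(ℝ, ℂ) ∞
          fun x : openUnitInterval × Circle => (x.2 : ℂ) :=
        contMDiff_coe_sphere.comp contMDiff_snd
      have h3 : ContDiff ℝ ∞ fun x : ℝ × ℂ => ((1 + N j + x.1 : ℝ) : ℂ) * x.2 :=
        (Complex.ofRealCLM.contDiff.comp (contDiff_const.add contDiff_fst)).mul contDiff_snd
      have h4 := h3.contMDiff.comp (h1.prodMk_space h2)
      refine h4.congr fun x => ?_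
      simp [annulusMap]
    contMDiff_invFun := by
      have := isManifold_planeChartedSpace (isOpenEmbedding_annulusMap_symm hN e)
      have hκ : ContMDiff (𝓡 2) 𝓘(ℝ, ℂ) ∞ fun c : cylinderOpens e j => annulusMap N (e.symm c) :=
        (contMDiff_planeEmbedding (isOpenEmbedding_annulusMap_symm hN e)).comp contMDiff_subtype_val
      have hn : ContMDiff (𝓡 2) 𝓘(ℝ, ℝ) ∞ fun c : cylinderOpens e j => ‖annulusMap N (e.symm c)‖ :=
        fun c => (contDiffAt_norm ℝ (annulusMap_ne_zero N (e.symm c))).contMDiffAt.comp c (hκ c)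
      refine ContMDiff.prodMk ?_ ?_
      · rw [← ContMDiff.subtypeVal_comp_iff]
        have h1 : ContDiff ℝ ∞ fun r : ℝ => r - 1 - N j := by fun_prop
        refine (h1.contMDiff.comp hn).congr fun c => ?_
        have : (e.symm c).1 = j := c.2
        simp only [Function.comp_apply]
        rw [norm_annulusMap, this]
        ring
      · refine ContMDiff.codRestrict_sphere (f := fun c : cylinderOpens e j => ((e.symm c).2.2 : ℂ))
          ?_ _
        have h1 (z : ℂ) (hz : z ≠ 0) : ContDiffAt ℝ ∞ (fun z : ℂ => z / (‖z‖ : ℂ)) z := by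
          have h2 : ContDiffAt ℝ ∞ (fun z : ℂ => (‖z‖ : ℂ)) z :=
            Complex.ofRealCLM.contDiff.contDiffAt.comp z (contDiffAt_norm ℝ hz)
          have h3 : (‖z‖ : ℂ) ≠ 0 := by exact_mod_cast norm_ne_zero_iff.2 hz
          simp only [div_eq_mul_inv]
          exact contDiffAt_id.mul (h2.inv h3)
        intro c
        refine ContMDiffAt.congr_of_eventuallyEq
          ((h1 _ (annulusMap_ne_zero N (e.symm c))).contMDiffAt.comp c (hκ c))
          (Eventually.of_forall fun d => (annulusMap_div_norm N (e.symm d)).symm) }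

end cylinder
end cylinders

/-! ### The inherited smooth structure -/

/-- Multiplication by a bump function extends a local function. It is needed because
`StratumSmoothAt` asks for a function smooth on the whole space of matrix entries, whereas the trace
formulas have denominators. -/
theorem exists_contDiff_eventuallyEq {E : Type*} [NormedAddCommGroup E] [NormedSpace ℝ E]
    [FiniteDimensional ℝ E] {f : E → ℝ} {V : Set E} (hV : IsOpen V) (hf : ContDiffOn ℝ ∞ f V) {x : E}
    (hx : x ∈ V) : ∃ F : E → ℝ, ContDiff ℝ ∞ F ∧ F =ᶠ[𝓝 x] f := by
  obtain ⟨ε, hε, hb⟩ := Metric.isOpen_iff.1 hV x hx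
  let φ : ContDiffBump x := ⟨ε / 4, ε / 2, by positivity, by linarith⟩
  refine ⟨fun y => φ y * f y, ?_, ?_⟩
  · rw [contDiff_iff_contDiffAt]
    intro y
    by_cases hy : y ∈ V
    · exact φ.contDiff.contDiffAt.mul ((hf y hy).contDiffAt (hV.mem_nhds hy))
    · have : y ∉ tsupport φ := by
        rw [φ.tsupport_eq]
        intro h
        exact hy (hb (Metric.closedBall_subset_ball (by change ε / 2 < ε; linarith) h))
      refine (contDiffAt_const (c := (0 : ℝ))).congr_of_eventuallyEq ?_
      filter_upwards [(isClosed_tsupport φ).isOpen_compl.mem_nhds this] with z hz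
      rw [image_eq_zero_of_notMem_tsupport hz, zero_mul]
  · filter_upwards [φ.eventuallyEq_one] with y hy
    rw [hy]
    simp

section smooth
variable {G : Type} [Group G] {p q : ℕ} {u v : G}

/-- The square roots are separate hypotheses so that the lemma applies both inside the cylinder,
where they are smooth, and on the boundary circles, where `s` is constant. -/
theorem contDiffAt_stdRep (h : IsTorusKnotGroup p q u v) {ζ η : Circle} (hζ : ζ ^ p = 1)
    (hη : η ^ q = 1) {E : Type*} [NormedAddCommGroup E] [NormedSpace ℝ E] {s : E → unitInterval}
    {τ : E → Circle} {x : E} (hs : ContDiffAt ℝ ∞ (fun t => (s t : ℝ)) x)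
    (hs0 : ContDiffAt ℝ ∞ (fun t => √(s t : ℝ)) x) (hs1 : ContDiffAt ℝ ∞ (fun t => √(1 - s t : ℝ)) x)
    (hτ : ContDiffAt ℝ ∞ (fun t => (τ t : ℂ)) x) (g : G) (i j : Fin 3) :
    ContDiffAt ℝ ∞ (fun t => (stdRep h hζ hη (s t, τ t) g).1 i j) x := by
  have R {f : E → ℝ} (hf : ContDiffAt ℝ ∞ f x) : ContDiffAt ℝ ∞ (fun t => (f t : ℂ)) x :=
    Complex.ofRealCLM.contDiff.contDiffAt.comp x hf
  have C {f : E → ℂ} (hf : ContDiffAt ℝ ∞ f x) : ContDiffAt ℝ ∞ (fun t => star (f t)) x :=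
    Complex.conjCLE.contDiff.contDiffAt.comp x hf
  have hz (n : ℕ) := hτ.pow n
  have h1 := R hs
  have off := ((hz p).mul (((R hs0).mul (R hs1)).mul (contDiffAt_const (c := 1 - (η : ℂ)))))
  refine h.contDiffAt_rep (fun i j => ?_) (fun i j => ?_) g i j
  · simp only [coe_stdRep_left]
    fin_cases i <;> fin_cases j
    · exact hz q
    · exact contDiffAt_const
    · exact contDiffAt_const
    · exact contDiffAt_const
    · exact (hz q).mul contDiffAt_const
    · exact contDiffAt_const
    · exact contDiffAt_const
    · exact contDiffAt_const
    · exact C ((hz (2 * q)).mul contDiffAt_const)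
  · simp only [coe_stdRep_right]
    fin_cases i <;> fin_cases j
    · exact (hz p).mul (h1.add ((contDiffAt_const.sub h1).mul contDiffAt_const))
    · exact off
    · exact contDiffAt_const
    · exact off
    · exact (hz p).mul ((contDiffAt_const.sub h1).add (h1.mul contDiffAt_const))
    · exact contDiffAt_const
    · exact contDiffAt_const
    · exact contDiffAt_const
    · exact C ((hz (2 * p)).mul contDiffAt_const)

/-- The words whose traces determine the class of a nonabelian reducible representation. -/
def traceWords (u v : G) : Fin 10 → G :=
  ![commutatorWord u v,
    commutatorWord u v * commutatorWord u v * u, commutatorWord u v * u, u,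
    commutatorWord u v * commutatorWord u v * v, commutatorWord u v * v, v,
    commutatorWord u v * commutatorWord u v * (u * v), commutatorWord u v * (u * v), u * v]

/-- The trace of the `i`-th matrix of a tuple. -/
def tupleTrace (i : Fin 10) (M : Fin 10 → Fin 3 → Fin 3 → ℂ) : ℂ := ∑ k, M i k k

/-- The trace on the invariant plane, from the matrix entries. -/
noncomputable def tuplePlaneTrace (i j k : Fin 10) (M : Fin 10 → Fin 3 → Fin 3 → ℂ) : ℂ :=
  planeTrace (tupleTrace 0 M) (tupleTrace i M) (tupleTrace j M) (tupleTrace k M)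

theorem contDiff_tupleTrace (i : Fin 10) : ContDiff ℝ ∞ (tupleTrace i) := by
  unfold tupleTrace
  fun_prop

theorem contDiffOn_tuplePlaneTrace (i j k : Fin 10) :
    ContDiffOn ℝ ∞ (tuplePlaneTrace i j k) {M | 3 - tupleTrace 0 M ≠ 0} := by
  have H (i : Fin 10) := (contDiff_tupleTrace i).contDiffOn (s := {M | 3 - tupleTrace 0 M ≠ 0})
  unfold tuplePlaneTrace planeTrace
  simp only [div_eq_mul_inv]
  exact (H k).sub (((((H i).sub (((H 0).sub contDiffOn_const).mul (H j))).add (H k))).mul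
    ((contDiffOn_const.sub (H 0)).inv fun M hM => hM))

/-- The circle parameter, from the matrix entries. -/
noncomputable def tupleCircle (ζ η : Circle) (m n : ℕ) (M : Fin 10 → Fin 3 → Fin 3 → ℂ) : ℂ :=
  circleParam ζ η m n (tuplePlaneTrace 1 2 3 M) (tuplePlaneTrace 4 5 6 M)

/-- The position in the plane, from the matrix entries. -/
noncomputable def tuplePosition (ζ η : Circle) (m n k l : ℕ) (M : Fin 10 → Fin 3 → Fin 3 → ℂ) : ℂ :=
  ((1 + l + intervalParam ζ η k (tupleCircle ζ η m n M) (tuplePlaneTrace 7 8 9 M) : ℝ) : ℂ) *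
    tupleCircle ζ η m n M

theorem contDiffOn_tuplePosition (ζ η : Circle) (m n k l : ℕ) :
    ContDiffOn ℝ ∞ (tuplePosition ζ η m n k l) {M | 3 - tupleTrace 0 M ≠ 0} := by
  have H := contDiffOn_tuplePlaneTrace
  have C {f : (Fin 10 → Fin 3 → Fin 3 → ℂ) → ℂ} {s} (hf : ContDiffOn ℝ ∞ f s) :
      ContDiffOn ℝ ∞ (fun t => star (f t)) s :=
    Complex.conjCLE.contDiff.comp_contDiffOn hf
  have hc : ContDiffOn ℝ ∞ (tupleCircle ζ η m n) {M | 3 - tupleTrace 0 M ≠ 0} := by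
    unfold tupleCircle circleParam
    simp only [div_eq_mul_inv]
    exact (((H 1 2 3).mul contDiffOn_const).pow m).mul
      (C (((H 4 5 6).mul contDiffOn_const).pow n))
  unfold tuplePosition intervalParam
  simp only [div_eq_mul_inv]
  refine ContDiffOn.mul (Complex.ofRealCLM.contDiff.comp_contDiffOn (contDiffOn_const.add
    (Complex.reCLM.contDiff.comp_contDiffOn (ContDiffOn.mul ?_ contDiffOn_const)))) hc
  exact (((H 7 8 9).mul ((C hc).pow k)).sub contDiffOn_const).sub contDiffOn_const

variable (h : IsTorusKnotGroup p q u v) (hp : Odd p) (hq : Odd q) (hpq : Nat.Coprime p q)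

/-- A numbering of the components. -/
noncomputable def componentNumber (j : ComponentIndex p q) : ℕ := Fintype.equivFin _ j

theorem componentNumber_injective :
    Function.Injective (componentNumber : ComponentIndex p q → ℕ) :=
  Fin.val_injective.comp (Fintype.equivFin _).injective

/-- The reducible stratum as a union of concentric annuli. -/
noncomputable def stratumEmbedding : redStratum G → ℂ :=
  annulusMap componentNumber ∘ (stratumHomeomorph h hp hq hpq).symm

theorem isOpenEmbedding_stratumEmbedding : IsOpenEmbedding (stratumEmbedding h hp hq hpq) :=
  isOpenEmbedding_annulusMap_symm componentNumber_injective _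

/-- Traces are conjugation invariant, so the formula for the chart holds at every representative of
the class and not only at the standard one. -/
theorem tuplePosition_eq {m n : ℕ} (hmn : m * q = n * p + 1) (σ : SU3Hom G) (c : redStratum G)
    (hσ : repClass σ = c) :
    tuplePosition (halfRoot p ((stratumHomeomorph h hp hq hpq).symm c).1.1)
      (halfRoot q ((stratumHomeomorph h hp hq hpq).symm c).1.2) m n (p + q)
      (componentNumber ((stratumHomeomorph h hp hq hpq).symm c).1)
      (fun i j k => (σ (traceWords u v i)).1 j k) = stratumEmbedding h hp hq hpq c ∧
    3 - tupleTrace 0 (fun i j k => (σ (traceWords u v i)).1 j k) ≠ 0 := by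
  obtain ⟨x, rfl⟩ := (stratumHomeomorph h hp hq hpq).surjective c
  rw [stratumEmbedding, Function.comp_apply, Homeomorph.symm_apply_apply]
  rw [stratumHomeomorph_apply] at hσ
  have e1 : tuplePlaneTrace 1 2 3 (fun i j k => (σ (traceWords u v i)).1 j k) =
    planeCharacter u v u (stratumParam h x).1 := by rw [← hσ]; rfl
  have e2 : tuplePlaneTrace 4 5 6 (fun i j k => (σ (traceWords u v i)).1 j k) =
    planeCharacter u v v (stratumParam h x).1 := by rw [← hσ]; rfl
  have e3 : tuplePlaneTrace 7 8 9 (fun i j k => (σ (traceWords u v i)).1 j k) =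
    planeCharacter u v (u * v) (stratumParam h x).1 := by rw [← hσ]; rfl
  have e0 : tupleTrace 0 (fun i j k => (σ (traceWords u v i)).1 j k) =
    character (commutatorWord u v) (stratumParam h x).1 := by rw [← hσ]; rfl
  constructor
  · rw [tuplePosition, tupleCircle, e1, e2, e3, circleParam_stratumParam h hp hq hmn,
      intervalParam_stratumParam, annulusMap]
  · rw [e0]
    exact character_commutator_ne h _ _ _ (halfRoot_ne_one _) (halfRoot_ne_one _) x.2.1.2

theorem invFun_stratumEmbedding [Nonempty (redStratum G)] (c : redStratum G) :
    Function.invFun (stratumEmbedding h hp hq hpq) (stratumEmbedding h hp hq hpq c) = c :=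
  Function.leftInverse_invFun (isOpenEmbedding_stratumEmbedding h hp hq hpq).injective c

/-- The chart is a smooth function of the entries of ten words, so a function smooth in the chart is
smooth on the stratum. Conversely, the standard representations form a smooth local section over the
chart, along which an inherited smooth function becomes smooth. -/
theorem contDiffOn_stratumEmbedding_iff [Nonempty (redStratum G)] (U : Opens (redStratum G))
    (f : redStratum G → ℝ) :
    ContDiffOn ℝ ∞ (f ∘ Function.invFun (stratumEmbedding h hp hq hpq))
      (stratumEmbedding h hp hq hpq '' U) ↔ ∀ c ∈ U, StratumSmoothAt f c := by
  set E := stratumHomeomorph h hp hq hpq with hE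
  set κ := stratumEmbedding h hp hq hpq with hκ
  have hκE (x) : κ (E x) = annulusMap componentNumber x := by
    rw [hκ, stratumEmbedding, Function.comp_apply, ← hE, Homeomorph.symm_apply_apply]
  have hinv := invFun_stratumEmbedding h hp hq hpq
  have hopen : IsOpen (κ '' U) :=
    (isOpenEmbedding_stratumEmbedding h hp hq hpq).isOpenMap _ U.isOpen
  constructor
  · intro hf c hc ρ hρ
    obtain ⟨m, n, hmn⟩ := exists_bezout_nat hp.pos hq.pos hpq
    set j := (E.symm c).1 with hj
    set P := tuplePosition (halfRoot p j.1) (halfRoot q j.2) m n (p + q) (componentNumber j)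
    have hP : ContDiffOn ℝ ∞ P {M | 3 - tupleTrace 0 M ≠ 0} := contDiffOn_tuplePosition _ _ _ _ _ _
    have hV : IsOpen {M : Fin 10 → Fin 3 → Fin 3 → ℂ | 3 - tupleTrace 0 M ≠ 0} :=
      isOpen_ne.preimage (continuous_const.sub (contDiff_tupleTrace 0).continuous)
    have hV' := hP.continuousOn.isOpen_inter_preimage hV hopen
    have hg : ContDiffOn ℝ ∞ ((f ∘ Function.invFun κ) ∘ P)
        ({M | 3 - tupleTrace 0 M ≠ 0} ∩ P ⁻¹' (κ '' U)) :=
      hf.comp (hP.mono inter_subset_left) fun M hM => hM.2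
    have hρP := tuplePosition_eq h hp hq hpq hmn ρ c hρ
    obtain ⟨F, hF, hFe⟩ := exists_contDiff_eventuallyEq hV' hg
      (x := fun i j k => (ρ (traceWords u v i)).1 j k)
      ⟨hρP.2, by
        rw [mem_preimage]
        exact ⟨c, hc, hρP.1.symm⟩⟩
    refine ⟨10, traceWords u v, F, hF, ?_⟩
    have hcont : Continuous fun (σ : SU3Hom G) (i : Fin 10) (j k : Fin 3) =>
        (σ (traceWords u v i)).1 j k :=
      continuous_pi fun i => continuous_pi fun j => continuous_pi fun k =>
        ((continuous_subtype_val.comp (continuous_eval (traceWords u v i))).matrix_elem j k)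
    -- The formula `P` belongs to the component of `c`, so `σ` is restricted to representations
    -- whose class, if in the stratum, lies in that component.
    obtain ⟨O, hO, hO'⟩ := isOpen_induced_iff.1 (cylinderOpens E j).isOpen
    have hcO : repClass ρ ∈ O := by
      rw [hρ]
      change c ∈ Subtype.val ⁻¹' O
      rw [hO']
      rfl
    filter_upwards [hcont.continuousAt.eventually hFe,
      (continuous_repClass.isOpen_preimage O hO).mem_nhds hcO] with σ h1 h2 hσ
    have h3 : (E.symm ⟨repClass σ, hσ⟩).1 = j := by
      have : (⟨repClass σ, hσ⟩ : redStratum G) ∈ Subtype.val ⁻¹' O := h2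
      rw [hO'] at this
      exact this
    have h4 := (tuplePosition_eq h hp hq hpq hmn σ ⟨repClass σ, hσ⟩ rfl).1
    rw [← hE, h3] at h4
    rw [h1]
    exact congrArg f ((congrArg (Function.invFun κ) h4).trans (hinv _)).symm
  · rintro hf _ ⟨c, hc, rfl⟩
    refine ContDiffAt.contDiffWithinAt ?_
    obtain ⟨x, rfl⟩ := E.surjective c
    obtain ⟨j, s₀, τ₀⟩ := x
    obtain ⟨n, w, F, hF, hw⟩ := hf _ hc (stdRep h (halfRoot_pow j.1) (halfRoot_pow j.2)
      (openToUnit s₀, τ₀)) rfl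
    rw [hκE]
    set z₀ := annulusMap componentNumber (j, s₀, τ₀) with hz₀
    obtain ⟨hne, hIoo⟩ := (eventually_annulus componentNumber (j, s₀, τ₀)).self_of_nhds
    set I := annulusInv componentNumber j with hI
    have hI0 : I z₀ = (s₀, τ₀) := annulusInv_annulusMap componentNumber (j, s₀, τ₀)
    have hIc : ContinuousAt I z₀ := continuousAt_annulusInv componentNumber (j, s₀, τ₀)
    set R : ℂ → SU3Hom G := fun z => stdRep h (halfRoot_pow j.1) (halfRoot_pow j.2)
      (openToUnit (I z).1, (I z).2) with hR
    have hRc : ContinuousAt R z₀ := by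
      have : Continuous fun y : openUnitInterval × Circle =>
          stdRep h (halfRoot_pow j.1) (halfRoot_pow j.2) (openToUnit y.1, y.2) :=
        (continuous_stdRep ..).comp
          ((continuous_openToUnit.comp continuous_fst).prodMk continuous_snd)
      exact this.continuousAt.comp hIc
    have hs : ContDiffAt ℝ ∞ (fun z => ((openToUnit (I z).1 : unitInterval) : ℝ)) z₀ := by
      have h1 : ContDiffAt ℝ ∞ (fun z : ℂ => ‖z‖ - 1 - (componentNumber j : ℝ)) z₀ :=
        ((contDiffAt_norm ℝ hne).sub contDiffAt_const).sub contDiffAt_const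
      refine h1.congr_of_eventuallyEq ?_
      filter_upwards [eventually_annulus componentNumber (j, s₀, τ₀)] with z hz
      exact coe_openClamp hz.2
    have hτ : ContDiffAt ℝ ∞ (fun z => ((I z).2 : ℂ)) z₀ := by
      have h2 : ContDiffAt ℝ ∞ (fun z : ℂ => (‖z‖ : ℂ)) z₀ :=
        Complex.ofRealCLM.contDiff.contDiffAt.comp z₀ (contDiffAt_norm ℝ hne)
      have h3 : (‖z₀‖ : ℂ) ≠ 0 := by exact_mod_cast norm_ne_zero_iff.2 hne
      refine (contDiffAt_id.mul (h2.inv h3)).congr_of_eventuallyEq ?_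
      filter_upwards [eventually_annulus componentNumber (j, s₀, τ₀)] with z hz
      exact coe_unitPart hz.1
    -- Strictly inside the interval both `s` and `1 - s` are nonzero, so their square roots are
    -- smooth.
    have hs0 := hs.sqrt (by
      rw [hI0]
      exact s₀.2.1.ne')
    have hs1 := (contDiffAt_const (c := (1 : ℝ))).sub hs |>.sqrt (by
      rw [hI0]
      exact (sub_pos.2 s₀.2.2).ne')
    have hent : ContDiffAt ℝ ∞ (fun z => F fun i j k => (R z (w i)).1 j k) z₀ := by
      refine hF.contDiffAt.comp z₀ ?_
      refine contDiffAt_pi.2 fun i => contDiffAt_pi.2 fun j => contDiffAt_pi.2 fun k => ?_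
      exact contDiffAt_stdRep h _ _ hs hs0 hs1 hτ (w i) j k
    refine hent.congr_of_eventuallyEq ?_
    have hw' : ∀ᶠ z in 𝓝 z₀, ∀ hσ : repClass (R z) ∈ redStratum G,
        f ⟨repClass (R z), hσ⟩ = F fun i j k => (R z (w i)).1 j k := by
      have h0 : R z₀ = stdRep h (halfRoot_pow j.1) (halfRoot_pow j.2) (openToUnit s₀, τ₀) := by
        simp only [hR, hI0]
      rw [← h0] at hw
      exact hRc.eventually hw
    filter_upwards [eventually_annulus componentNumber (j, s₀, τ₀), hw'] with z hz hzw
    have h1 : κ (E (j, I z)) = z := by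
      rw [hκE]
      exact annulusMap_annulusInv componentNumber hz.1 hz.2
    have h2 : Function.invFun κ z = E (j, I z) := by
      rw [← hinv (E (j, I z)), ← hκ, h1]
    rw [Function.comp_apply, h2]
    exact hzw (E (j, I z)).2

end smooth

/-! ### Path components -/

section pathComponents
variable {J X S : Type*} [TopologicalSpace J] [DiscreteTopology J] [TopologicalSpace X]
  [PathConnectedSpace X] [TopologicalSpace S] (e : J × X ≃ₜ S)

theorem joined_iff_of_homeomorph {c d : S} : Joined c d ↔ (e.symm c).1 = (e.symm d).1 := by
  constructor
  · intro h
    obtain ⟨γ⟩ := h.map (continuous_fst.comp e.symm.continuous)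
    have := PreconnectedSpace.constant (Y := J) (f := γ) inferInstance γ.continuous (x := 0) (y := 1)
    simpa using this
  · intro h
    have h1 := (PathConnectedSpace.joined (e.symm c).2 (e.symm d).2).map
      (f := fun x => e ((e.symm c).1, x)) (by fun_prop)
    have h2 : e ((e.symm c).1, (e.symm d).2) = d := by
      rw [h]
      exact e.apply_symm_apply d
    rwa [h2, show e ((e.symm c).1, (e.symm c).2) = c from e.apply_symm_apply c] at h1

theorem pathComponent_eq_of_homeomorph (c : S) :
    pathComponent c = {d | (e.symm d).1 = (e.symm c).1} := by
  ext d
  rw [mem_ofPred_eq, eq_comm, ← joined_iff_of_homeomorph]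
  rfl

/-- The path components of a disjoint union of path connected spaces. -/
noncomputable def zerothHomotopyEquiv : ZerothHomotopy S ≃ J :=
  Equiv.ofBijective
    (Quotient.lift (fun c => (e.symm c).1) fun _ _ h => (joined_iff_of_homeomorph e).1 h) (by
      constructor
      · intro a b
        induction a using Quotient.inductionOn
        induction b using Quotient.inductionOn
        exact fun h => Quotient.sound ((joined_iff_of_homeomorph e).2 h)
      · intro j
        obtain ⟨x⟩ := (inferInstance : Nonempty X)
        refine ⟨Quotient.mk _ (e (j, x)), ?_⟩
        change (e.symm (e (j, x))).1 = j
        rw [Homeomorph.symm_apply_apply])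

instance : PathConnectedSpace openUnitInterval :=
  isPathConnected_iff_pathConnectedSpace.1
    ((convex_Ioo (0 : ℝ) 1).isPathConnected ⟨1 / 2, by norm_num, by norm_num⟩)

instance : PathConnectedSpace Circle :=
  (show Function.Surjective Circle.exp from fun z => ⟨z.1.arg, Circle.exp_arg z⟩).pathConnectedSpace
    Circle.exp.continuous

instance : PathConnectedSpace (openUnitInterval × Circle) where
  nonempty := inferInstance
  joined x y := by
    obtain ⟨γ⟩ := PathConnectedSpace.joined x.1 y.1
    obtain ⟨δ⟩ := PathConnectedSpace.joined x.2 y.2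
    exact ⟨γ.prod δ⟩

end pathComponents

/-! ### Closures of the components -/

section closure
variable {G : Type} [Group G] {p q : ℕ} {u v : G}

instance : CompactSpace SU3 := by
  suffices h : IsCompact ((Matrix.specialUnitaryGroup (Fin 3) ℂ : Submonoid _) :
    Set (Matrix (Fin 3) (Fin 3) ℂ)) from isCompact_iff_compactSpace.1 h
  refine IsCompact.of_isClosed_subset
    (isCompact_univ_pi fun _ : Fin 3 => isCompact_univ_pi fun _ : Fin 3 =>
      isCompact_closedBall (0 : ℂ) 1) ?_ ?_
  · have : ((Matrix.specialUnitaryGroup (Fin 3) ℂ : Submonoid _) : Set (Matrix (Fin 3) (Fin 3) ℂ)) =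
        {M | M * star M = 1} ∩ {M | M.det = 1} := by
      ext M
      rw [SetLike.mem_coe, Matrix.mem_specialUnitaryGroup_iff, Matrix.mem_unitaryGroup_iff]
      rfl
    rw [this]
    exact (isClosed_eq (by fun_prop) continuous_const).inter
      (isClosed_eq (Continuous.matrix_det continuous_id) continuous_const)
  · exact fun M hM i _ j _ => mem_closedBall_zero_iff.2
      (entry_norm_bound_of_unitary (Matrix.mem_specialUnitaryGroup_iff.1 hM).1 i j)

instance : T2Space (SU3Hom G) :=
  T2Space.of_injective_continuous (f := fun (ρ : SU3Hom G) (g : G) => ρ g)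
    (fun _ _ h => MonoidHom.ext (congrFun h)) continuous_induced_dom

theorem continuous_conj : Continuous fun x : SU3 × SU3Hom G => x.2.conj x.1 := by
  refine continuous_induced_rng.2 (continuous_pi fun g => ?_)
  exact (continuous_fst.mul ((continuous_eval g).comp continuous_snd)).mul continuous_fst.inv

/-- The saturation of `K` is the image of the compact space `SU3 × K` under conjugation, hence
closed in the Hausdorff space of representations. No separation property of the quotient is needed.
-/
theorem isClosed_image_repClass {K : Set (SU3Hom G)} (hK : IsCompact K) :
    IsClosed (repClass '' K) := by
  rw [← isQuotientMap_quotient_mk'.isClosed_preimage]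
  have : Quotient.mk' ⁻¹' (repClass '' K) =
      (fun x : SU3 × SU3Hom G => x.2.conj x.1) '' (univ ×ˢ K) := by
    ext σ
    constructor
    · rintro ⟨ρ, hρ, h⟩
      obtain ⟨a, ha⟩ := repClass_eq_iff.1 h
      exact ⟨(a, ρ), ⟨trivial, hρ⟩, MonoidHom.ext fun g => (ha g).symm⟩
    · rintro ⟨⟨a, ρ⟩, ⟨-, hρ⟩, rfl⟩
      exact ⟨ρ, hρ, (repClass_conj a ρ).symm⟩
  rw [this]
  exact ((isCompact_univ.prod hK).image continuous_conj).isClosed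

theorem isClosed_range_stdClass (h : IsTorusKnotGroup p q u v) (j : ComponentIndex p q) :
    IsClosed (range (stdClass h j)) := by
  have := isClosed_image_repClass
    (isCompact_range (continuous_stdRep h (halfRoot_pow j.1) (halfRoot_pow j.2)))
  rwa [← range_comp] at this

theorem dense_openUnitInterval : Dense (range openToUnit) := by
  rw [Subtype.dense_iff]
  have : Subtype.val '' range openToUnit = Ioo (0 : ℝ) 1 := by
    ext r
    constructor
    · rintro ⟨_, ⟨s, rfl⟩, rfl⟩
      exact s.2
    · exact fun hr => ⟨_, ⟨⟨r, hr⟩, rfl⟩, rfl⟩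
  rw [this, closure_Ioo zero_ne_one]

/-- The closed cylinder has closed image by compactness, and the open cylinder is dense in it. -/
theorem closure_image_stdClass (h : IsTorusKnotGroup p q u v) (j : ComponentIndex p q) :
    closure (range fun x : openUnitInterval × Circle => stdClass h j (openToUnit x.1, x.2)) =
      range (stdClass h j) := by
  refine subset_antisymm (closure_minimal ?_ (isClosed_range_stdClass h j)) ?_
  · rintro _ ⟨x, rfl⟩
    exact mem_range_self _
  · have hd : Dense (range openToUnit ×ˢ (univ : Set Circle)) :=
      dense_openUnitInterval.prod dense_univ
    refine ((continuous_stdClass h j).range_subset_closure_image_dense hd).trans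
      (closure_mono ?_)
    rintro _ ⟨⟨_, τ⟩, ⟨⟨s, rfl⟩, -⟩, rfl⟩
    exact ⟨(s, τ), rfl⟩

theorem closure_cylinderOpens (h : IsTorusKnotGroup p q u v) (hp : Odd p) (hq : Odd q)
    (hpq : Nat.Coprime p q) (j : ComponentIndex p q) :
    closure (Subtype.val '' (cylinderOpens (stratumHomeomorph h hp hq hpq) j : Set (redStratum G))) =
      Subtype.val '' (cylinderOpens (stratumHomeomorph h hp hq hpq) j : Set (redStratum G)) ∪
        (range (fun τ => stdClass h j (0, τ)) ∪ range fun τ => stdClass h j (1, τ)) := by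
  have h1 : Subtype.val '' (cylinderOpens (stratumHomeomorph h hp hq hpq) j : Set (redStratum G)) =
      range fun x : openUnitInterval × Circle => stdClass h j (openToUnit x.1, x.2) := by
    ext c
    constructor
    · rintro ⟨c, hc, rfl⟩
      obtain ⟨x, rfl⟩ := (stratumHomeomorph h hp hq hpq).surjective c
      have hx : ((stratumHomeomorph h hp hq hpq).symm (stratumHomeomorph h hp hq hpq x)).1 = j := hc
      rw [Homeomorph.symm_apply_apply] at hx
      subst hx
      exact ⟨x.2, rfl⟩
    · rintro ⟨x, rfl⟩
      refine ⟨stratumHomeomorph h hp hq hpq (j, x), ?_, rfl⟩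
      change ((stratumHomeomorph h hp hq hpq).symm (stratumHomeomorph h hp hq hpq (j, x))).1 = j
      rw [Homeomorph.symm_apply_apply]
  rw [h1, closure_image_stdClass]
  ext c
  constructor
  · rintro ⟨⟨s, τ⟩, rfl⟩
    rcases eq_or_lt_of_le s.2.1 with h0 | h0
    · exact Or.inr (Or.inl ⟨τ, by rw [show s = 0 from Subtype.ext h0.symm]⟩)
    · rcases eq_or_lt_of_le s.2.2 with h2 | h2
      · exact Or.inr (Or.inr ⟨τ, by rw [show s = 1 from Subtype.ext h2]⟩)
      · exact Or.inl ⟨(⟨s, h0, h2⟩, τ), rfl⟩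
  · rintro (⟨x, rfl⟩ | ⟨τ, rfl⟩ | ⟨τ, rfl⟩) <;> exact mem_range_self _

end closure

/-! ### Coincidences of spectra along the boundary circles -/

section unitTriples

theorem Circle.star_eq_mul {x y z : Circle} (h : x * y * z = 1) : star (x : ℂ) = y * z := by
  have h1 := Circle.mul_star_coe x
  have h2 : (x : ℂ) * y * z = 1 := by exact_mod_cast congrArg Circle.coeHom h
  linear_combination (y : ℂ) * z * h1 - star (x : ℂ) * h2

/-- The eigenvalues of a matrix in `SU(3)` are determined by its trace. -/
theorem Circle.eq_or_eq_of_sum_eq {x y z x' y' z' : Circle} (h : x * y * z = 1)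
    (h' : x' * y' * z' = 1) (hs : (x : ℂ) + y + z = x' + y' + z') : z' = x ∨ z' = y ∨ z' = z := by
  have e1 := Circle.star_eq_mul h
  have e2 := Circle.star_eq_mul (by rw [← h, mul_comm, ← mul_assoc] : y * z * x = 1)
  have e3 := Circle.star_eq_mul (by rw [← h, mul_assoc, mul_comm] : z * x * y = 1)
  have f1 := Circle.star_eq_mul h'
  have f2 := Circle.star_eq_mul (by rw [← h', mul_comm, ← mul_assoc] : y' * z' * x' = 1)
  have f3 := Circle.star_eq_mul (by rw [← h', mul_assoc, mul_comm] : z' * x' * y' = 1)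
  have hs' := congrArg star hs
  simp only [star_add, e1, e2, e3, f1, f2, f3] at hs'
  have hc : (x : ℂ) * y * z = 1 := by exact_mod_cast congrArg Circle.coeHom h
  have hc' : (x' : ℂ) * y' * z' = 1 := by exact_mod_cast congrArg Circle.coeHom h'
  -- For unit eigenvalues with product `1`, the second symmetric function is the conjugate of the
  -- sum. Equal traces thus give equal characteristic polynomials, and `z'` is a root of the first
  -- one.
  have key : ((z' : ℂ) - x) * (z' - y) * (z' - z) = 0 := by
    linear_combination -(z' : ℂ) ^ 2 * hs + (z' : ℂ) * hs' - hc + hc'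
  rcases mul_eq_zero.1 key with key | key
  · rcases mul_eq_zero.1 key with key | key
    · exact Or.inl (Circle.ext (sub_eq_zero.1 key))
    · exact Or.inr (Or.inl (Circle.ext (sub_eq_zero.1 key)))
  · exact Or.inr (Or.inr (Circle.ext (sub_eq_zero.1 key)))

theorem Circle.pair_eq_of_sum_eq {x y z x' y' : Circle} (h : x * y * z = 1)
    (h' : x' * y' * z = 1) (hs : (x : ℂ) + y + z = x' + y' + z) :
    (x = x' ∧ y = y') ∨ (x = y' ∧ y = x') := by
  have hm : x * y = x' * y' := mul_right_cancel (h.trans h'.symm)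
  have hm' : (x : ℂ) * y = x' * y' := by exact_mod_cast congrArg Circle.coeHom hm
  have key : ((x : ℂ) - x') * (x - y') = 0 := by
    linear_combination (x : ℂ) * hs - hm'
  rcases mul_eq_zero.1 key with key | key
  · obtain rfl : x = x' := Circle.ext (sub_eq_zero.1 key)
    exact Or.inl ⟨rfl, mul_left_cancel hm⟩
  · obtain rfl : x = y' := Circle.ext (sub_eq_zero.1 key)
    exact Or.inr ⟨rfl, mul_left_cancel (hm.trans (mul_comm _ _))⟩

theorem eq_one_of_pow_coprime {A : Type*} [Group A] {x : A} {m n : ℕ} (h : Nat.Coprime m n)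
    (hm : x ^ m = 1) (hn : x ^ n = 1) : x = 1 := by
  have := pow_gcd_eq_one.2 ⟨hm, hn⟩
  rwa [h.gcd_eq_one, pow_one] at this

/-- The ratios of the first two eigenvalues along the two boundary circles to the parameter. -/
noncomputable def weightFst (α : Circle) : Fin 2 → Circle := ![α, 1]

/-- See `weightFst`. -/
noncomputable def weightSnd (α β : Circle) : Fin 2 → Circle := ![β, α * β]

/-- The third eigenvalue along the boundary circles. -/
noncomputable def thirdEigenvalue (α β : Circle) (x : Fin 2 × Circle) : Circle :=
  (x.2 * weightFst α x.1 * (x.2 * weightSnd α β x.1))⁻¹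

/-- The trace along the boundary circles. -/
noncomputable def boundaryTrace (α β : Circle) (x : Fin 2 × Circle) : ℂ :=
  (x.2 * weightFst α x.1 : Circle) + (x.2 * weightSnd α β x.1 : Circle) + thirdEigenvalue α β x

variable {p q : ℕ} {α β : Circle} (hp : Odd p) (hq : Odd q) (hpq : Nat.Coprime p q) (hα : α ^ q = 1)
  (hβ : β ^ p = 1) (hα1 : α ≠ 1) (hβ1 : β ≠ 1)

section
include hpq hα hβ hβ1

theorem weightFst_ne_weightSnd (i : Fin 2) : weightFst α i ≠ weightSnd α β i := by
  intro h
  have h2 : β ^ q = 1 := by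
    have h3 := congrArg (· ^ q) h
    fin_cases i
    · simpa [weightFst, weightSnd, hα] using h3.symm
    · simpa [weightFst, weightSnd, hα, mul_pow] using h3.symm
  exact hβ1 (eq_one_of_pow_coprime hpq hβ h2)

include hp hq hα1

/-- The first two eigenvalues agree as unordered pairs. Any matching other than the identity forces
one of `α ^ 2 = β ^ 2`, `α ^ 2 = 1`, `β ^ 2 = 1` or `(α * β) ^ 2 = 1`, excluded because `α` and `β`
are nontrivial of coprime odd orders. -/
theorem eq_of_thirdEigenvalue_eq {x y : Fin 2 × Circle}
    (h : boundaryTrace α β x = boundaryTrace α β y)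
    (h3 : thirdEigenvalue α β x = thirdEigenvalue α β y) : x = y := by
  obtain ⟨i, s⟩ := x
  obtain ⟨k, t⟩ := y
  have hα2 : α ^ 2 ≠ 1 := fun h => hα1 (eq_one_of_pow_coprime hq.coprime_two_left h hα)
  have hβ2 : β ^ 2 ≠ 1 := fun h => hβ1 (eq_one_of_pow_coprime hp.coprime_two_left h hβ)
  have c (z w : Circle) (h : (z : ℂ) = w) : z = w := Circle.ext h
  have hs0 := Circle.coe_ne_zero s
  have ht0 := Circle.coe_ne_zero t
  have ha0 := Circle.coe_ne_zero α
  have hb0 := Circle.coe_ne_zero β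
  have αβ : α ^ 2 ≠ β ^ 2 := by
    intro h
    have h1 : (β ^ 2) ^ q = 1 := by rw [← h, ← pow_mul, mul_comm, pow_mul, hα, one_pow]
    rw [← pow_mul] at h1
    exact hβ1 (eq_one_of_pow_coprime (Nat.Coprime.mul_right hp.coprime_two_right hpq) hβ h1)
  have αβ' : (α * β) ^ 2 ≠ 1 := by
    intro h
    have h1 : ((α * β) ^ 2) ^ q = 1 := by rw [h, one_pow]
    rw [← pow_mul, mul_pow, mul_comm 2 q, pow_mul α, hα, one_pow, one_mul, mul_comm] at h1
    exact hβ1 (eq_one_of_pow_coprime (Nat.Coprime.mul_right hp.coprime_two_right hpq) hβ h1)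
  have hsum := h
  rw [boundaryTrace, boundaryTrace, h3] at hsum
  have hinv := mul_inv_cancel ((i, s).2 * weightFst α (i, s).1 * ((i, s).2 * weightSnd α β (i, s).1))
  change _ * thirdEigenvalue α β (i, s) = 1 at hinv
  rw [h3] at hinv
  have H := Circle.pair_eq_of_sum_eq hinv (mul_inv_cancel (_ * _)) hsum
  have C {z w : Circle} (h : z = w) : (z : ℂ) = w := congrArg _ h
  fin_cases i <;> fin_cases k <;>
    simp only [weightFst, weightSnd, Fin.zero_eta, Fin.mk_one, Matrix.cons_val_zero,
      Matrix.cons_val_one, Fin.isValue, mul_one] at H ⊢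
  · rcases H with ⟨h1, h2⟩ | ⟨h1, h2⟩
    · rw [mul_right_cancel h1]
    · refine absurd (c _ _ ?_) αβ
      have h1 := C h1
      have h2 := C h2
      push_cast at h1 h2 ⊢
      refine mul_left_cancel₀ (mul_ne_zero hs0 ht0) ?_
      linear_combination (t : ℂ) * α * h1 - (t : ℂ) * β * h2
  · rcases H with ⟨h1, h2⟩ | ⟨h1, h2⟩
    · refine absurd (c _ _ ?_) hα2
      have h1 := C h1
      have h2 := C h2
      push_cast at h1 h2 ⊢
      refine mul_left_cancel₀ (mul_ne_zero hs0 hb0) ?_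
      linear_combination (α : ℂ) * β * h1 - h2
    · refine absurd (c _ _ ?_) hβ2
      have h1 := C h1
      have h2 := C h2
      push_cast at h1 h2 ⊢
      refine mul_left_cancel₀ (mul_ne_zero hs0 ha0) ?_
      linear_combination (α : ℂ) * β * h2 - h1
  · rcases H with ⟨h1, h2⟩ | ⟨h1, h2⟩
    · refine absurd (c _ _ ?_) hα2
      have h1 := C h1
      have h2 := C h2
      push_cast at h1 h2 ⊢
      refine mul_left_cancel₀ (mul_ne_zero ht0 hb0) ?_
      linear_combination h2 - (α : ℂ) * β * h1
    · refine absurd (c _ _ ?_) hβ2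
      have h1 := C h1
      have h2 := C h2
      push_cast at h1 h2 ⊢
      refine mul_left_cancel₀ (mul_ne_zero ht0 ha0) ?_
      linear_combination h2 - (α : ℂ) * β * h1
  · rcases H with ⟨h1, h2⟩ | ⟨h1, h2⟩
    · rw [h1]
    · refine absurd (c _ _ ?_) αβ'
      have h1 := C h1
      have h2 := C h2
      push_cast at h1 h2 ⊢
      refine mul_left_cancel₀ ht0 ?_
      linear_combination h2 - (α : ℂ) * β * h1

omit hp hq hpq hα hβ hα1 hβ1 in
theorem thirdEigenvalue_mem {x y : Fin 2 × Circle}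
    (h : boundaryTrace α β x = boundaryTrace α β y) :
    thirdEigenvalue α β y = x.2 * weightFst α x.1 ∨ thirdEigenvalue α β y = x.2 * weightSnd α β x.1 ∨
      thirdEigenvalue α β y = thirdEigenvalue α β x :=
  Circle.eq_or_eq_of_sum_eq (mul_inv_cancel _) (mul_inv_cancel _) h

theorem thirdEigenvalue_mem_of_ne {x y : Fin 2 × Circle}
    (h : boundaryTrace α β x = boundaryTrace α β y) (hxy : x ≠ y) :
    thirdEigenvalue α β y = x.2 * weightFst α x.1 ∨
      thirdEigenvalue α β y = x.2 * weightSnd α β x.1 := by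
  rcases thirdEigenvalue_mem h with h1 | h1 | h1
  · exact Or.inl h1
  · exact Or.inr h1
  · exact absurd (eq_of_thirdEigenvalue_eq hp hq hpq hα hβ hα1 hβ1 h h1.symm) hxy

/-- The ratio of the third eigenvalues of two further points with the same trace. -/
theorem thirdEigenvalue_ratio {x y z : Fin 2 × Circle}
    (hxy : boundaryTrace α β x = boundaryTrace α β y)
    (hxz : boundaryTrace α β x = boundaryTrace α β z) (h1 : x ≠ y) (h2 : x ≠ z) (h3 : y ≠ z) :
    (thirdEigenvalue α β y * (thirdEigenvalue α β z)⁻¹) ^ q ∈ ({β ^ q, (β ^ q)⁻¹} : Set Circle) ∧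
    (thirdEigenvalue α β y * (thirdEigenvalue α β z)⁻¹) ^ p ∈ ({α ^ p, (α ^ p)⁻¹} : Set Circle) := by
  have hne : thirdEigenvalue α β y ≠ thirdEigenvalue α β z := fun h =>
    h3 (eq_of_thirdEigenvalue_eq hp hq hpq hα hβ hα1 hβ1 (hxy.symm.trans hxz) h)
  obtain ⟨i, t⟩ := x
  have H1 := thirdEigenvalue_mem_of_ne hp hq hpq hα hβ hα1 hβ1 hxy h1
  have H2 := thirdEigenvalue_mem_of_ne hp hq hpq hα hβ hα1 hβ1 hxz h2
  fin_cases i <;> simp only [weightFst, weightSnd, Fin.zero_eta, Fin.mk_one, Matrix.cons_val_zero,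
      Matrix.cons_val_one, Fin.isValue, mul_one] at H1 H2 <;>
    rcases H1 with H1 | H1 <;> rcases H2 with H2 | H2 <;>
    first
    | exact absurd (H1.trans H2.symm) hne
    | (rw [H1, H2]
       constructor <;> simp [mul_pow, hα, hβ, mul_assoc])

end

/-- A product of three factors `b` or `b⁻¹` has exponent `±1` or `±3`. -/
theorem cube_eq_one {A : Type*} [CommGroup A] {b x y z : A} (hx : x ∈ ({b, b⁻¹} : Set A))
    (hy : y ∈ ({b, b⁻¹} : Set A)) (hz : z ∈ ({b, b⁻¹} : Set A)) (h : x * y * z = 1) : b ^ 3 = 1 := by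
  have key (hb : b = 1) : b ^ 3 = 1 := by rw [hb, one_pow]
  have cube (hb : b * b * b = 1) : b ^ 3 = 1 := by rw [pow_succ, pow_two, hb]
  rcases hx with rfl | rfl <;> rcases hy with rfl | rfl <;> rcases hz with rfl | rfl
  · exact cube h
  · exact key (by rwa [mul_inv_cancel_right] at h)
  · exact key (by rwa [mul_inv_cancel, one_mul] at h)
  · exact key (by rwa [mul_inv_cancel, one_mul, inv_eq_one] at h)
  · exact key (by rwa [inv_mul_cancel, one_mul] at h)
  · exact key (by rwa [inv_mul_cancel, one_mul, inv_eq_one] at h)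
  · exact key (by rwa [inv_mul_cancel_right, inv_eq_one] at h)
  · exact cube (by rwa [← mul_inv, ← mul_inv, inv_eq_one] at h)

include hp hq hpq hα hβ hα1 hβ1 in
-- For a triple point, the three ratios of third eigenvalues have product `1`. Their `q`-th and
-- `p`-th powers then give `β ^ (3 * q) = 1` and `α ^ (3 * p) = 1`, so `3` divides both `p` and `q`,
-- contradicting coprimality.
theorem encard_boundaryTrace_le (d : ℂ) : {x | boundaryTrace α β x = d}.encard ≤ 2 := by
  by_contra hlt
  obtain ⟨t, ht, h3⟩ := exists_subset_encard_eq (Order.add_one_le_of_lt (not_le.1 hlt))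
  obtain ⟨x, y, z, hxy, hxz, hyz, rfl⟩ := encard_eq_three.1 h3
  obtain ⟨hx, hy, hz⟩ : boundaryTrace α β x = d ∧ boundaryTrace α β y = d ∧ boundaryTrace α β z = d :=
    ⟨ht (by simp), ht (by simp), ht (by simp)⟩
  have exy : boundaryTrace α β x = boundaryTrace α β y := hx.trans hy.symm
  have eyz : boundaryTrace α β y = boundaryTrace α β z := hy.trans hz.symm
  have ezx : boundaryTrace α β z = boundaryTrace α β x := hz.trans hx.symm
  have r1 := thirdEigenvalue_ratio hp hq hpq hα hβ hα1 hβ1 exy ezx.symm hxy hxz hyz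
  have r2 := thirdEigenvalue_ratio hp hq hpq hα hβ hα1 hβ1 eyz exy.symm hyz hxy.symm hxz.symm
  have r3 := thirdEigenvalue_ratio hp hq hpq hα hβ hα1 hβ1 ezx eyz.symm hxz.symm hyz.symm hxy
  have hprod (n : ℕ) : (thirdEigenvalue α β y * (thirdEigenvalue α β z)⁻¹) ^ n *
      (thirdEigenvalue α β z * (thirdEigenvalue α β x)⁻¹) ^ n *
      (thirdEigenvalue α β x * (thirdEigenvalue α β y)⁻¹) ^ n = 1 := by
    rw [← mul_pow, ← mul_pow]
    simp
  have b3 := cube_eq_one r1.1 r2.1 r3.1 (hprod q)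
  have a3 := cube_eq_one r1.2 r2.2 r3.2 (hprod p)
  rw [← pow_mul] at a3 b3
  have dp : 3 ∣ p := by
    by_contra h
    have h1 : Nat.Coprime p 3 := ((Nat.Prime.coprime_iff_not_dvd Nat.prime_three).2 h).symm
    exact hβ1 (eq_one_of_pow_coprime (Nat.Coprime.mul_right hpq h1) hβ b3)
  have dq : 3 ∣ q := by
    by_contra h
    have h1 : Nat.Coprime q 3 := ((Nat.Prime.coprime_iff_not_dvd Nat.prime_three).2 h).symm
    exact hα1 (eq_one_of_pow_coprime (Nat.Coprime.mul_right hpq.symm h1) hα a3)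
  have := Nat.dvd_gcd dp dq
  rw [hpq.gcd_eq_one] at this
  norm_num at this

include hp hq hpq hα hβ hα1 hβ1 in
-- Raising to the power `p * q` removes the weights. At a double point the third eigenvalue at each
-- point is one of the first two at the other, so `X = x.2 ^ (p * q)` and `Y = y.2 ^ (p * q)`
-- satisfy `Y ^ (-2) = X` and `X ^ (-2) = Y`, whence `X ^ 3 = 1`.
theorem pow_eq_one_of_boundaryTrace_eq {x y : Fin 2 × Circle}
    (h : boundaryTrace α β x = boundaryTrace α β y) (hxy : x ≠ y) : x.2 ^ (3 * (p * q)) = 1 := by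
  have hw (i : Fin 2) : weightFst α i ^ (p * q) = 1 ∧ weightSnd α β i ^ (p * q) = 1 := by
    have h1 : α ^ (p * q) = 1 := by rw [mul_comm, pow_mul, hα, one_pow]
    have h2 : β ^ (p * q) = 1 := by rw [pow_mul, hβ, one_pow]
    fin_cases i <;> simp [weightFst, weightSnd, mul_pow, h1, h2]
  have key {x y : Fin 2 × Circle} (h : boundaryTrace α β x = boundaryTrace α β y) (hxy : x ≠ y) :
      (y.2 ^ (p * q) * y.2 ^ (p * q))⁻¹ = x.2 ^ (p * q) := by
    rcases thirdEigenvalue_mem_of_ne hp hq hpq hα hβ hα1 hβ1 h hxy with h1 | h1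
    · have := congrArg (· ^ (p * q)) h1
      simpa [thirdEigenvalue, mul_pow, (hw x.1).1, (hw x.1).2, (hw y.1).1, (hw y.1).2] using this
    · have := congrArg (· ^ (p * q)) h1
      simpa [thirdEigenvalue, mul_pow, (hw x.1).1, (hw x.1).2, (hw y.1).1, (hw y.1).2] using this
  have h1 := key h hxy
  have h2 := key h.symm hxy.symm
  rw [mul_comm, pow_mul]
  rw [← h2] at h1
  set t := x.2 ^ (p * q)
  have h3 : t * t * (t * t) = t := by
    rwa [mul_inv, inv_inv] at h1
  have h4 : t * t * t = 1 := mul_right_cancel (b := t) (by rw [one_mul, mul_assoc]; exact h3)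
  rw [pow_succ, pow_two, h4]

end unitTriples

/-! ### Immersion and double points of the boundary circles -/

section boundary
variable {G : Type} [Group G] {p q : ℕ} {u v : G}

theorem Circle.finite_pow_eq_one {n : ℕ} (hn : n ≠ 0) : {z : Circle | z ^ n = 1}.Finite := by
  refine Finite.subset (Finite.preimage Circle.coe_injective.injOn
    (Polynomial.nthRoots n (1 : ℂ)).toFinset.finite_toSet) fun z hz => ?_
  have hz' : (z : ℂ) ^ n = 1 := by exact_mod_cast congrArg Circle.coeHom hz
  simpa [Polynomial.mem_nthRoots (Nat.pos_of_ne_zero hn)] using hz'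

/-- A cyclic permutation of the coordinates, as an element of `SU(3)`. -/
def cyclicSU3 : SU3 :=
  ⟨!![0, 1, 0; 0, 0, 1; 1, 0, 0], by
    rw [Matrix.mem_specialUnitaryGroup_iff, Matrix.mem_unitaryGroup_iff]
    constructor
    · ext i k
      fin_cases i <;> fin_cases k <;> simp [Matrix.mul_apply, Fin.sum_univ_three]
    · simp [Matrix.det_fin_three]⟩

theorem cyclicSU3_conj_diag3 (x y : Circle) :
    cyclicSU3 * diag3 (x, y) * cyclicSU3⁻¹ = diag3 (y, (x * y)⁻¹) := by
  rw [mul_inv_eq_iff_eq_mul, SU3.ext_iff_coe]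
  change cyclicSU3.1 * (diag3 (x, y)).1 = (diag3 (y, (x * y)⁻¹)).1 * cyclicSU3.1
  have h1 : (x : ℂ) ≠ 0 := Circle.coe_ne_zero x
  have h2 : (y : ℂ) ≠ 0 := Circle.coe_ne_zero y
  rw [coe_diag3, coe_diag3]
  ext i k
  fin_cases i <;> fin_cases k <;>
    simp [cyclicSU3, Matrix.mul_apply, Fin.sum_univ_three]

section endpoints
variable (h : IsTorusKnotGroup p q u v) {α β : Circle} (hζ : (β ^ q) ^ p = 1)
  (hη : (α ^ p) ^ q = 1) (hα : α ^ q = 1) (hβ : β ^ p = 1)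
include hα in
theorem stdRep_endpoint_left (i : Fin 2) (τ : Circle) : stdRep h hζ hη (![0, 1] i, τ) u =
    diag3 (τ * weightFst α i, τ * weightSnd α β i) ^ q := by
  rw [stdRep_left, ← map_pow]
  fin_cases i <;> simp [weightFst, weightSnd, mul_pow, hα]

include hβ in
theorem stdRep_endpoint_right (i : Fin 2) (τ : Circle) : stdRep h hζ hη (![0, 1] i, τ) v =
    diag3 (τ * weightFst α i, τ * weightSnd α β i) ^ p := by
  rw [← map_pow, SU3.ext_iff_coe, coe_stdRep_right, coe_diag3]
  ext k l
  fin_cases i <;> fin_cases k <;> fin_cases l <;>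
    simp [weightFst, weightSnd, mul_pow, hβ] <;>
    rw [← Circle.coe_inv_eq_conj, ← Circle.coe_inv_eq_conj, Circle.coe_inv, Circle.coe_inv, inv_pow,
      inv_pow, two_mul, pow_add, mul_inv] <;>
    ring

include hα hβ

/-- At the ends of the cylinder the representation factors through `ℤ`, with `u` and `v` acting as
the `q`-th and `p`-th powers of one diagonal matrix; this word is sent to that matrix by the Bezout
relation. -/
theorem stdRep_endpoint_apply {m n : ℕ} (hmn : m * q = n * p + 1) (i : Fin 2) (τ : Circle) :
    stdRep h hζ hη (![0, 1] i, τ) (u ^ m * (v ^ n)⁻¹) =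
      diag3 (τ * weightFst α i, τ * weightSnd α β i) := by
  rw [map_mul, map_inv, map_pow, map_pow, stdRep_endpoint_left h hζ hη hα,
    stdRep_endpoint_right h hζ hη hβ, ← pow_mul, ← pow_mul, mul_comm q, mul_comm p, hmn, pow_succ',
    mul_inv_cancel_right]

/-- At these two parameters one of the first two eigenvalues equals `1`, and both spectra consist of
`1`, the ratio of the weights and its inverse, in cyclically permuted order. This is the source of
noninjectivity. -/
theorem repClass_stdRep_endpoint_eq (i : Fin 2) :
    repClass (stdRep h hζ hη (![0, 1] i, (weightSnd α β i)⁻¹)) =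
      repClass (stdRep h hζ hη (![0, 1] i, (weightFst α i)⁻¹)) := by
  refine repClass_eq_iff.2 ⟨cyclicSU3, fun g => ?_⟩
  have key := cyclicSU3_conj_diag3 ((weightSnd α β i)⁻¹ * weightFst α i) 1
  have : stdRep h hζ hη (![0, 1] i, (weightFst α i)⁻¹) =
      SU3Hom.conj cyclicSU3 (stdRep h hζ hη (![0, 1] i, (weightSnd α β i)⁻¹)) := by
    refine h.hom_ext ?_ ?_
    · rw [SU3Hom.conj_apply, stdRep_endpoint_left h hζ hη hα, stdRep_endpoint_left h hζ hη hα,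
        ← conj_pow]
      simp only [inv_mul_cancel, key, mul_one, mul_inv, inv_inv]
      rw [mul_comm (weightSnd α β i)]
    · rw [SU3Hom.conj_apply, stdRep_endpoint_right h hζ hη hβ, stdRep_endpoint_right h hζ hη hβ,
        ← conj_pow]
      simp only [inv_mul_cancel, key, mul_one, mul_inv, inv_inv]
      rw [mul_comm (weightSnd α β i)]
  rw [this, SU3Hom.conj_apply]

end endpoints

theorem hasDerivAt_boundaryTrace (α β : Circle) (i : Fin 2) (t : ℝ) :
    HasDerivAt (fun s : ℝ => boundaryTrace α β (i, Circle.exp s))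
      (Complex.I * ((Circle.exp t * weightFst α i : Circle) + (Circle.exp t * weightSnd α β i : Circle) -
        2 * thirdEigenvalue α β (i, Circle.exp t))) t := by
  have hz : HasDerivAt (fun s : ℝ => (Circle.exp s : ℂ)) (Complex.I * Circle.exp t) t := by
    simp only [Circle.coe_exp]
    have := ((Complex.ofRealCLM.hasDerivAt (x := t)).mul_const Complex.I).cexp
    simpa [mul_comm] using this
  have h1 := hz.mul_const (weightFst α i : ℂ)
  have h2 := hz.mul_const (weightSnd α β i : ℂ)
  have h0 : (Circle.exp t * weightFst α i : ℂ) * (Circle.exp t * weightSnd α β i) ≠ 0 := by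
    simp [Circle.coe_ne_zero]
  have h3 := (h1.mul h2).inv h0
  have h4 := (h1.add h2).add h3
  simp only [boundaryTrace, thirdEigenvalue, Circle.coe_mul, Circle.coe_inv]
  refine h4.congr_deriv ?_
  have e1 := Circle.coe_ne_zero (Circle.exp t)
  have e2 := Circle.coe_ne_zero (weightFst α i)
  have e3 := Circle.coe_ne_zero (weightSnd α β i)
  simp only [Pi.mul_apply]
  field_simp
  ring

/-- The circle is strictly convex, so the midpoint of two of its points lies on it only if they
coincide. Hence the derivative of the boundary trace can vanish only where the first two eigenvalues
agree. -/
theorem Circle.eq_of_add_eq_two_mul {x y z : Circle} (h : (x : ℂ) + y = 2 * z) : x = y := by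
  have hx := Circle.mul_star_coe x
  have hy := Circle.mul_star_coe y
  have hz := Circle.mul_star_coe z
  have h' := congrArg star h
  simp only [star_add, star_mul, star_ofNat] at h'
  have key : ((x : ℂ) - y) ^ 2 = 0 := by
    linear_combination ((x : ℂ) + y + 2 * z) * h
      + 4 * x * y * hz + 2 * x * y * z * h' - 2 * y * z * hx - 2 * x * z * hy - 2 * z * h
  exact Circle.ext (sub_eq_zero.1 (pow_eq_zero_iff two_ne_zero |>.1 key))

theorem stratumSmoothAt_re_mul_character {S : Set (RepVariety G)} (a : ℂ) (g : G) (c : S) :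
    StratumSmoothAt (fun d : S => (a * character g d.1).re) c := by
  refine fun ρ _ => ⟨1, fun _ => g, fun M => (a * ∑ i, M 0 i i).re, ?_, ?_⟩
  · have : ContDiff ℝ ∞ fun M : Fin 1 → Fin 3 → Fin 3 → ℂ => a * ∑ i, M 0 i i := by fun_prop
    exact Complex.reCLM.contDiff.comp this
  · exact Eventually.of_forall fun σ hσ => rfl

/-- The circle lifts to a smooth family of representations, which gives smoothness. For the
immersion, the real part of `star d` times the character has derivative `|d| ^ 2`. -/
theorem isImmersedCircle_of_stdRep {ζ η : Circle} (h : IsTorusKnotGroup p q u v) (hζ : ζ ^ p = 1)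
    (hη : η ^ q = 1) {S : Set (RepVariety G)} {s : unitInterval} {γ : Circle → S}
    (hγ : ∀ τ, (γ τ).1 = repClass (stdRep h hζ hη (s, τ))) (g : G)
    (hg : ∀ t : ℝ, ∃ d : ℂ, d ≠ 0 ∧
      HasDerivAt (fun x : ℝ => character g (γ (Circle.exp x)).1) d t) : IsImmersedCircle γ where
  smooth := by
    intro t f hf
    obtain ⟨n, w, F, hF, he⟩ := hf _ (hγ _).symm
    have hc : Continuous fun x : ℝ => stdRep h hζ hη (s, Circle.exp x) :=
      (continuous_stdRep h hζ hη).comp (continuous_const.prodMk Circle.exp.continuous)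
    have hexp : ContDiffAt ℝ ∞ (fun x : ℝ => (Circle.exp x : ℂ)) t := by
      simp only [Circle.coe_exp]
      exact ((Complex.ofRealCLM.contDiff.mul contDiff_const).cexp).contDiffAt
    have hsm : ContDiffAt ℝ ∞ (fun x : ℝ => F fun i j k =>
        (stdRep h hζ hη (s, Circle.exp x) (w i)).1 j k) t :=
      hF.contDiffAt.comp t (contDiffAt_pi.2 fun i => contDiffAt_pi.2 fun j => contDiffAt_pi.2 fun k =>
        contDiffAt_stdRep h hζ hη contDiffAt_const contDiffAt_const contDiffAt_const hexp _ _ _)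
    refine hsm.congr_of_eventuallyEq ?_
    filter_upwards [hc.continuousAt.eventually he] with x hx
    rw [← hx (hγ (Circle.exp x) ▸ (γ _).2)]
    exact congrArg f (Subtype.ext (hγ _))
  immersive := by
    intro t
    obtain ⟨d, hd, hder⟩ := hg t
    refine ⟨_, stratumSmoothAt_re_mul_character (star d) g _, ?_⟩
    have h1 : HasDerivAt (fun x : ℝ => (star d * character g (γ (Circle.exp x)).1).re)
        (star d * d).re t := Complex.reCLM.hasFDerivAt.comp_hasDerivAt t (hder.const_mul (star d))
    rw [h1.deriv]
    have : star d * d = (Complex.normSq d : ℂ) := Complex.normSq_eq_conj_mul_self.symm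
    rw [this, Complex.ofReal_re]
    exact (Complex.normSq_pos.2 hd).ne'

/-- The two boundary circles of a component of the reducible stratum. -/
noncomputable def boundaryClass (h : IsTorusKnotGroup p q u v) (j : ComponentIndex p q) (i : Fin 2)
    (τ : Circle) : abStratum G :=
  ⟨stdClass h j (![0, 1] i, τ), _, rfl,
    (stdRep_isAbelian_iff h _ _ _ (halfRoot_ne_one _) (halfRoot_ne_one _)).2 (by fin_cases i <;> simp)⟩

/-- The roots `α` and `β` are powers of the ratios `η` and `ζ`, chosen by the Bezout relation so
that `α ^ p = η` and `β ^ q = ζ`. -/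
theorem exists_boundaryTrace (h : IsTorusKnotGroup p q u v) (hp : Odd p) (hq : Odd q)
    (hpq : Nat.Coprime p q) (j : ComponentIndex p q) : ∃ (α β : Circle) (g : G), α ^ q = 1 ∧ β ^ p = 1 ∧
      α ≠ 1 ∧ β ≠ 1 ∧ (∀ i τ, character g (boundaryClass h j i τ).1 = boundaryTrace α β (i, τ)) ∧
      ∀ i, boundaryClass h j i (weightSnd α β i)⁻¹ = boundaryClass h j i (weightFst α i)⁻¹ := by
  obtain ⟨m, n, hmn⟩ := exists_bezout_nat hp.pos hq.pos hpq
  have hζ := halfRoot_pow j.1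
  have hη := halfRoot_pow j.2
  obtain ⟨α, hα, hα'⟩ : ∃ α : Circle, α ^ q = 1 ∧ α ^ p = halfRoot q j.2 := by
    refine ⟨(halfRoot q j.2 ^ n)⁻¹, ?_, ?_⟩
    · rw [inv_pow, ← pow_mul, mul_comm, pow_mul, hη, one_pow, inv_one]
    · rw [inv_pow, ← pow_mul, inv_eq_iff_mul_eq_one, ← pow_succ, ← hmn, mul_comm, pow_mul, hη, one_pow]
  obtain ⟨β, hβ, hβ'⟩ : ∃ β : Circle, β ^ p = 1 ∧ β ^ q = halfRoot p j.1 := by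
    refine ⟨halfRoot p j.1 ^ m, ?_, ?_⟩
    · rw [← pow_mul, mul_comm, pow_mul, hζ, one_pow]
    · rw [← pow_mul, hmn, pow_succ, mul_comm n, pow_mul, hζ, one_pow, one_mul]
  -- The ratios are generalized so that they can be replaced by powers of `β` and `α` inside the
  -- dependent arguments of `stdRep`.
  have e {ζ η : Circle} (hζ : ζ ^ p = 1) (hη : η ^ q = 1) (h1 : β ^ q = ζ) (h2 : α ^ p = η) i τ :
      character (u ^ m * (v ^ n)⁻¹) (repClass (stdRep h hζ hη (![0, 1] i, τ))) =
        boundaryTrace α β (i, τ) := by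
    subst h1 h2
    rw [character_repClass, stdRep_endpoint_apply h hζ hη hα hβ hmn, coe_diag3, Matrix.trace_fin_three]
    simp [boundaryTrace, thirdEigenvalue]
  have e' {ζ η : Circle} (hζ : ζ ^ p = 1) (hη : η ^ q = 1) (h1 : β ^ q = ζ) (h2 : α ^ p = η) i :
      repClass (stdRep h hζ hη (![0, 1] i, (weightSnd α β i)⁻¹)) =
        repClass (stdRep h hζ hη (![0, 1] i, (weightFst α i)⁻¹)) := by
    subst h1 h2
    exact repClass_stdRep_endpoint_eq h hζ hη hα hβ i
  refine ⟨α, β, u ^ m * (v ^ n)⁻¹, hα, hβ, ?_, ?_, e hζ hη hβ' hα', fun i =>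
    Subtype.ext (e' hζ hη hβ' hα' i)⟩
  · rintro rfl
    exact halfRoot_ne_one j.2 (by rw [← hα', one_pow])
  · rintro rfl
    exact halfRoot_ne_one j.1 (by rw [← hβ', one_pow])

section odd
variable (h : IsTorusKnotGroup p q u v) (hp : Odd p) (hq : Odd q) (hpq : Nat.Coprime p q)
  (j : ComponentIndex p q)
include hp hq hpq

theorem isImmersedCircle_boundaryClass (i : Fin 2) : IsImmersedCircle (boundaryClass h j i) := by
  obtain ⟨α, β, g, hα, hβ, hα1, hβ1, hg, -⟩ := exists_boundaryTrace h hp hq hpq j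
  refine isImmersedCircle_of_stdRep h (halfRoot_pow j.1) (halfRoot_pow j.2) (fun _ => rfl) g
    fun t => ⟨_, ?_, by simpa only [hg] using hasDerivAt_boundaryTrace α β i t⟩
  refine mul_ne_zero Complex.I_ne_zero fun h0 => ?_
  exact weightFst_ne_weightSnd hpq hα hβ hβ1 i
    (mul_left_cancel (Circle.eq_of_add_eq_two_mul (sub_eq_zero.1 h0)))

theorem not_injective_boundaryClass (i : Fin 2) : ¬ Function.Injective (boundaryClass h j i) := by
  obtain ⟨α, β, g, hα, hβ, hα1, hβ1, -, hne⟩ := exists_boundaryTrace h hp hq hpq j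
  exact fun hinj => weightFst_ne_weightSnd hpq hα hβ hβ1 i (inv_injective (hinj (hne i))).symm

theorem encard_boundaryClass_le (d : abStratum G) :
    {x : Fin 2 × Circle | boundaryClass h j x.1 x.2 = d}.encard ≤ 2 := by
  obtain ⟨α, β, g, hα, hβ, hα1, hβ1, hg, -⟩ := exists_boundaryTrace h hp hq hpq j
  refine (encard_le_encard fun x hx => ?_).trans
    (encard_boundaryTrace_le hp hq hpq hα hβ hα1 hβ1 (character g d.1))
  exact (hg x.1 x.2).symm.trans (congrArg (fun c : abStratum G => character g c.1) hx)

theorem finite_double_boundaryClass : {d : abStratum G | ∃ x y : Fin 2 × Circle,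
    x ≠ y ∧ boundaryClass h j x.1 x.2 = d ∧ boundaryClass h j y.1 y.2 = d}.Finite := by
  obtain ⟨α, β, g, hα, hβ, hα1, hβ1, hg, -⟩ := exists_boundaryTrace h hp hq hpq j
  have hfin : {z : Circle | z ^ (3 * (p * q)) = 1}.Finite :=
    Circle.finite_pow_eq_one (mul_ne_zero three_ne_zero (mul_ne_zero hp.pos.ne' hq.pos.ne'))
  refine ((finite_univ (α := Fin 2)).prod hfin |>.image
    fun x => boundaryClass h j x.1 x.2).subset ?_
  rintro d ⟨x, y, hxy, hx, hy⟩
  refine ⟨x, ⟨trivial, ?_⟩, hx⟩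
  refine pow_eq_one_of_boundaryTrace_eq hp hq hpq hα hβ hα1 hβ1 ?_ hxy
  rw [← hg x.1 x.2, ← hg y.1 y.2, hx, hy]

end odd

end boundary

/-! ### Assembling the theorem -/

section stratum
variable {G : Type} [Group G] {p q : ℕ} {u v : G}

/-- The stratum is empty when `p` or `q` equals `1`; the single-chart construction needs a point, so
this case is separate. -/
theorem isInheritedSmoothStructure_of_isEmpty [IsEmpty (redStratum G)]
    [ChartedSpace (EuclideanSpace ℝ (Fin 2)) (redStratum G)] :
    IsInheritedSmoothStructure (redStratum G) :=
  fun _ _ => ⟨fun _ c => isEmptyElim c, fun _ c => isEmptyElim c⟩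

theorem exists_chartedSpace_redStratum (h : IsTorusKnotGroup p q u v) (hp : Odd p) (hq : Odd q)
    (hpq : Nat.Coprime p q) :
    ∃ _ : ChartedSpace (EuclideanSpace ℝ (Fin 2)) (redStratum G),
      IsManifold (𝓡 2) ∞ (redStratum G) ∧ IsInheritedSmoothStructure (redStratum G) ∧
      ∀ j, ∃ Φ : Diffeomorph (𝓘(ℝ, ℝ).prod (𝓡 1)) (𝓡 2) (openUnitInterval × Circle)
        (cylinderOpens (stratumHomeomorph h hp hq hpq) j) ∞,
        ∀ x, (Φ x : redStratum G) = stratumHomeomorph h hp hq hpq (j, x) := by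
  rcases isEmpty_or_nonempty (redStratum G) with hS | hS
  · let _ := ChartedSpace.empty (EuclideanSpace ℝ (Fin 2)) (redStratum G)
    refine ⟨inferInstance, IsManifold.empty _, isInheritedSmoothStructure_of_isEmpty, fun j => ?_⟩
    exact (hS.false (stratumHomeomorph h hp hq hpq
      (j, Classical.arbitrary (openUnitInterval × Circle)))).elim
  · let _ := planeChartedSpace (isOpenEmbedding_stratumEmbedding h hp hq hpq)
    refine ⟨inferInstance, isManifold_planeChartedSpace (isOpenEmbedding_stratumEmbedding h hp hq hpq),
      fun U f => ?_, fun j => ?_⟩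
    · exact (contMDiffOn_planeChartedSpace_iff
        (isOpenEmbedding_stratumEmbedding h hp hq hpq) U f).trans
          (contDiffOn_stratumEmbedding_iff h hp hq hpq U f)
    · exact ⟨cylinderDiffeomorph componentNumber_injective (stratumHomeomorph h hp hq hpq) j,
        fun x => rfl⟩

theorem four_mul_card_componentIndex (hp : Odd p) (hq : Odd q) :
    4 * Nat.card (ComponentIndex p q) = (p - 1) * (q - 1) := by
  obtain ⟨a, rfl⟩ := hp
  obtain ⟨b, rfl⟩ := hq
  simp only [ComponentIndex, Nat.card_eq_fintype_card, Fintype.card_prod, Fintype.card_fin]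
  simp only [Nat.add_sub_cancel, Nat.mul_div_cancel_left _ two_pos]
  ring

theorem IsTorusKnotGroup.redStratum_structure (h : IsTorusKnotGroup p q u v) (hp : Odd p) (hq : Odd q)
    (hpq : Nat.Coprime p q) :
    T2Space (redStratum G) ∧
    SecondCountableTopology (redStratum G) ∧
    ∃ _ : ChartedSpace (EuclideanSpace ℝ (Fin 2)) (redStratum G),
      IsManifold (𝓡 2) ∞ (redStratum G) ∧
      IsInheritedSmoothStructure (redStratum G) ∧
      Finite (ZerothHomotopy (redStratum G)) ∧
      4 * Nat.card (ZerothHomotopy (redStratum G)) = (p - 1) * (q - 1) ∧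
      ∀ c : redStratum G,
        ∃ C : Opens (redStratum G),
          (C : Set (redStratum G)) = pathComponent c ∧
          ∃ (Φ : Diffeomorph (𝓘(ℝ, ℝ).prod (𝓡 1)) (𝓡 2) (openUnitInterval × Circle) C ∞)
            (Ψ : ℝ × Circle → RepVariety G)
            (γ : Fin 2 → Circle → abStratum G),
            ContinuousOn Ψ (Icc (0 : ℝ) 1 ×ˢ univ) ∧
            (∀ (s : openUnitInterval) (z : Circle),
              Ψ ((s : ℝ), z) = ((Φ (s, z) : redStratum G) :
                RepVariety G)) ∧
            (∀ z : Circle, Ψ (0, z) = (γ 0 z : RepVariety G)) ∧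
            (∀ z : Circle, Ψ (1, z) = (γ 1 z : RepVariety G)) ∧
            closure (Subtype.val '' (C : Set (redStratum G))) =
              Subtype.val '' (C : Set (redStratum G)) ∪
                ⋃ i : Fin 2, range (fun z : Circle =>
                  (γ i z : RepVariety G)) ∧
            (∀ i : Fin 2, IsImmersedCircle (γ i) ∧ ¬ Function.Injective (γ i)) ∧
            (∀ d : abStratum G,
              {x : Fin 2 × Circle | γ x.1 x.2 = d}.encard ≤ 2) ∧
            {d : abStratum G |
              ∃ x y : Fin 2 × Circle, x ≠ y ∧ γ x.1 x.2 = d ∧ γ y.1 y.2 = d}.Finite := by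
  have hemb := isOpenEmbedding_stratumEmbedding h hp hq hpq
  set E := stratumHomeomorph h hp hq hpq 
  obtain ⟨cs, hman, hinh, hdiff⟩ := exists_chartedSpace_redStratum h hp hq hpq
  have eqv := zerothHomotopyEquiv E
  refine ⟨T2Space.of_injective_continuous hemb.injective hemb.continuous, hemb.isInducing.secondCountableTopology, cs, hman,
    hinh, Finite.of_equiv _ eqv.symm, ?_, fun c => ?_⟩
  · rw [Nat.card_congr eqv, four_mul_card_componentIndex hp hq]
  set j := (E.symm c).1
  obtain ⟨Φ, hΦ⟩ := hdiff j
  -- The extension clamps the first coordinate to `[0,1]`, so it is continuous everywhere and agrees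
  -- with the closed cylinder on the relevant set.
  refine ⟨cylinderOpens E j, (pathComponent_eq_of_homeomorph E c).symm, Φ,
    fun x => stdClass h j (projIcc 0 1 zero_le_one x.1, x.2), boundaryClass h j, ?_, ?_, ?_, ?_, ?_,
    fun i => ⟨isImmersedCircle_boundaryClass h hp hq hpq j i,
      not_injective_boundaryClass h hp hq hpq j i⟩,
    encard_boundaryClass_le h hp hq hpq j, finite_double_boundaryClass h hp hq hpq j⟩
  · exact ((continuous_stdClass h j).comp ((continuous_projIcc.comp continuous_fst).prodMk
      continuous_snd)).continuousOn
  · intro s z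
    rw [hΦ, stratumHomeomorph_apply]
    exact congrArg (fun s => stdClass h j (s, z)) (projIcc_of_mem _ (Ioo_subset_Icc_self s.2))
  · intro z
    exact congrArg (fun s => stdClass h j (s, z)) (projIcc_left _)
  · intro z
    exact congrArg (fun s => stdClass h j (s, z)) (projIcc_right _)
  · rw [closure_cylinderOpens]
    congr 1
    ext d
    simp only [mem_iUnion, Fin.exists_fin_two]
    rfl

end stratum
theorem theorem3p9 (p q r : ℕ) (hr : 0 < r)
    (hpq : Nat.Coprime p q) (hpr : Nat.Coprime p r) (hqr : Nat.Coprime q r)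
    (hp : Odd p) (hq : Odd q) (z₀ : fiberComplement p q r) :
    -- the stratum is a smooth 2-manifold, for the inherited smooth structure
    T2Space (redStratum (fiberGroup p q r z₀)) ∧
    SecondCountableTopology (redStratum (fiberGroup p q r z₀)) ∧
    ∃ _ : ChartedSpace (EuclideanSpace ℝ (Fin 2)) (redStratum (fiberGroup p q r z₀)),
      IsManifold (𝓡 2) ∞ (redStratum (fiberGroup p q r z₀)) ∧
      IsInheritedSmoothStructure (redStratum (fiberGroup p q r z₀)) ∧
      -- it has `(p - 1) (q - 1) / 4` path components
      Finite (ZerothHomotopy (redStratum (fiberGroup p q r z₀))) ∧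
      4 * Nat.card (ZerothHomotopy (redStratum (fiberGroup p q r z₀))) = (p - 1) * (q - 1) ∧
      -- each path component `C` is open and diffeomorphic to `(0,1) × S¹`
      ∀ c : redStratum (fiberGroup p q r z₀),
        ∃ C : Opens (redStratum (fiberGroup p q r z₀)),
          (C : Set (redStratum (fiberGroup p q r z₀))) = pathComponent c ∧
          ∃ (Φ : Diffeomorph (𝓘(ℝ, ℝ).prod (𝓡 1)) (𝓡 2) (openUnitInterval × Circle) C ∞)
            (Ψ : ℝ × Circle → RepVariety (fiberGroup p q r z₀))
            (γ : Fin 2 → Circle → abStratum (fiberGroup p q r z₀)),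
            -- the diffeomorphism extends continuously to `[0,1] × S¹`,
            -- with the two boundary circles `γ 0`, `γ 1` in the abelian stratum
            ContinuousOn Ψ (Icc (0 : ℝ) 1 ×ˢ univ) ∧
            (∀ (s : openUnitInterval) (z : Circle),
              Ψ ((s : ℝ), z) = ((Φ (s, z) : redStratum (fiberGroup p q r z₀)) :
                RepVariety (fiberGroup p q r z₀))) ∧
            (∀ z : Circle, Ψ (0, z) = (γ 0 z : RepVariety (fiberGroup p q r z₀))) ∧
            (∀ z : Circle, Ψ (1, z) = (γ 1 z : RepVariety (fiberGroup p q r z₀))) ∧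
            -- the closure of `C` in the representation variety adds exactly these circles
            closure (Subtype.val '' (C : Set (redStratum (fiberGroup p q r z₀)))) =
              Subtype.val '' (C : Set (redStratum (fiberGroup p q r z₀))) ∪
                ⋃ i : Fin 2, range (fun z : Circle =>
                  (γ i z : RepVariety (fiberGroup p q r z₀))) ∧
            -- each circle is immersed in the abelian stratum, not injectively
            (∀ i : Fin 2, IsImmersedCircle (γ i) ∧ ¬ Function.Injective (γ i)) ∧
            -- all multiple points of the two circles together are double points,
            -- and there are only finitely many of them
            (∀ d : abStratum (fiberGroup p q r z₀),
              {x : Fin 2 × Circle | γ x.1 x.2 = d}.encard ≤ 2) ∧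
            {d : abStratum (fiberGroup p q r z₀) |
              ∃ x y : Fin 2 × Circle, x ≠ y ∧ γ x.1 x.2 = d ∧ γ y.1 y.2 = d}.Finite := by
  obtain ⟨u, v, h⟩ := exists_isTorusKnotGroup_fiberGroup hp hq hr.ne' hpq hpr hqr z₀
  exact h.redStratum_structure hp hq hpq
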